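/- **Setting.** Let $\Gamma$ be the category of finite sets and partially defined functions, $\Theta\subset\Gamma$ the subcategory with the same objects and with the partially defined functions that are injective on their domain of definition, $\Lambda$ a subcategory of $\Gamma$ containing $\Theta$, and $\mathcal C$ a category. The objects of $\mathcal C\wr\Lambda$ are the finite families $C=(C_e)_{e\in E}$ of objects of $\mathcal C$; a morphism $(C_e)_{e\in E}\to(C'_y)_{y\in F}$ is a morphism $f:E\to F$ of $\Lambda$ together with morphisms $\gamma_e:C_e\to C'_{f(e)}$ of $\mathcal C$ for all $e$ in the domain of definition of $f$. For $M\subset E$ put $\rho_M(C)=(C_e)_{e\in M}$; the inclusion $M\subset E$ gives $i_M^C:\rho_M(C)\to C$, the partial function $E\supset M=M$ gives $r_C^M:C\to\rho_M(C)$ (with identities as components), and $d_{C,M}=i_M^C\circ r_C^M$. For a functor $T:\mathcal C\wr\Lambda\to\mathbf{Ab}$ put $$cr(T)(C)=\bigcap_{U\subsetneq E}\ker T(d_{C,U})\ \cap\ \operatorname{im}T(d_{C,E})=\bigcap_{U\subsetneq E}\ker T(d_{C,U}).$$ $T$ is *polynomial of degree at most $d$* if $T(\varnothing)=0$ and $cr(T)(C)=0$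 for every family $C$ of more than $d$ objects. Put $G_C=\operatorname{Aut}_{\mathcal C\wr\Lambda}(C)$ and $V_C=\{\rho_U(C): U\subset E\}$; $G_C$ acts on $V_C$ through its action on subsets of $E$. For $A=\rho_M(C)\in V_C$ one has $V_A\subset V_C$; extending automorphisms by the identity gives a homomorphism $G_A\to G_C$, and for $U\in V_A$ a homomorphism $G_{A-U}\to G_{C-U}$, where $C-\rho_U(C)=\rho_{E\setminus U}(C)$ and $A-\rho_U(C)=\rho_{M\setminus U}(C)$. Write $\sigma_{\ell,U}:H_\ell(G_{A-U};\mathbf Z)\to H_\ell(G_{C-U};\mathbf Z)$ for the induced map. The cardinality of $\rho_U(C)$ is that of $U$. **Statement.** Let $\kappa:\mathcal C\wr\Lambda\to\mathbf{Gr}$ be a functor, $C$ an object of $\mathcal C\wr\Lambda$, $A\in V_C$, $i\ge 0$ an integer and $(d(q))_{q\geq 1}$ non-negative integers. Suppose that * for every $q>0$ the functor $H_q(\kappa(-);\mathbf Z)$ is polynomial of degree at most $d(q)$; * for every $q\in[1,i]$, every $U\in V_C$ of cardinality at most $d(q)$ lies in $G_C\cdot V_A$ (that is, the inclusion $V_A/G_A\subset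 V_C/G_C$ is an equality in cardinality at most $d(q)$); * for every $q\in[1,i-1]$ and every non-empty $U\in V_A$ of cardinality at most $d(q)$, the map $\sigma_{\ell,U}$ is an isomorphism for $\ell\le i-q$ and an epimorphism for $\ell=i-q+1$; * $\sigma_{\ell,\varnothing}$ is an isomorphism for $\ell\le i$. Then the map $$\mu_\ell: H_\ell(\kappa(A)\rtimes G_A;\mathbf Z)\to H_\ell(\kappa(C)\rtimes G_C;\mathbf Z)$$ induced by $\kappa(i_M^C)$ and $G_A\to G_C$ is an isomorphism for $\ell\le i$. If moreover * every $U\in V_C$ of cardinality at most $d(i+1)$ lies in $G_C\cdot V_A$; * $\sigma_{i+1,\varnothing}$ is an epimorphism; * if $i\ge1$, then $\sigma_{1,U}$ is an epimorphism for every non-empty $U\in V_A$ of cardinality at most $d(i)$, then $\mu_{i+1}$ is an epimorphism. -/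

import Mathlib

open CategoryTheory

universe u v

namespace WreathStability

/-! ### Finite sets and partial functions -/

/-- The objects of the category `Γ`: finite sets. -/
structure FinPart where
  carrier : Type
  [finite : Finite carrier]

namespace FinPart

instance : CoeSort FinPart Type := ⟨carrier⟩

instance (E : FinPart) : Finite E := E.finite

/-- A morphism of `Γ` is a partially defined function: the value of `pfun` at `e` is `f e` if `f` is
defined at `e`, and is undefined otherwise; `y ∈ f.pfun e` means that `f` is defined at `e` and
`f e = y`. -/
@[ext]
structure Hom (E F : FinPart) where
  pfun : E → Part F

/-- The category `Γ` of finite sets and partially defined functions. -/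
instance : Category FinPart where
  Hom := Hom
  id _ := ⟨fun e => Part.some e⟩
  comp f g := ⟨fun e => (f.pfun e).bind g.pfun⟩
  id_comp f := Hom.ext (funext fun e => Part.bind_some e f.pfun)
  comp_id f := Hom.ext (funext fun e => Part.bind_some_right (f.pfun e))
  assoc f g h := Hom.ext (funext fun e => Part.bind_assoc (f.pfun e) g.pfun h.pfun)

theorem hom_ext {E F : FinPart} {f g : E ⟶ F}
    (h : ∀ e y, y ∈ f.pfun e ↔ y ∈ g.pfun e) : f = g :=
  Hom.ext (funext fun e => Part.ext (h e))

theorem mem_id {E : FinPart} (e y : E) : y ∈ Hom.pfun (𝟙 E) e ↔ y = e :=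
  Part.mem_some_iff

theorem mem_comp {E F G : FinPart} (f : E ⟶ F) (g : F ⟶ G) (e : E) (z : G) :
    z ∈ (f ≫ g).pfun e ↔ ∃ y, y ∈ f.pfun e ∧ z ∈ g.pfun y :=
  Part.mem_bind_iff

end FinPart

/-- `Θ`, as a class of morphisms of `Γ`: the partially defined functions that are injective on
their domain of definition. -/
def Theta : MorphismProperty FinPart := fun _ _ f =>
  ∀ e e' y, y ∈ f.pfun e → y ∈ f.pfun e' → e = e'

/-- `Λ` is (the class of morphisms of) a subcategory of `Γ` that contains `Θ`. -/
class ContainsTheta (Λ : MorphismProperty FinPart) : Prop extends Λ.IsMultiplicative where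
  theta_le : Theta ≤ Λ

/-! ### The category `𝒞 ≀ Λ` -/

/-- The objects of `𝒞 ≀ Λ`: finite families of objects of `𝒞`. -/
structure Wreath (𝒞 : Type u) (Λ : MorphismProperty FinPart) where
  idx : FinPart
  fam : idx → 𝒞

namespace Wreath

variable {𝒞 : Type u} [Category.{v} 𝒞] {Λ : MorphismProperty FinPart}

/-- A morphism `(E, (C_e)) ⟶ (F, (C'_f))` of `𝒞 ≀ Λ`: a morphism `f : E ⟶ F` of `Λ` and, for each
`e` in the domain of `f`, a morphism `C_e ⟶ C'_{f e}`. The latter is indexed by the pairs `(e, y)`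
in the graph of `f`, that is, by the `e` in the domain of `f` together with `y = f e`. -/
structure Hom (X Y : Wreath 𝒞 Λ) where
  base : X.idx ⟶ Y.idx
  mem : Λ base
  app : ∀ (e : X.idx) (y : Y.idx), y ∈ base.pfun e → (X.fam e ⟶ Y.fam y)

theorem Hom.ext' {X Y : Wreath 𝒞 Λ} {f g : Hom X Y}
    (h : ∀ e y, y ∈ f.base.pfun e ↔ y ∈ g.base.pfun e)
    (h' : ∀ e y hf hg, f.app e y hf = g.app e y hg) : f = g := by
  obtain ⟨f, _, φ⟩ := f
  obtain ⟨g, _, ψ⟩ := g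
  obtain rfl : f = g := FinPart.hom_ext h
  congr
  funext e y hy
  exact h' e y hy hy

/-- Composition in `𝒞 ≀ Λ`. -/
noncomputable def Hom.comp [Λ.IsMultiplicative] {X Y Z : Wreath 𝒞 Λ} (f : Hom X Y) (g : Hom Y Z) : Hom X Z where
  base := f.base ≫ g.base
  mem := Λ.comp_mem _ _ f.mem g.mem
  app e z hz :=
    have h := (FinPart.mem_comp f.base g.base e z).1 hz
    f.app e h.choose h.choose_spec.1 ≫ g.app h.choose z h.choose_spec.2

theorem Hom.comp_app [Λ.IsMultiplicative] {X Y Z : Wreath 𝒞 Λ} (f : Hom X Y) (g : Hom Y Z)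
    (e : X.idx) (y : Y.idx) (z : Z.idx) (hy : y ∈ f.base.pfun e) (hz : z ∈ g.base.pfun y)
    (h : z ∈ (f.comp g).base.pfun e) :
    (f.comp g).app e z h = f.app e y hy ≫ g.app y z hz := by
  have h' := (FinPart.mem_comp f.base g.base e z).1 h
  have key : ∀ (w : Y.idx) (hw : w ∈ f.base.pfun e) (hw' : z ∈ g.base.pfun w),
      f.app e w hw ≫ g.app w z hw' = f.app e y hy ≫ g.app y z hz := by
    intro w hw hw'
    obtain rfl := Part.mem_unique hw hy
    rfl
  exact key _ h'.choose_spec.1 h'.choose_spec.2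

/-- The identity in `𝒞 ≀ Λ`. -/
def Hom.id [Λ.IsMultiplicative] (X : Wreath 𝒞 Λ) : Hom X X where
  base := 𝟙 X.idx
  mem := Λ.id_mem _
  app e y hy := eqToHom (congrArg X.fam ((FinPart.mem_id e y).1 hy).symm)

/-- The category `𝒞 ≀ Λ`. -/
noncomputable instance [Λ.IsMultiplicative] : Category (Wreath 𝒞 Λ) where
  Hom := Hom
  id := Hom.id
  comp := Hom.comp
  id_comp f := by
    refine Hom.ext' (fun e y => ?_) (fun e y h h' => ?_)
    · change y ∈ (𝟙 _ ≫ f.base).pfun e ↔ _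
      rw [Category.id_comp]
    · rw [Hom.comp_app (Hom.id _) f e e y ((FinPart.mem_id e e).2 rfl) h']
      exact Category.id_comp _
  comp_id f := by
    refine Hom.ext' (fun e y => ?_) (fun e y h h' => ?_)
    · change y ∈ (f.base ≫ 𝟙 _).pfun e ↔ _
      rw [Category.comp_id]
    · rw [Hom.comp_app f (Hom.id _) e y y h' ((FinPart.mem_id y y).2 rfl)]
      exact Category.comp_id _
  assoc {W X Y Z} f g k := by
    refine Hom.ext' (fun e y => ?_) (fun e z h h' => ?_)
    · change y ∈ ((f.base ≫ g.base) ≫ k.base).pfun e ↔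
        y ∈ (f.base ≫ g.base ≫ k.base).pfun e
      rw [Category.assoc]
    · obtain ⟨x, hx, hz⟩ := (FinPart.mem_comp f.base (g.base ≫ k.base) e z).1 h'
      obtain ⟨y, hy, hyz⟩ := (FinPart.mem_comp g.base k.base x z).1 hz
      have h₁ : y ∈ (f.comp g).base.pfun e := (FinPart.mem_comp f.base g.base e y).2 ⟨x, hx, hy⟩
      have h₂ : z ∈ (g.comp k).base.pfun x := hz
      rw [Hom.comp_app (f.comp g) k e y z h₁ hyz, Hom.comp_app f g e x y hx hy,
        Hom.comp_app f (g.comp k) e x z hx h₂, Hom.comp_app g k x y z hy hyz, Category.assoc]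

theorem hom_ext [Λ.IsMultiplicative] {X Y : Wreath 𝒞 Λ} {f g : X ⟶ Y}
    (h : ∀ e y, y ∈ f.base.pfun e ↔ y ∈ g.base.pfun e)
    (h' : ∀ e y hf hg, f.app e y hf = g.app e y hg) : f = g :=
  Hom.ext' h h'

theorem mem_comp_base [Λ.IsMultiplicative] {X Y Z : Wreath 𝒞 Λ} (f : X ⟶ Y) (g : Y ⟶ Z)
    (e : X.idx) (z : Z.idx) :
    z ∈ (f ≫ g).base.pfun e ↔ ∃ y, y ∈ f.base.pfun e ∧ z ∈ g.base.pfun y :=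
  FinPart.mem_comp f.base g.base e z

theorem mem_id_base [Λ.IsMultiplicative] {X : Wreath 𝒞 Λ} (e y : X.idx) :
    y ∈ (Hom.base (𝟙 X)).pfun e ↔ y = e :=
  FinPart.mem_id e y

theorem comp_app [Λ.IsMultiplicative] {X Y Z : Wreath 𝒞 Λ} (f : X ⟶ Y) (g : Y ⟶ Z)
    (e : X.idx) (y : Y.idx) (z : Z.idx) (hy : y ∈ f.base.pfun e) (hz : z ∈ g.base.pfun y)
    (h : z ∈ (f ≫ g).base.pfun e) :
    (f ≫ g).app e z h = f.app e y hy ≫ g.app y z hz :=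
  Hom.comp_app f g e y z hy hz h

theorem id_app [Λ.IsMultiplicative] {X : Wreath 𝒞 Λ} (e y : X.idx)
    (h : y ∈ (Hom.base (𝟙 X)).pfun e) :
    (𝟙 X : X ⟶ X).app e y h = eqToHom (congrArg X.fam ((mem_id_base e y).1 h).symm) :=
  rfl

/-- The empty family. -/
def empty (𝒞 : Type u) (Λ : MorphismProperty FinPart) : Wreath 𝒞 Λ where
  idx := ⟨Empty⟩
  fam := Empty.elim

/-- `ρ_M(C) = (M, (C_e)_{e ∈ M})`, for `C = (E, (C_e)_{e ∈ E})` and `M ⊆ E`. -/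
def restrict (C : Wreath 𝒞 Λ) (M : Set C.idx) : Wreath 𝒞 Λ where
  idx := ⟨M⟩
  fam e := C.fam e.1

variable [ContainsTheta Λ]

/-- `i_M^C : ρ_M(C) ⟶ C`, given by the inclusion `M ⊆ E` and identities. -/
def incl (C : Wreath 𝒞 Λ) (M : Set C.idx) : C.restrict M ⟶ C where
  base := ⟨fun e => Part.some e.1⟩
  mem := ContainsTheta.theta_le _ (by
    intro e e' y h h'
    exact Subtype.ext ((Part.mem_some_iff.1 h).symm.trans (Part.mem_some_iff.1 h')))
  app _ _ hy := eqToHom (congrArg C.fam (Part.mem_some_iff.1 hy).symm)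

/-- `r_C^M : C ⟶ ρ_M(C)`, given by the partial function `E ⊇ M = M` and identities. -/
def retr (C : Wreath 𝒞 Λ) (M : Set C.idx) : C ⟶ C.restrict M where
  base := ⟨fun e => ⟨e ∈ M, fun h => ⟨e, h⟩⟩⟩
  mem := ContainsTheta.theta_le _ (by
    rintro e e' y ⟨h, rfl⟩ ⟨h', e'⟩
    exact (congrArg Subtype.val e').symm)
  app _ _ hy := eqToHom (congrArg C.fam (congrArg Subtype.val hy.choose_spec))

/-- The idempotent `d_{C,M} = i_M^C ∘ r_C^M` of `C`. -/
noncomputable def idem (C : Wreath 𝒞 Λ) (M : Set C.idx) : C ⟶ C := C.retr M ≫ C.incl M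

/-! ### Cross effects and polynomial functors -/

/-- `cr_M(T)(C) = ⋂_{U ⊊ M} ker T(d_{C,U}) ∩ im T(d_{C,M})`. -/
noncomputable def crossEffectAt (T : Wreath 𝒞 Λ ⥤ AddCommGrpCat.{v}) (C : Wreath 𝒞 Λ) (M : Set C.idx) :
    AddSubgroup (T.obj C) :=
  (⨅ U : {U : Set C.idx // U ⊂ M}, (T.map (C.idem U.1)).hom.ker) ⊓ (T.map (C.idem M)).hom.range

/-- `cr(T)(C) = cr_E(T)(C)`, where `E` is the index set of `C`. -/
noncomputable def crossEffect (T : Wreath 𝒞 Λ ⥤ AddCommGrpCat.{v}) (C : Wreath 𝒞 Λ) : AddSubgroup (T.obj C) :=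
  crossEffectAt T C Set.univ

/-- `T` is polynomial of degree at most `d`: `T(∅) = 0`, and `cr(T)(C) = 0` for every family `C`
of more than `d` objects. -/
def IsPolynomialOfDegreeLE (T : Wreath 𝒞 Λ ⥤ AddCommGrpCat.{v}) (d : ℕ) : Prop :=
  Subsingleton (T.obj (empty 𝒞 Λ)) ∧
    ∀ C : Wreath 𝒞 Λ, d < Nat.card C.idx → crossEffect T C = ⊥

/-! ### Automorphism groups

`G_C` is `Aut C`, whose product in Mathlib is the composition of functions
(`g * h` is `h` followed by `g`). -/

/-- The underlying partial function of an automorphism is injective. -/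
theorem theta_base (C : Wreath 𝒞 Λ) (g : Aut C) : Theta g.hom.base := by
  intro e e' y h h'
  have key : ∀ (a : C.idx), y ∈ g.hom.base.pfun a → a ∈ g.inv.base.pfun y := by
    intro a ha
    obtain ⟨z, hz, haz⟩ := (mem_comp_base g.hom g.inv a a).1
      (by rw [g.hom_inv_id]; exact (mem_id_base a a).2 rfl)
    exact Part.mem_unique ha hz ▸ haz
  exact Part.mem_unique (key e h) (key e' h')

open Classical in
/-- The extension by the identity of a partial function from `M` to `M`. -/
noncomputable def extendPFun {E : Type} (M : Set E) (f : M → Part M) : E → Part E := fun e =>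
  if h : e ∈ M then (f ⟨e, h⟩).map Subtype.val else Part.some e

theorem mem_extendPFun_of_mem {E : Type} {M : Set E} {f : M → Part M} {e y : E} (he : e ∈ M) :
    y ∈ extendPFun M f e ↔ ∃ hy : y ∈ M, ⟨y, hy⟩ ∈ f ⟨e, he⟩ := by
  simp [extendPFun, he]

theorem mem_extendPFun_of_notMem {E : Type} {M : Set E} {f : M → Part M} {e y : E} (he : e ∉ M) :
    y ∈ extendPFun M f e ↔ y = e := by
  simp [extendPFun, he]

open Classical in
/-- The extension to `C` of an endomorphism of `ρ_M(C)` (with injective underlying partial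
function) by the identity on `C - ρ_M(C)`. -/
noncomputable def extendHom (C : Wreath 𝒞 Λ) (M : Set C.idx)
    (f : C.restrict M ⟶ C.restrict M) (hf : Theta f.base) : C ⟶ C where
  base := ⟨extendPFun M f.base.pfun⟩
  mem := ContainsTheta.theta_le _ (by
    intro e e' y h h'
    by_cases he : e ∈ M <;> by_cases he' : e' ∈ M
    · obtain ⟨hy, h⟩ := (mem_extendPFun_of_mem he).1 h
      obtain ⟨_, h'⟩ := (mem_extendPFun_of_mem he').1 h'
      exact congrArg Subtype.val (hf _ _ _ h h')
    · obtain ⟨hy, h⟩ := (mem_extendPFun_of_mem he).1 h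
      exact absurd ((mem_extendPFun_of_notMem he').1 h' ▸ hy) he'
    · obtain ⟨hy, h'⟩ := (mem_extendPFun_of_mem he').1 h'
      exact absurd ((mem_extendPFun_of_notMem he).1 h ▸ hy) he
    · exact ((mem_extendPFun_of_notMem he).1 h).symm.trans ((mem_extendPFun_of_notMem he').1 h'))
  app e y hy :=
    if he : e ∈ M then
      have h := (mem_extendPFun_of_mem he).1 hy
      f.app ⟨e, he⟩ ⟨y, h.1⟩ h.2
    else eqToHom (congrArg C.fam ((mem_extendPFun_of_notMem he).1 hy).symm)

theorem extendHom_app_of_mem (C : Wreath 𝒞 Λ) (M : Set C.idx)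
    (f : C.restrict M ⟶ C.restrict M) (hf : Theta f.base) (e y : C.idx) (he : e ∈ M) (hy : y ∈ M)
    (h : (⟨y, hy⟩ : M) ∈ f.base.pfun ⟨e, he⟩) (h' : y ∈ (extendHom C M f hf).base.pfun e) :
    (extendHom C M f hf).app e y h' = f.app ⟨e, he⟩ ⟨y, hy⟩ h :=
  dif_pos he

theorem extendHom_app_of_notMem (C : Wreath 𝒞 Λ) (M : Set C.idx)
    (f : C.restrict M ⟶ C.restrict M) (hf : Theta f.base) (e y : C.idx) (he : e ∉ M)
    (h : y = e) (h' : y ∈ (extendHom C M f hf).base.pfun e) :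
    (extendHom C M f hf).app e y h' = eqToHom (congrArg C.fam h.symm) :=
  dif_neg he

theorem extendHom_id (C : Wreath 𝒞 Λ) (M : Set C.idx) (h : Theta (Hom.base (𝟙 (C.restrict M)))) :
    extendHom C M (𝟙 _) h = 𝟙 C := by
  have key : ∀ e y, y ∈ (extendHom C M (𝟙 _) h).base.pfun e ↔ y = e := by
    intro e y
    by_cases he : e ∈ M
    · refine (mem_extendPFun_of_mem he).trans ⟨?_, ?_⟩
      · rintro ⟨hy, h⟩
        exact congrArg Subtype.val ((mem_id_base (X := C.restrict M) _ _).1 h)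
      · rintro rfl
        exact ⟨he, (mem_id_base (X := C.restrict M) _ _).2 rfl⟩
    · exact mem_extendPFun_of_notMem he
  refine hom_ext (fun e y => (key e y).trans (mem_id_base e y).symm) (fun e y hf hg => ?_)
  obtain rfl := (key e y).1 hf
  by_cases he : y ∈ M
  · rw [extendHom_app_of_mem C M _ h y y he he ((mem_id_base (X := C.restrict M) _ _).2 rfl)]
    rfl
  · rw [extendHom_app_of_notMem C M _ h y y he rfl]
    rfl

theorem extendHom_comp (C : Wreath 𝒞 Λ) (M : Set C.idx) (f g : C.restrict M ⟶ C.restrict M)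
    (hf : Theta f.base) (hg : Theta g.base) (hfg : Theta (f ≫ g).base) :
    extendHom C M (f ≫ g) hfg = extendHom C M f hf ≫ extendHom C M g hg := by
  refine hom_ext (fun e z => ?_) (fun e z h h' => ?_)
  · rw [mem_comp_base]
    by_cases he : e ∈ M
    · refine (mem_extendPFun_of_mem he).trans ⟨?_, ?_⟩
      · rintro ⟨hz, h⟩
        obtain ⟨y, hy, hyz⟩ := (mem_comp_base f g _ _).1 h
        exact ⟨y.1, (mem_extendPFun_of_mem he).2 ⟨y.2, hy⟩, (mem_extendPFun_of_mem y.2).2 ⟨hz, hyz⟩⟩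
      · rintro ⟨y, hy, hyz⟩
        obtain ⟨hyM, hy⟩ := (mem_extendPFun_of_mem he).1 hy
        obtain ⟨hz, hyz⟩ := (mem_extendPFun_of_mem hyM).1 hyz
        exact ⟨hz, (mem_comp_base f g _ _).2 ⟨_, hy, hyz⟩⟩
    · refine (mem_extendPFun_of_notMem he).trans ⟨?_, ?_⟩
      · rintro rfl
        exact ⟨z, (mem_extendPFun_of_notMem he).2 rfl, (mem_extendPFun_of_notMem he).2 rfl⟩
      · rintro ⟨y, hy, hyz⟩
        obtain rfl := (mem_extendPFun_of_notMem he).1 hy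
        exact (mem_extendPFun_of_notMem he).1 hyz
  · obtain ⟨y, hy, hyz⟩ := (mem_comp_base _ _ _ _).1 h'
    rw [comp_app _ _ e y z hy hyz]
    by_cases he : e ∈ M
    · obtain ⟨hyM, hy'⟩ := (mem_extendPFun_of_mem he).1 hy
      obtain ⟨hz, hyz'⟩ := (mem_extendPFun_of_mem hyM).1 hyz
      rw [extendHom_app_of_mem C M f hf e y he hyM hy', extendHom_app_of_mem C M g hg y z hyM hz hyz',
        extendHom_app_of_mem C M (f ≫ g) hfg e z he hz
          ((mem_comp_base f g _ _).2 ⟨_, hy', hyz'⟩)]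
      exact comp_app f g _ _ _ hy' hyz' _
    · obtain rfl := (mem_extendPFun_of_notMem he).1 hy
      obtain rfl := (mem_extendPFun_of_notMem he).1 hyz
      rw [extendHom_app_of_notMem C M f hf _ _ he rfl, extendHom_app_of_notMem C M g hg _ _ he rfl,
        extendHom_app_of_notMem C M (f ≫ g) hfg _ _ he rfl]
      exact (Category.id_comp _).symm

/-- The homomorphism `G_A → G_C`, for `A = ρ_M(C)`, that extends an automorphism of `A` by the
identity on `C - A`. -/
noncomputable def extendAut (C : Wreath 𝒞 Λ) (M : Set C.idx) : Aut (C.restrict M) →* Aut C where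
  toFun g :=
    { hom := extendHom C M g.hom (theta_base _ g)
      inv := extendHom C M g.inv (theta_base _ g⁻¹)
      hom_inv_id := by
        have h : Theta (g.hom ≫ g.inv).base := by
          rw [g.hom_inv_id]; exact theta_base _ (1 : Aut (C.restrict M))
        rw [← extendHom_comp C M g.hom g.inv _ _ h]
        simp only [g.hom_inv_id]
        exact extendHom_id C M _
      inv_hom_id := by
        have h : Theta (g.inv ≫ g.hom).base := by
          rw [g.inv_hom_id]; exact theta_base _ (1 : Aut (C.restrict M))
        rw [← extendHom_comp C M g.inv g.hom _ _ h]
        simp only [g.inv_hom_id]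
        exact extendHom_id C M _ }
  map_one' := Iso.ext (extendHom_id C M (theta_base _ (1 : Aut (C.restrict M))))
  map_mul' g h := Iso.ext
    (extendHom_comp C M h.hom g.hom (theta_base _ h) (theta_base _ g) (theta_base _ (g * h)))

/-- `i_A^C` is equivariant along `G_A → G_C`. -/
theorem incl_extendAut (C : Wreath 𝒞 Λ) (M : Set C.idx) (g : Aut (C.restrict M)) :
    g.hom ≫ C.incl M = C.incl M ≫ (extendAut C M g).hom := by
  have hi : ∀ (e : M) (y : C.idx), y ∈ (C.incl M).base.pfun e ↔ y = e.1 :=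
    fun e y => Part.mem_some_iff
  refine hom_ext (fun e z => ?_) (fun e z h h' => ?_)
  · rw [mem_comp_base, mem_comp_base]
    constructor
    · rintro ⟨y, hy, hz⟩
      obtain rfl := (hi y z).1 hz
      exact ⟨e.1, (hi e _).2 rfl, (mem_extendPFun_of_mem e.2).2 ⟨y.2, hy⟩⟩
    · rintro ⟨y, hy, hz⟩
      obtain rfl := (hi e y).1 hy
      obtain ⟨hzM, hz⟩ := (mem_extendPFun_of_mem e.2).1 hz
      exact ⟨⟨z, hzM⟩, hz, (hi _ _).2 rfl⟩
  · obtain ⟨y, hy, hz⟩ := (mem_comp_base _ _ _ _).1 h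
    obtain rfl := (hi y z).1 hz
    have h₁ : e.1 ∈ (C.incl M).base.pfun e := (hi e _).2 rfl
    have h₂ : y.1 ∈ (extendAut C M g).hom.base.pfun e.1 :=
      (mem_extendPFun_of_mem e.2).2 ⟨y.2, hy⟩
    rw [comp_app g.hom (C.incl M) e y y.1 hy hz,
      comp_app (C.incl M) (extendAut C M g).hom e e.1 y.1 h₁ h₂]
    have h₃ := extendHom_app_of_mem C M g.hom (theta_base _ g) e.1 y.1 e.2 y.2 hy h₂
    refine (Category.comp_id _).trans (Eq.trans ?_ (Category.id_comp _).symm)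
    exact h₃.symm

/-- The elements of `V_C` are the `ρ_U(C)`, for `U` a subset of the index set `E` of `C`; so `V_C`
is identified with the set of subsets of `E`, and `V_A`, for `A = ρ_M(C)`, with the set of subsets
of `M`. This is the assertion that `ρ_U(C)` belongs to `G_C · V_A`, the union of the `G_C`-orbits
that meet `V_A`. -/
def MemOrbits (C : Wreath 𝒞 Λ) (M U : Set C.idx) : Prop :=
  ∃ (g : Aut C) (U' : Set C.idx), U' ⊆ M ∧ {y | ∃ e ∈ U', y ∈ g.hom.base.pfun e} = U

end Wreath

/-! ### Integral homology of groups -/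

/-- The trivial representation of `G` on `ℤ` (lifted to the universe of `G`). -/
abbrev trivialZ (G : Type v) [Group G] : Rep (ULift.{v} ℤ) G :=
  Rep.trivial (ULift.{v} ℤ) G (ULift.{v} ℤ)

/-- The functor `H_n(-; ℤ)` from groups to abelian groups. -/
noncomputable def intHomology (n : ℕ) : GrpCat.{v} ⥤ AddCommGrpCat.{v} where
  obj G := (forget₂ (ModuleCat (ULift.{v} ℤ)) AddCommGrpCat).obj (groupHomology (trivialZ G) n)
  map {G H} f := (forget₂ (ModuleCat (ULift.{v} ℤ)) AddCommGrpCat).map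
    (groupHomology.map (A := trivialZ G) (B := trivialZ H) f.hom (𝟙 (trivialZ G)) n)
  map_id G := by
    have h : groupHomology.map (A := trivialZ G) (B := trivialZ G) (MonoidHom.id G)
      (𝟙 (trivialZ G)) n = 𝟙 _ := groupHomology.map_id n
    exact (congrArg _ h).trans (CategoryTheory.Functor.map_id _ _)
  map_comp {G H K} f g := by
    have h := groupHomology.map_comp (A := trivialZ G) (B := trivialZ H) (C := trivialZ K)
      f.hom g.hom (𝟙 (trivialZ G)) (𝟙 (trivialZ H)) n
    refine Eq.trans (congrArg _ ?_) (CategoryTheory.Functor.map_comp _ _ _)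
    rw [← h]
    rfl

/-- The homomorphism induced on integral homology by a group homomorphism. -/
noncomputable def homologyMap (n : ℕ) {G H : Type v} [Group G] [Group H] (f : G →* H) :
    (intHomology.{v} n).obj (GrpCat.of G) ⟶ (intHomology.{v} n).obj (GrpCat.of H) :=
  (intHomology n).map (GrpCat.ofHom f)

/-! ### The groups `κ(C) ⋊ G_C` -/

namespace Wreath

variable {𝒞 : Type u} [Category.{v} 𝒞] {Λ : MorphismProperty FinPart} [ContainsTheta Λ]

/-- The action of `G_C` on `κ(C)`. -/
noncomputable def autAction (κ : Wreath 𝒞 Λ ⥤ GrpCat.{v}) (C : Wreath 𝒞 Λ) : Aut C →* MulAut (κ.obj C) where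
  toFun g := (κ.mapIso g).groupIsoToMulEquiv
  map_one' := by
    ext x
    exact congrArg (fun f : κ.obj C ⟶ κ.obj C => f.hom x) (κ.map_id C)
  map_mul' g h := by
    ext x
    exact congrArg (fun f : κ.obj C ⟶ κ.obj C => f.hom x) (κ.map_comp h.hom g.hom)

/-- The group `κ(C) ⋊ G_C`. -/
abbrev Semidirect (κ : Wreath 𝒞 Λ ⥤ GrpCat.{v}) (C : Wreath 𝒞 Λ) : Type v :=
  κ.obj C ⋊[autAction κ C] Aut C

/-- The homomorphism `κ(A) ⋊ G_A → κ(C) ⋊ G_C`, for `A = ρ_M(C)`, given by `κ(i_A^C)` and the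
homomorphism `G_A → G_C`. -/
noncomputable def semidirectMap (κ : Wreath 𝒞 Λ ⥤ GrpCat.{v}) (C : Wreath 𝒞 Λ) (M : Set C.idx) :
    Semidirect κ (C.restrict M) →* Semidirect κ C :=
  SemidirectProduct.map (κ.map (C.incl M)).hom (extendAut C M) (by
    intro g
    have h : κ.map g.hom ≫ κ.map (C.incl M) =
        κ.map (C.incl M) ≫ κ.map (extendAut C M g).hom := by
      rw [← κ.map_comp, incl_extendAut, κ.map_comp]
    exact congrArg GrpCat.Hom.hom h)

/-- `μ_ℓ : H_ℓ(κ(A) ⋊ G_A; ℤ) → H_ℓ(κ(C) ⋊ G_C; ℤ)`, for `A = ρ_M(C)`. -/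
noncomputable def mu (κ : Wreath 𝒞 Λ ⥤ GrpCat.{v}) (C : Wreath 𝒞 Λ) (M : Set C.idx) (l : ℕ) :
    (intHomology.{v} l).obj (GrpCat.of (Semidirect κ (C.restrict M))) ⟶
      (intHomology.{v} l).obj (GrpCat.of (Semidirect κ C)) :=
  homologyMap l (semidirectMap κ C M)

/-- `σ_{ℓ,U} : H_ℓ(G_{A-U}; ℤ) → H_ℓ(G_{C-U}; ℤ)`, for `A = ρ_M(C)` and a subset `U` of `M`.
Here `C - U` is the restriction of `C` to the complement of `U`, and `A - U` is the restriction of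
`C - U` to the elements of `M` in that complement. -/
noncomputable def sigma (C : Wreath 𝒞 Λ) (M U : Set C.idx) (l : ℕ) :
    (intHomology.{v} l).obj
        (GrpCat.of (Aut ((C.restrict Uᶜ).restrict ((Subtype.val : ↥Uᶜ → C.idx) ⁻¹' M)))) ⟶
      (intHomology.{v} l).obj (GrpCat.of (Aut (C.restrict Uᶜ))) :=
  homologyMap l (extendAut (C.restrict Uᶜ) ((Subtype.val : ↥Uᶜ → C.idx) ⁻¹' M))

end Wreath

end WreathStability

/-!
The homology of `κ(C) ⋊ G_C` is assembled from the homology of `G_C` with coefficients in the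
homology of `κ(C)`, as in the Hochschild-Serre spectral sequence; so the two semidirect products are
compared by comparing the groups `H_p(G_A; H_q(κ(A)))` and `H_p(G_C; H_q(κ(C)))`.

**From the coefficients to the semidirect products.** No spectral sequence is used. The chains of
`K ⋊ G` with coefficients in `k[G]`, reduced modulo the chains of `G`, form a complex of
representations of `G` (`extCx`). Its terms are acyclic, its homology in degree `q ≥ 1` is `H_q(K)`
by Shapiro's lemma (`shapiro`, `inl_bijective`), and its coinvariants compute the relative homology
of `K ⋊ G` and `G`. A dévissage along cycles and boundaries (`RepCxHom.HY_surjective`,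
`RepCxHom.HY_injective`, `RepCxHom.coinv_surjective`, `RepCxHom.coinv_injective`) then gives
`semidirect_surjective` and `semidirect_injective`. The identification of the homology of the complex
with `H_q(K)` is equivariant because inner automorphisms act trivially on homology (`H_conj`).

**Polynomial coefficients.** The idempotents `d_{C,U}` commute, with `d_{C,U} d_{C,V} = d_{C,U ∩ V}`.
They split `N = H_q(κ(C))` into homogeneous components indexed by the subsets `V` of the index set of
`C`, and the component of degree `V` embeds into the cross effect at `ρ_V(C)`; so only non-empty sets
of at most `d(q)` elements occur, and `G_C` moves each of them into `A` (`Wreath.coeff_graded`).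
Moreover, the automorphisms that fix `ρ_V(C)` act trivially on the component of degree `V`, and
`H_q(κ(A))` is the part of `N` of degree contained in `A`. Such a graded representation is a quotient
of a sum of graded permutation representations `k[G_C / Q_U]`, where `Q_U` is the pointwise
stabilizer of `U ⊆ A`, and the kernel is graded in the same way. For `k[G_C / Q_U]`, the part of
degree contained in `A` is `k[G_A / (Q_U ∩ G_A)]`, since an automorphism of `C` that maps `U` into `A`
agrees on `U` with one of `A` (`Wreath.exists_extendAut_mul_mem_fixer`). By Shapiro's lemma the
comparison for it is the comparison of the homology of `Q_U ∩ G_A` and `Q_U`, that is, of `G_{A-U}`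
and `G_{C-U}` (`Wreath.exists_stabilizer_equiv`), and this is the map `σ_{ℓ,U}`. Dimension shifting
along these covers yields the general case (`graded_compare`).
-/

namespace WreathStability

/-! ### Group homology and equivariant maps -/

section Equivariant

variable {k : Type u} [CommRing k]
variable {G₁ G₂ G₃ : Type u} [Group G₁] [Group G₂] [Group G₃]
variable {V₁ V₂ V₃ : Type u} [AddCommGroup V₁] [AddCommGroup V₂] [AddCommGroup V₃]
  [Module k V₁] [Module k V₂] [Module k V₃]

/-- The homology `H_n(G; V)` of a group with coefficients in an unbundled representation. -/
noncomputable abbrev HG (ρ : Representation k G₁ V₁) (n : ℕ) : ModuleCat.{u} k :=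
  groupHomology (Rep.of ρ) n

/-- The linear map `f` is equivariant along the group homomorphism `φ`. -/
def Equivar (φ : G₁ →* G₂) (ρ₁ : Representation k G₁ V₁) (ρ₂ : Representation k G₂ V₂)
    (f : V₁ →ₗ[k] V₂) : Prop :=
  ∀ g x, f (ρ₁ g x) = ρ₂ (φ g) (f x)

variable {ρ₁ : Representation k G₁ V₁} {ρ₂ : Representation k G₂ V₂} {ρ₃ : Representation k G₃ V₃}
variable {φ : G₁ →* G₂} {ψ : G₂ →* G₃} {χ : G₁ →* G₃}
variable {f : V₁ →ₗ[k] V₂} {g : V₂ →ₗ[k] V₃} {e : V₁ →ₗ[k] V₃}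

namespace Equivar

/-- An equivariant map as a morphism of `Rep`. -/
noncomputable def hom (h : Equivar φ ρ₁ ρ₂ f) : Rep.of ρ₁ ⟶ Rep.res φ (Rep.of ρ₂) :=
  Rep.ofHom (σ := ρ₂.comp φ) (f.intertwiningMap_of_isIntertwiningMap ρ₁ (ρ₂.comp φ) h)

/-- The map induced on inhomogeneous chains by an equivariant map. -/
noncomputable def chains (h : Equivar φ ρ₁ ρ₂ f) :
    groupHomology.inhomogeneousChains (Rep.of ρ₁) ⟶ groupHomology.inhomogeneousChains (Rep.of ρ₂) :=
  groupHomology.chainsMap φ h.hom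

/-- The map induced on homology by an equivariant map. -/
noncomputable def H (h : Equivar φ ρ₁ ρ₂ f) (n : ℕ) : HG ρ₁ n →ₗ[k] HG ρ₂ n :=
  (groupHomology.map φ h.hom n).hom

theorem H_comp (h : Equivar φ ρ₁ ρ₂ f) (h' : Equivar ψ ρ₂ ρ₃ g) (h'' : Equivar χ ρ₁ ρ₃ e)
    (hχ : ∀ x, χ x = ψ (φ x)) (he : ∀ x, e x = g (f x)) (n : ℕ) (x : HG ρ₁ n) :
    h''.H n x = h'.H n (h.H n x) := by
  obtain rfl : χ = ψ.comp φ := MonoidHom.ext hχ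
  obtain rfl : e = g ∘ₗ f := LinearMap.ext he
  have := groupHomology.map_comp φ ψ h.hom h'.hom n
  exact congr($(this).hom x)

theorem H_id {φ : G₁ →* G₁} {f : V₁ →ₗ[k] V₁} (h : Equivar φ ρ₁ ρ₁ f) (hφ : ∀ x, φ x = x)
    (hf : ∀ x, f x = x) (n : ℕ) (x : HG ρ₁ n) : h.H n x = x := by
  obtain rfl : φ = MonoidHom.id _ := MonoidHom.ext hφ
  obtain rfl : f = LinearMap.id := LinearMap.ext hf
  have := groupHomology.map_id (A := Rep.of ρ₁) n
  exact congr($(this).hom x)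

theorem comp (h : Equivar φ ρ₁ ρ₂ f) (h' : Equivar ψ ρ₂ ρ₃ g) :
    Equivar (ψ.comp φ) ρ₁ ρ₃ (g ∘ₗ f) := fun x v => by
  simp only [LinearMap.comp_apply, MonoidHom.comp_apply, h x v, h' (φ x) (f v)]

theorem id (ρ : Representation k G₁ V₁) : Equivar (MonoidHom.id G₁) ρ ρ LinearMap.id :=
  fun _ _ => rfl

/-- An isomorphism of pairs (group, representation) induces a bijection on homology. -/
theorem H_bijective_of_equiv (φ : G₁ ≃* G₂) (f : V₁ ≃ₗ[k] V₂)
    (h : Equivar (φ : G₁ →* G₂) ρ₁ ρ₂ (f : V₁ →ₗ[k] V₂)) (n : ℕ) : Function.Bijective (h.H n) := by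
  have h' : Equivar (φ.symm : G₂ →* G₁) ρ₂ ρ₁ (f.symm : V₂ →ₗ[k] V₁) := fun x v => by
    apply f.injective
    have := h (φ.symm x) (f.symm v)
    simp only [MonoidHom.coe_coe, LinearEquiv.coe_coe, MulEquiv.apply_symm_apply,
      LinearEquiv.apply_symm_apply] at this ⊢
    exact this.symm
  refine Function.bijective_iff_has_inverse.2 ⟨h'.H n, fun x => ?_, fun x => ?_⟩
  · rw [← h.H_comp h' (Equivar.id ρ₁) (fun x => (φ.symm_apply_apply x).symm)
      (fun x => (f.symm_apply_apply x).symm)]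
    exact H_id _ (fun _ => rfl) (fun _ => rfl) n x
  · rw [← h'.H_comp h (Equivar.id ρ₂) (fun x => (φ.apply_symm_apply x).symm)
      (fun x => (f.apply_symm_apply x).symm)]
    exact H_id _ (fun _ => rfl) (fun _ => rfl) n x

end Equivar

end Equivariant

/-! ### The long exact sequence -/

section LongExact

variable {k : Type u} [CommRing k] {G G' : Type u} [Group G] [Group G']
variable {V₁ V₂ V₃ W₁ W₂ W₃ : Type u} [AddCommGroup V₁] [AddCommGroup V₂] [AddCommGroup V₃]
  [Module k V₁] [Module k V₂] [Module k V₃] [AddCommGroup W₁] [AddCommGroup W₂] [AddCommGroup W₃]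
  [Module k W₁] [Module k W₂] [Module k W₃]
variable {ρ₁ : Representation k G V₁} {ρ₂ : Representation k G V₂} {ρ₃ : Representation k G V₃}
variable {τ₁ : Representation k G' W₁} {τ₂ : Representation k G' W₂} {τ₃ : Representation k G' W₃}
variable {i : V₁ →ₗ[k] V₂} {p : V₂ →ₗ[k] V₃} {j : W₁ →ₗ[k] W₂} {q : W₂ →ₗ[k] W₃}

/-- A short exact sequence of representations of `G`. -/
structure SES (ρ₁ : Representation k G V₁) (ρ₂ : Representation k G V₂)
    (ρ₃ : Representation k G V₃) (i : V₁ →ₗ[k] V₂) (p : V₂ →ₗ[k] V₃) : Prop where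
  hi : Equivar (MonoidHom.id G) ρ₁ ρ₂ i
  hp : Equivar (MonoidHom.id G) ρ₂ ρ₃ p
  inj : Function.Injective i
  surj : Function.Surjective p
  exact : Function.Exact i p

namespace SES

/-- The short complex of `Rep` underlying a short exact sequence. -/
noncomputable def sc (S : SES ρ₁ ρ₂ ρ₃ i p) : ShortComplex (Rep k G) where
  X₁ := Rep.of ρ₁
  X₂ := Rep.of ρ₂
  X₃ := Rep.of ρ₃
  f := S.hi.hom
  g := S.hp.hom
  zero := by
    ext x
    exact S.exact.apply_apply_eq_zero x

theorem shortExact (S : SES ρ₁ ρ₂ ρ₃ i p) : S.sc.ShortExact := by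
  have h1 : Mono S.sc.f := (Rep.mono_iff_injective _).2 S.inj
  have h2 : Epi S.sc.g := (Rep.epi_iff_surjective _).2 S.surj
  refine ⟨?_⟩
  rw [← ShortComplex.exact_map_iff_of_faithful _ (forget₂ (Rep k G) (ModuleCat k)),
    ShortComplex.moduleCat_exact_iff]
  intro x hx
  exact (S.exact x).1 hx

/-- The connecting homomorphism. -/
noncomputable def δ (S : SES ρ₁ ρ₂ ρ₃ i p) (n : ℕ) : HG ρ₃ (n + 1) →ₗ[k] HG ρ₁ n :=
  (groupHomology.δ S.shortExact (n + 1) n rfl).hom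

theorem exact₁ (S : SES ρ₁ ρ₂ ρ₃ i p) (n : ℕ) : Function.Exact (S.δ n) (S.hi.H n) :=
  (ShortComplex.ShortExact.moduleCat_exact_iff_function_exact _).1
    (groupHomology.mapShortComplex₁_exact S.shortExact (i := n + 1) (j := n) rfl)

theorem exact₂ (S : SES ρ₁ ρ₂ ρ₃ i p) (n : ℕ) : Function.Exact (S.hi.H n) (S.hp.H n) :=
  (ShortComplex.ShortExact.moduleCat_exact_iff_function_exact _).1
    (groupHomology.mapShortComplex₂_exact S.shortExact n)

theorem exact₃ (S : SES ρ₁ ρ₂ ρ₃ i p) (n : ℕ) : Function.Exact (S.hp.H (n + 1)) (S.δ n) :=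
  (ShortComplex.ShortExact.moduleCat_exact_iff_function_exact _).1
    (groupHomology.mapShortComplex₃_exact S.shortExact (i := n + 1) (j := n) rfl)

theorem H_zero_surjective (S : SES ρ₁ ρ₂ ρ₃ i p) : Function.Surjective (S.hp.H 0) := by
  have h2 : Epi S.hp.hom := (Rep.epi_iff_surjective (k := k) (G := G) S.sc.g).2 S.surj
  exact (ModuleCat.epi_iff_surjective _).1
    (groupHomology.epi_map_0_of_epi (A := Rep.of ρ₂) (B := Rep.of ρ₃) S.hp.hom)

/-- The connecting homomorphism is natural with respect to the group and the sequence. -/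
theorem δ_naturality (S : SES τ₁ τ₂ τ₃ j q) (T : SES ρ₁ ρ₂ ρ₃ i p) {φ : G' →* G}
    {f₁ : W₁ →ₗ[k] V₁} {f₂ : W₂ →ₗ[k] V₂} {f₃ : W₃ →ₗ[k] V₃}
    (h₁ : Equivar φ τ₁ ρ₁ f₁) (h₂ : Equivar φ τ₂ ρ₂ f₂) (h₃ : Equivar φ τ₃ ρ₃ f₃)
    (c₁ : ∀ x, f₂ (j x) = i (f₁ x)) (c₂ : ∀ x, f₃ (q x) = p (f₂ x)) (n : ℕ)
    (x : HG τ₃ (n + 1)) : T.δ n (h₃.H (n + 1) x) = h₁.H n (S.δ n x) := by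
  let Φ : S.sc.map (groupHomology.chainsFunctor k G') ⟶ T.sc.map (groupHomology.chainsFunctor k G) :=
    { τ₁ := h₁.chains
      τ₂ := h₂.chains
      τ₃ := h₃.chains
      comm₁₂ := by
        have e₁ := groupHomology.chainsMap_comp φ (MonoidHom.id G) h₁.hom T.hi.hom
        have e₂ := groupHomology.chainsMap_comp (MonoidHom.id G') φ S.hi.hom h₂.hom
        refine e₁.symm.trans (Eq.trans ?_ e₂)
        refine groupHomology.chainsMap_congr rfl (LinearMap.ext fun x => ?_)
        exact (c₁ x).symm
      comm₂₃ := by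
        have e₁ := groupHomology.chainsMap_comp φ (MonoidHom.id G) h₂.hom T.hp.hom
        have e₂ := groupHomology.chainsMap_comp (MonoidHom.id G') φ S.hp.hom h₃.hom
        refine e₁.symm.trans (Eq.trans ?_ e₂)
        refine groupHomology.chainsMap_congr rfl (LinearMap.ext fun x => ?_)
        exact (c₂ x).symm }
  have := HomologicalComplex.HomologySequence.δ_naturality Φ
    (groupHomology.map_chainsFunctor_shortExact S.shortExact)
    (groupHomology.map_chainsFunctor_shortExact T.shortExact) (n + 1) n rfl
  exact congr($(this).hom x).symm

end SES

end LongExact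

/-! ### Four lemmas for the long exact sequences -/

section FourLemmas

variable {k : Type u} [CommRing k] {G G' : Type u} [Group G] [Group G']
variable {V₁ V₂ V₃ W₁ W₂ W₃ : Type u} [AddCommGroup V₁] [AddCommGroup V₂] [AddCommGroup V₃]
  [Module k V₁] [Module k V₂] [Module k V₃] [AddCommGroup W₁] [AddCommGroup W₂] [AddCommGroup W₃]
  [Module k W₁] [Module k W₂] [Module k W₃]
variable {ρ₁ : Representation k G V₁} {ρ₂ : Representation k G V₂} {ρ₃ : Representation k G V₃}
variable {τ₁ : Representation k G' W₁} {τ₂ : Representation k G' W₂} {τ₃ : Representation k G' W₃}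
variable {i : V₁ →ₗ[k] V₂} {p : V₂ →ₗ[k] V₃} {j : W₁ →ₗ[k] W₂} {q : W₂ →ₗ[k] W₃}
variable {φ : G' →* G} {f₁ : W₁ →ₗ[k] V₁} {f₂ : W₂ →ₗ[k] V₂} {f₃ : W₃ →ₗ[k] V₃}

/-- A morphism of short exact sequences along a group homomorphism. -/
structure SESHom (S : SES τ₁ τ₂ τ₃ j q) (T : SES ρ₁ ρ₂ ρ₃ i p) (φ : G' →* G)
    (f₁ : W₁ →ₗ[k] V₁) (f₂ : W₂ →ₗ[k] V₂) (f₃ : W₃ →ₗ[k] V₃) : Prop where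
  h₁ : Equivar φ τ₁ ρ₁ f₁
  h₂ : Equivar φ τ₂ ρ₂ f₂
  h₃ : Equivar φ τ₃ ρ₃ f₃
  c₁ : ∀ x, f₂ (j x) = i (f₁ x)
  c₂ : ∀ x, f₃ (q x) = p (f₂ x)

namespace SESHom

variable {S : SES τ₁ τ₂ τ₃ j q} {T : SES ρ₁ ρ₂ ρ₃ i p} (F : SESHom S T φ f₁ f₂ f₃)
include F

theorem sq₁ (n : ℕ) : T.hi.H n ∘ₗ F.h₁.H n = F.h₂.H n ∘ₗ S.hi.H n := by
  have h := F.h₁.comp T.hi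
  refine LinearMap.ext fun x => ?_
  exact (F.h₁.H_comp T.hi h (fun _ => rfl) (fun _ => rfl) n x).symm.trans
    (S.hi.H_comp F.h₂ h (fun _ => rfl) (fun x => (F.c₁ x).symm) n x)

theorem sq₂ (n : ℕ) : T.hp.H n ∘ₗ F.h₂.H n = F.h₃.H n ∘ₗ S.hp.H n := by
  have h := F.h₂.comp T.hp
  refine LinearMap.ext fun x => ?_
  exact (F.h₂.H_comp T.hp h (fun _ => rfl) (fun _ => rfl) n x).symm.trans
    (S.hp.H_comp F.h₃ h (fun _ => rfl) (fun x => (F.c₂ x).symm) n x)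

theorem sq₃ (n : ℕ) : T.δ n ∘ₗ F.h₃.H (n + 1) = F.h₁.H n ∘ₗ S.δ n :=
  LinearMap.ext fun x => S.δ_naturality T F.h₁ F.h₂ F.h₃ F.c₁ F.c₂ n x

open Function

theorem surjective₂ (n : ℕ) (s₁ : Surjective (F.h₁.H (n + 1))) (s₃ : Surjective (F.h₃.H (n + 1)))
    (i₁ : Injective (F.h₁.H n)) : Surjective (F.h₂.H (n + 1)) :=
  LinearMap.surjective_of_surjective_of_surjective_of_injective _ _ _ _ _ _ _ _ _ _
    (F.sq₁ (n + 1)) (F.sq₂ (n + 1)) (F.sq₃ n) (S.exact₃ n)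
    (T.exact₂ (n + 1)) (T.exact₃ n) s₁ s₃ i₁

theorem injective₂ (n : ℕ) (s₃ : Surjective (F.h₃.H (n + 1))) (i₁ : Injective (F.h₁.H n))
    (i₃ : Injective (F.h₃.H n)) : Injective (F.h₂.H n) :=
  LinearMap.injective_of_surjective_of_injective_of_injective _ _ _ _ _ _ _ _ _ _
    (F.sq₃ n) (F.sq₁ n) (F.sq₂ n) (S.exact₁ n) (S.exact₂ n) (T.exact₁ n) s₃ i₁ i₃

theorem surjective₃_zero (s₂ : Surjective (F.h₂.H 0)) : Surjective (F.h₃.H 0) := by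
  have h : Surjective (F.h₃.H 0 ∘ₗ S.hp.H 0) := by
    rw [← F.sq₂ 0]
    exact T.H_zero_surjective.comp s₂
  exact Surjective.of_comp h

theorem surjective₃ (n : ℕ) (s₂ : Surjective (F.h₂.H (n + 1))) (s₁ : Surjective (F.h₁.H n))
    (i₂ : Injective (F.h₂.H n)) : Surjective (F.h₃.H (n + 1)) :=
  LinearMap.surjective_of_surjective_of_surjective_of_injective _ _ _ _ _ _ _ _ _ _
    (F.sq₂ (n + 1)) (F.sq₃ n) (F.sq₁ n) (S.exact₁ n)
    (T.exact₃ n) (T.exact₁ n) s₂ s₁ i₂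

theorem injective₃_zero (s₁ : Surjective (F.h₁.H 0)) (i₂ : Injective (F.h₂.H 0)) :
    Injective (F.h₃.H 0) := by
  refine (injective_iff_map_eq_zero _).2 fun x hx => ?_
  obtain ⟨y, rfl⟩ := S.H_zero_surjective x
  have h : T.hp.H 0 (F.h₂.H 0 y) = 0 := (congr($(F.sq₂ 0) y)).trans hx
  obtain ⟨z, hz⟩ := (T.exact₂ 0 _).1 h
  obtain ⟨w, rfl⟩ := s₁ z
  have : S.hi.H 0 w = y := i₂ ((congr($(F.sq₁ 0) w)).symm.trans hz)
  rw [← this]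
  exact (S.exact₂ 0).apply_apply_eq_zero w

theorem injective₃ (n : ℕ) (s₁ : Surjective (F.h₁.H (n + 1))) (i₂ : Injective (F.h₂.H (n + 1)))
    (i₁ : Injective (F.h₁.H n)) : Injective (F.h₃.H (n + 1)) :=
  LinearMap.injective_of_surjective_of_injective_of_injective _ _ _ _ _ _ _ _ _ _
    (F.sq₁ (n + 1)) (F.sq₂ (n + 1)) (F.sq₃ n) (S.exact₂ (n + 1)) (S.exact₃ n) (T.exact₂ (n + 1))
    s₁ i₂ i₁

end SESHom

end FourLemmas

/-! ### Cycles and boundaries -/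

section Cycles

variable {k : Type u} [CommRing k] {G G' : Type u} [Group G] [Group G']
variable {V W : Type u} [AddCommGroup V] [AddCommGroup W] [Module k V] [Module k W]

/-- The differential `C_{n+1}(G; V) → C_n(G; V)` of inhomogeneous chains. -/
noncomputable def bd (ρ : Representation k G V) (n : ℕ) :
    ((Fin (n + 1) → G) →₀ V) →ₗ[k] ((Fin n → G) →₀ V) :=
  (groupHomology.inhomogeneousChains.d (Rep.of ρ) n).hom

theorem bd_single (ρ : Representation k G V) (n : ℕ) (g : Fin (n + 1) → G) (a : V) :
    bd ρ n (Finsupp.single g a) = Finsupp.single (fun i => g i.succ) (ρ (g 0)⁻¹ a) +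
      Finset.univ.sum fun j : Fin (n + 1) =>
        (-1 : k) ^ ((j : ℕ) + 1) • Finsupp.single (Fin.contractNth j (· * ·) g) a :=
  groupHomology.inhomogeneousChains.d_single (A := Rep.of ρ) n g a

theorem bd_bd (ρ : Representation k G V) (n : ℕ) (c) : bd ρ n (bd ρ (n + 1) c) = 0 :=
  congr($(groupHomology.inhomogeneousChains.d_comp_d (A := Rep.of ρ) (n := n)).hom c)

/-- The `n`-cycles, as a submodule of the inhomogeneous chains. -/
noncomputable def cyc (ρ : Representation k G V) : ∀ n : ℕ, Submodule k ((Fin n → G) →₀ V)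
  | 0 => ⊤
  | n + 1 => LinearMap.ker (bd ρ n)

/-- The homology classes of cycles given as inhomogeneous chains, in terms of the cycles of the
complex that defines group homology. -/
theorem exists_cls (ρ : Representation k G V) (n : ℕ) :
    ∃ c : cyc ρ n →ₗ[k] HG ρ n, (∀ z : cyc ρ n, ∃ w : groupHomology.cycles (Rep.of ρ) n,
      (groupHomology.iCycles (Rep.of ρ) n).hom w = z.1 ∧
        c z = (groupHomology.π (Rep.of ρ) n).hom w) := by
  let K := groupHomology.inhomogeneousChains (Rep.of ρ)
  let ι : K.cycles n →ₗ[k] ((Fin n → G) →₀ V) := (K.iCycles n).hom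
  have hι : Function.Injective ι := (ModuleCat.mono_iff_injective (K.iCycles n)).1 inferInstance
  have hr : ∀ z : cyc ρ n, (z : (Fin n → G) →₀ V) ∈ LinearMap.range ι := by
    rintro ⟨z, hz⟩
    have hz' : (K.d n ((ComplexShape.down ℕ).next n)).hom z = 0 := by
      cases n with
      | zero =>
        have : K.d 0 ((ComplexShape.down ℕ).next 0) = 0 := K.shape _ _ (by simp)
        rw [this]; rfl
      | succ n =>
        have e : (ComplexShape.down ℕ).next (n + 1) = n :=
          ComplexShape.next_eq' _ rfl
        rw [e]
        have := groupHomology.inhomogeneousChains.d_def (A := Rep.of ρ) n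
        exact congr($(this).hom z).trans hz
    exact ⟨K.cyclesMk z _ rfl hz', K.i_cyclesMk z _ rfl hz'⟩
  let e := LinearEquiv.ofInjective ι hι
  refine ⟨(groupHomology.π (Rep.of ρ) n).hom ∘ₗ e.symm.toLinearMap ∘ₗ
    LinearMap.codRestrict (LinearMap.range ι) (cyc ρ n).subtype hr, fun z => ?_⟩
  refine ⟨e.symm ⟨z, hr z⟩, ?_, rfl⟩
  exact congrArg Subtype.val (e.apply_symm_apply ⟨z.1, hr z⟩)

/-- The homology class of a cycle. -/
noncomputable def cls (ρ : Representation k G V) (n : ℕ) : cyc ρ n →ₗ[k] HG ρ n :=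
  (exists_cls ρ n).choose

theorem cls_spec (ρ : Representation k G V) (n : ℕ) (z : cyc ρ n)
    (w : groupHomology.cycles (Rep.of ρ) n)
    (hw : (groupHomology.iCycles (Rep.of ρ) n).hom w = z.1) :
    cls ρ n z = (groupHomology.π (Rep.of ρ) n).hom w := by
  obtain ⟨w', h, h'⟩ := (exists_cls ρ n).choose_spec z
  have hι : Function.Injective (groupHomology.iCycles (Rep.of ρ) n).hom :=
    (ModuleCat.mono_iff_injective _).1 inferInstance
  obtain rfl : w = w' := hι (hw.trans h.symm)
  exact h'

theorem iCycles_mem_cyc (ρ : Representation k G V) (n : ℕ)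
    (w : groupHomology.cycles (Rep.of ρ) n) :
    (groupHomology.iCycles (Rep.of ρ) n).hom w ∈ cyc ρ n := by
  cases n with
  | zero => trivial
  | succ n =>
    have h := (groupHomology.inhomogeneousChains (Rep.of ρ)).iCycles_d (n + 1) n
    have := groupHomology.inhomogeneousChains.d_def (A := Rep.of ρ) n
    rw [this] at h
    exact congr($(h).hom w)

theorem cls_surjective (ρ : Representation k G V) (n : ℕ) : Function.Surjective (cls ρ n) := by
  intro x
  obtain ⟨w, rfl⟩ := (ModuleCat.epi_iff_surjective (groupHomology.π (Rep.of ρ) n)).1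
    (inferInstanceAs (Epi (HomologicalComplex.homologyπ _ _))) x
  exact ⟨⟨_, iCycles_mem_cyc ρ n w⟩, cls_spec ρ n _ w rfl⟩

theorem cls_eq_zero_iff (ρ : Representation k G V) (n : ℕ) (z : cyc ρ n) :
    cls ρ n z = 0 ↔ ∃ b, bd ρ n b = z.1 := by
  let K := groupHomology.inhomogeneousChains (Rep.of ρ)
  obtain ⟨w, h, h'⟩ := (exists_cls ρ n).choose_spec z
  have h'' : cls ρ n z = (K.homologyπ n).hom w := h'
  have hd := groupHomology.inhomogeneousChains.d_def (A := Rep.of ρ) n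
  have hι : Function.Injective (K.iCycles n).hom :=
    (ModuleCat.mono_iff_injective _).1 inferInstance
  have hπ : (K.toCycles (n + 1) n) ≫ K.homologyπ n = 0 := K.toCycles_comp_homologyπ _ _
  have hex : (ShortComplex.mk _ _ hπ).Exact :=
    ShortComplex.exact_of_g_is_cokernel _ (K.homologyIsCokernel (n + 1) n (by simp))
  have hti : ∀ b, (K.iCycles n).hom ((K.toCycles (n + 1) n).hom b) = bd ρ n b := fun b =>
    (congr($(K.toCycles_i (n + 1) n).hom b)).trans (congr($(hd).hom b))
  rw [h'']
  constructor
  · intro h0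
    obtain ⟨b, hb⟩ := (ShortComplex.moduleCat_exact_iff _).1 hex w h0
    refine ⟨b, ?_⟩
    rw [← hti b]
    exact (congrArg (K.iCycles n).hom hb).trans h
  · rintro ⟨b, hb⟩
    have : (K.toCycles (n + 1) n).hom b = w := hι ((hti b).trans (hb.trans h.symm))
    rw [← this]
    exact congr($(hπ).hom b)

variable {ρ : Representation k G V} {τ : Representation k G' W} {φ : G' →* G} {f : W →ₗ[k] V}

namespace Equivar

/-- The map induced on inhomogeneous chains. -/
noncomputable def C (_ : Equivar φ τ ρ f) (n : ℕ) :
    ((Fin n → G') →₀ W) →ₗ[k] ((Fin n → G) →₀ V) :=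
  Finsupp.mapRange.linearMap f ∘ₗ Finsupp.lmapDomain W k (φ ∘ ·)

theorem C_single (h : Equivar φ τ ρ f) (n : ℕ) (g : Fin n → G') (a : W) :
    h.C n (Finsupp.single g a) = Finsupp.single (φ ∘ g) (f a) := by
  simp [C]

theorem C_bd (h : Equivar φ τ ρ f) (n : ℕ) (c) : h.C n (bd τ n c) = bd ρ n (h.C (n + 1) c) := by
  have := h.chains.comm (n + 1) n
  rw [groupHomology.inhomogeneousChains.d_def, groupHomology.inhomogeneousChains.d_def] at this
  exact congr($(this).hom c).symm

theorem C_mem_cyc (h : Equivar φ τ ρ f) (n : ℕ) {c} (hc : c ∈ cyc τ n) : h.C n c ∈ cyc ρ n := by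
  cases n with
  | zero => trivial
  | succ n =>
    change bd ρ n _ = 0
    rw [← h.C_bd, show bd τ n c = 0 from hc, map_zero]

theorem H_cls (h : Equivar φ τ ρ f) (n : ℕ) (z : cyc τ n) :
    h.H n (cls τ n z) = cls ρ n ⟨h.C n z.1, h.C_mem_cyc n z.2⟩ := by
  obtain ⟨w, hw, h'⟩ := (exists_cls τ n).choose_spec z
  have h'' : cls τ n z = (groupHomology.π (Rep.of τ) n).hom w := h'
  rw [h'', cls_spec ρ n _ ((groupHomology.cyclesMap φ h.hom n).hom w)]
  · exact congr($(groupHomology.π_map φ h.hom n).hom w)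
  · refine (congr($(HomologicalComplex.cyclesMap_i h.chains n).hom w)).trans ?_
    exact congrArg (h.C n) hw

/-- Surjectivity on homology in terms of chains. -/
theorem H_surjective_iff (h : Equivar φ τ ρ f) (n : ℕ) : Function.Surjective (h.H n) ↔
    ∀ z ∈ cyc ρ n, ∃ y ∈ cyc τ n, ∃ b, z = h.C n y + bd ρ n b := by
  constructor
  · intro hs z hz
    obtain ⟨y, hy⟩ := hs (cls ρ n ⟨z, hz⟩)
    obtain ⟨y, rfl⟩ := cls_surjective τ n y
    rw [h.H_cls, ← sub_eq_zero, ← map_sub, cls_eq_zero_iff] at hy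
    obtain ⟨b, hb⟩ := hy
    refine ⟨y.1, y.2, -b, ?_⟩
    rw [map_neg, hb]
    simp
  · intro H x
    obtain ⟨⟨z, hz⟩, rfl⟩ := cls_surjective ρ n x
    obtain ⟨y, hy, b, hb⟩ := H z hz
    refine ⟨cls τ n ⟨y, hy⟩, ?_⟩
    rw [h.H_cls, ← sub_eq_zero, ← map_sub, cls_eq_zero_iff]
    refine ⟨-b, ?_⟩
    simp [hb]

/-- Injectivity on homology in terms of chains. -/
theorem H_injective_iff (h : Equivar φ τ ρ f) (n : ℕ) : Function.Injective (h.H n) ↔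
    ∀ z ∈ cyc τ n, (∃ b, bd ρ n b = h.C n z) → ∃ b, bd τ n b = z := by
  rw [injective_iff_map_eq_zero]
  constructor
  · intro H z hz hb
    refine (cls_eq_zero_iff τ n ⟨z, hz⟩).1 (H _ ?_)
    rw [h.H_cls]
    exact (cls_eq_zero_iff _ _ _).2 hb
  · intro H x hx
    obtain ⟨⟨z, hz⟩, rfl⟩ := cls_surjective τ n x
    rw [h.H_cls, cls_eq_zero_iff] at hx
    exact (cls_eq_zero_iff _ _ _).2 (H z hz hx)

end Equivar

theorem HG_subsingleton_iff (ρ : Representation k G V) (n : ℕ) : Subsingleton (HG ρ n) ↔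
    ∀ z ∈ cyc ρ n, ∃ b, bd ρ n b = z := by
  constructor
  · intro _ z hz
    exact (cls_eq_zero_iff ρ n ⟨z, hz⟩).1 (Subsingleton.elim _ _)
  · intro H
    refine subsingleton_of_forall_eq 0 fun x => ?_
    obtain ⟨⟨z, hz⟩, rfl⟩ := cls_surjective ρ n x
    exact (cls_eq_zero_iff _ _ _).2 (H z hz)

end Cycles

/-! ### Homology in degree zero -/

section DegreeZero

variable {k : Type u} [CommRing k] {G G' : Type u} [Group G] [Group G']
variable {V W : Type u} [AddCommGroup V] [AddCommGroup W] [Module k V] [Module k W]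

theorem mem_cyc_zero (ρ : Representation k G V) (c : (Fin 0 → G) →₀ V) : c ∈ cyc ρ 0 :=
  Submodule.mem_top

/-- The projection from the coefficients to the homology in degree zero. -/
noncomputable def H0mk (ρ : Representation k G V) : V →ₗ[k] HG ρ 0 :=
  cls ρ 0 ∘ₗ LinearMap.codRestrict (cyc ρ 0)
    (Finsupp.lsingle (default : Fin 0 → G)) (fun _ => mem_cyc_zero ρ _)

theorem H0mk_surjective (ρ : Representation k G V) : Function.Surjective (H0mk ρ) := by
  intro x
  obtain ⟨⟨z, hz⟩, rfl⟩ := cls_surjective ρ 0 x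
  refine ⟨z default, congrArg (cls ρ 0) (Subtype.ext ?_)⟩
  refine Finsupp.ext fun t => ?_
  obtain rfl := Subsingleton.elim t default
  exact Finsupp.single_eq_same

theorem H0mk_eq_zero_iff (ρ : Representation k G V) (x : V) :
    H0mk ρ x = 0 ↔ x ∈ Representation.Coinvariants.ker ρ := by
  have h0 : ∀ (g : Fin 1 → G) (a : V), bd ρ 0 (Finsupp.single g a) =
      Finsupp.single default (ρ (g 0)⁻¹ a - a) := by
    intro g a
    rw [bd_single, Finsupp.single_sub, Fin.sum_univ_one, sub_eq_add_neg]
    refine congrArg₂ (· + ·) (congrArg (Finsupp.single · _) (Subsingleton.elim _ _)) ?_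
    simp only [Fin.val_zero, zero_add, pow_one, neg_smul, one_smul]
    exact congrArg (-Finsupp.single · a) (Subsingleton.elim _ _)
  constructor
  · intro h
    obtain ⟨b, hb⟩ := (cls_eq_zero_iff _ _ _).1 h
    have hb' : bd ρ 0 b default = x := by
      rw [hb]; exact Finsupp.single_eq_same
    rw [← hb']
    clear hb hb' h
    induction b using Finsupp.induction_linear with
    | zero => simp
    | add f g hf hg => rw [map_add, Finsupp.add_apply]; exact add_mem hf hg
    | single g a =>
      rw [h0]
      simpa using Representation.Coinvariants.sub_mem_ker (ρ := ρ) (g 0)⁻¹ a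
  · intro hx
    induction hx using Submodule.span_induction with
    | mem x h =>
      obtain ⟨⟨g, a⟩, rfl⟩ := h
      refine (cls_eq_zero_iff _ _ _).2 ⟨Finsupp.single (fun _ => g⁻¹) a, ?_⟩
      rw [h0, inv_inv]
      rfl
    | zero => simp
    | add x y _ _ hx hy => rw [map_add, hx, hy, add_zero]
    | smul a x _ hx => rw [map_smul, hx, smul_zero]

theorem H0mk_rho (ρ : Representation k G V) (g : G) (x : V) : H0mk ρ (ρ g x) = H0mk ρ x := by
  rw [← sub_eq_zero, ← map_sub, H0mk_eq_zero_iff]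
  exact Representation.Coinvariants.sub_mem_ker (ρ := ρ) g x

theorem Equivar.H_H0mk {ρ : Representation k G V} {τ : Representation k G' W} {φ : G' →* G}
    {f : W →ₗ[k] V} (h : Equivar φ τ ρ f) (x : W) : h.H 0 (H0mk τ x) = H0mk ρ (f x) := by
  refine (h.H_cls 0 _).trans (congrArg (cls ρ 0) (Subtype.ext ?_))
  refine (h.C_single 0 _ _).trans ?_
  exact congrArg (Finsupp.single · (f x)) (Subsingleton.elim _ _)

/-- In degree zero, an isomorphism between trivial coefficients induces an isomorphism. -/
theorem H_zero_bijective_of_trivial {φ : G' →* G} {f : W →ₗ[k] V}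
    (h : Equivar φ (Representation.trivial k G' W) (Representation.trivial k G V) f)
    (hf : Function.Bijective f) : Function.Bijective (h.H 0) := by
  have hker : ∀ x : V, x ∈ Representation.Coinvariants.ker (Representation.trivial k G V) →
      x = 0 := by
    intro x hx
    induction hx using Submodule.span_induction with
    | mem x h => obtain ⟨⟨g, a⟩, rfl⟩ := h; simp
    | zero => rfl
    | add x y _ _ hx hy => rw [hx, hy, add_zero]
    | smul a x _ hx => rw [hx, smul_zero]
  constructor
  · refine (injective_iff_map_eq_zero _).2 fun x hx => ?_
    obtain ⟨x, rfl⟩ := H0mk_surjective _ x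
    rw [h.H_H0mk, H0mk_eq_zero_iff] at hx
    have : x = 0 := hf.1 ((hker _ hx).trans (map_zero f).symm)
    rw [this, map_zero]
  · intro y
    obtain ⟨y, rfl⟩ := H0mk_surjective _ y
    obtain ⟨x, rfl⟩ := hf.2 y
    exact ⟨H0mk _ x, h.H_H0mk x⟩

end DegreeZero

/-! ### Coefficients that decompose into pieces -/

section Decomposition

variable {k : Type u} [CommRing k] {G G' : Type u} [Group G] [Group G']
variable {V W : Type u} [AddCommGroup V] [AddCommGroup W] [Module k V] [Module k W]
variable {I : Type*} {X Y : I → Type u} [∀ i, AddCommGroup (X i)] [∀ i, AddCommGroup (Y i)]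
  [∀ i, Module k (X i)] [∀ i, Module k (Y i)]

/-- If every vector is a finite sum of its components, then so is every homology class. -/
theorem exists_finset_sum_eq {ρ : Representation k G V} {σ : ∀ i, Representation k G (X i)}
    {j : ∀ i, X i →ₗ[k] V} {p : ∀ i, V →ₗ[k] X i} (hj : ∀ i, Equivar (MonoidHom.id G) (σ i) ρ (j i))
    (hp : ∀ i, Equivar (MonoidHom.id G) ρ (σ i) (p i))
    (hjp : ∀ x, ∃ s : Finset I, ∀ t, s ⊆ t → ∑ i ∈ t, j i (p i x) = x) (n : ℕ) (x : HG ρ n) :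
    ∃ s : Finset I, ∑ i ∈ s, (hj i).H n ((hp i).H n x) = x := by
  classical
  obtain ⟨⟨c, hc⟩, rfl⟩ := cls_surjective ρ n x
  have key : ∃ s : Finset I, ∀ t, s ⊆ t → ∑ i ∈ t, (hj i).C n ((hp i).C n c) = c := by
    clear hc
    induction c using Finsupp.induction_linear with
    | zero => exact ⟨∅, fun t _ => by simp⟩
    | add f g hf hg =>
      obtain ⟨s, hs⟩ := hf
      obtain ⟨s', hs'⟩ := hg
      refine ⟨s ∪ s', fun t ht => ?_⟩
      simp only [map_add, Finset.sum_add_distrib]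
      rw [hs t (Finset.union_subset_left ht), hs' t (Finset.union_subset_right ht)]
    | single g a =>
      obtain ⟨s, hs⟩ := hjp a
      refine ⟨s, fun t ht => ?_⟩
      simp only [Equivar.C_single]
      rw [← Finsupp.single_finsetSum, hs t ht]
      rfl
  obtain ⟨s, hs⟩ := key
  refine ⟨s, ?_⟩
  simp only [Equivar.H_cls]
  rw [← map_sum]
  refine congrArg _ (Subtype.ext ?_)
  rw [AddSubmonoidClass.coe_finsetSum]
  exact hs s subset_rfl

variable {ρ : Representation k G V} {σ : ∀ i, Representation k G (X i)}
    {j : ∀ i, X i →ₗ[k] V} {p : ∀ i, V →ₗ[k] X i}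
    {ρ' : Representation k G' W} {σ' : ∀ i, Representation k G' (Y i)}
    {j' : ∀ i, Y i →ₗ[k] W} {p' : ∀ i, W →ₗ[k] Y i}
    {φ : G' →* G} {f : W →ₗ[k] V} {f' : ∀ i, Y i →ₗ[k] X i}

theorem H_surjective_of_pieces (hj : ∀ i, Equivar (MonoidHom.id G) (σ i) ρ (j i))
    (hp : ∀ i, Equivar (MonoidHom.id G) ρ (σ i) (p i))
    (hjp : ∀ x, ∃ s : Finset I, ∀ t, s ⊆ t → ∑ i ∈ t, j i (p i x) = x)
    (hj' : ∀ i, Equivar (MonoidHom.id G') (σ' i) ρ' (j' i))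
    (hf : Equivar φ ρ' ρ f) (hf' : ∀ i, Equivar φ (σ' i) (σ i) (f' i))
    (cj : ∀ i x, f (j' i x) = j i (f' i x)) (n : ℕ)
    (h : ∀ i, Function.Surjective ((hf' i).H n)) : Function.Surjective (hf.H n) := by
  intro x
  obtain ⟨s, hs⟩ := exists_finset_sum_eq hj hp hjp n x
  choose y hy using fun i => h i ((hp i).H n x)
  refine ⟨∑ i ∈ s, (hj' i).H n (y i), ?_⟩
  rw [map_sum, ← hs]
  refine Finset.sum_congr rfl fun i _ => ?_
  rw [← hy i, ← (hj' i).H_comp hf ((hj' i).comp hf) (fun _ => rfl) (fun _ => rfl) n,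
    ← (hf' i).H_comp (hj i) ((hj' i).comp hf) (fun _ => rfl) (fun x => cj i x) n]

theorem H_injective_of_pieces
    (hp : ∀ i, Equivar (MonoidHom.id G) ρ (σ i) (p i))
    (hj' : ∀ i, Equivar (MonoidHom.id G') (σ' i) ρ' (j' i))
    (hp' : ∀ i, Equivar (MonoidHom.id G') ρ' (σ' i) (p' i))
    (hjp' : ∀ x, ∃ s : Finset I, ∀ t, s ⊆ t → ∑ i ∈ t, j' i (p' i x) = x)
    (hf : Equivar φ ρ' ρ f) (hf' : ∀ i, Equivar φ (σ' i) (σ i) (f' i))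
    (cp : ∀ i x, p i (f x) = f' i (p' i x)) (n : ℕ)
    (h : ∀ i, Function.Injective ((hf' i).H n)) : Function.Injective (hf.H n) := by
  refine (injective_iff_map_eq_zero _).2 fun x hx => ?_
  obtain ⟨s, hs⟩ := exists_finset_sum_eq hj' hp' hjp' n x
  rw [← hs]
  refine Finset.sum_eq_zero fun i _ => ?_
  have : (hp' i).H n x = 0 := by
    apply h i
    rw [← (hp' i).H_comp (hf' i) ((hp' i).comp (hf' i)) (fun _ => rfl) (fun _ => rfl) n,
      hf.H_comp (hp i) ((hp' i).comp (hf' i)) (fun _ => rfl) (fun x => (cp i x).symm) n, hx,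
      map_zero, map_zero]
  rw [this, map_zero]

end Decomposition

/-! ### Permutation representations -/

section Permutation

variable {k : Type u} [CommRing k] {G : Type u} [Group G] {Ω : Type u}

/-- The permutation representation `k[Ω]` of a `G`-set `Ω`. The action is a homomorphism to the
group of permutations, so that several actions of a group on the same set can be used. -/
noncomputable def permRep (k : Type u) [CommRing k] (α : G →* Equiv.Perm Ω) :
    Representation k G (Ω →₀ k) where
  toFun g := Finsupp.lmapDomain k k (α g)
  map_one' := by
    refine Finsupp.lhom_ext fun a b => ?_
    simp
  map_mul' g h := by
    refine Finsupp.lhom_ext fun a b => ?_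
    simp

theorem permRep_single (α : G →* Equiv.Perm Ω) (g : G) (ω : Ω) (a : k) :
    permRep k α g (Finsupp.single ω a) = Finsupp.single (α g ω) a :=
  Finsupp.mapDomain_single

theorem contractNth_zero_cons {n : ℕ} (x : G) (g : Fin (n + 1) → G) :
    Fin.contractNth 0 (· * ·) (Fin.cons x g : Fin (n + 2) → G) =
      Fin.cons (x * g 0) (fun i => g i.succ) := by
  funext i
  refine Fin.cases ?_ (fun i => ?_) i
  · simp [Fin.contractNth]
  · simp [Fin.contractNth]

theorem contractNth_succ_cons {n : ℕ} (j : Fin (n + 1)) (x : G) (g : Fin (n + 1) → G) :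
    Fin.contractNth j.succ (· * ·) (Fin.cons x g : Fin (n + 2) → G) =
      Fin.cons x (Fin.contractNth j (· * ·) g) := by
  funext i
  refine Fin.cases ?_ (fun i => ?_) i
  · simp [Fin.contractNth]
  · simp [Fin.contractNth]

/-- A contracting homotopy of the inhomogeneous chains with coefficients in `k[Ω]`, for a `G`-set
`Ω` with an equivariant map `r` to `G`. -/
noncomputable def contraction (α : G →* Equiv.Perm Ω) (r : Ω → G) (n : ℕ) :
    ((Fin n → G) →₀ (Ω →₀ k)) →ₗ[k] ((Fin (n + 1) → G) →₀ (Ω →₀ k)) :=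
  Finsupp.lsum k fun g => Finsupp.lsum k fun ω =>
    Finsupp.lsingle (Fin.cons (r ω)⁻¹ g) ∘ₗ Finsupp.lsingle (α (r ω)⁻¹ ω)

theorem contraction_single (α : G →* Equiv.Perm Ω) (r : Ω → G) (n : ℕ) (g : Fin n → G) (ω : Ω)
    (a : k) : contraction α r n (Finsupp.single g (Finsupp.single ω a)) =
      Finsupp.single (Fin.cons (r ω)⁻¹ g) (Finsupp.single (α (r ω)⁻¹ ω) a) := by
  refine (Finsupp.lsum_single _ _ _ _).trans ?_
  exact Finsupp.lsum_single _ _ _ _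

/-- The cancellation in the homotopy formula `bd_contraction`. -/
theorem alternating_sum_cancel {M ι : Type*} [AddCommGroup M] [Module k M] [Fintype ι] (a b : M)
    (c : ι → k) (v : ι → M) :
    a + (-((-1 : k) ^ 0 • b) + ∑ x, c x • v x) + (b + ∑ x, -c x • v x) = a := by
  simp only [pow_zero, one_smul, neg_smul, Finset.sum_neg_distrib]
  abel

/-- The identity `∂s + s∂ = 1` for the contraction `s`, in positive degrees. -/
theorem bd_contraction (α : G →* Equiv.Perm Ω) (r : Ω → G) (hr : ∀ g ω, r (α g ω) = g * r ω)
    (n : ℕ) (c : (Fin (n + 1) → G) →₀ (Ω →₀ k)) :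
    bd (permRep k α) (n + 1) (contraction α r (n + 1) c) +
      contraction α r n (bd (permRep k α) n c) = c := by
  induction c using Finsupp.induction_linear with
  | zero => rw [map_zero, map_zero, map_zero, map_zero, add_zero]
  | add f g hf hg =>
    rw [map_add, map_add, map_add, map_add, add_add_add_comm, hf, hg]
  | single g a =>
    induction a using Finsupp.induction_linear with
    | zero => rw [Finsupp.single_zero, map_zero, map_zero, map_zero, map_zero, add_zero]
    | add f g hf hg =>
      rw [Finsupp.single_add, map_add, map_add, map_add, map_add, add_add_add_comm, hf, hg]
    | single ω a =>
      rw [contraction_single, bd_single, bd_single, map_add, map_sum, Fin.sum_univ_succ]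
      have h1 : (fun i : Fin (n + 1) => (Fin.cons (r ω)⁻¹ g : Fin (n + 2) → G) i.succ) = g := by
        funext i; simp
      have h2 : r (α (g 0)⁻¹ ω) = (g 0)⁻¹ * r ω := hr _ _
      have h3 : α ((r ω)⁻¹ * g 0) (α (g 0)⁻¹ ω) = α (r ω)⁻¹ ω := by
        rw [← Equiv.Perm.mul_apply, ← map_mul]; simp
      simp only [h1, permRep_single, Fin.cons_zero, inv_inv, contractNth_zero_cons,
        contractNth_succ_cons, contraction_single, map_smul, h2, mul_inv_rev, h3]
      rw [← Equiv.Perm.mul_apply, ← map_mul, mul_inv_cancel, map_one, Equiv.Perm.one_apply]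
      simp only [Fin.val_zero, zero_add, neg_smul, Fin.val_succ, pow_succ,
        mul_neg, mul_one, neg_neg]
      exact alternating_sum_cancel _ _ _ _

/-- The representation `k[Ω]` is acyclic if `Ω` is free, that is, if it has an equivariant map `r`
to `G`. -/
theorem permRep_acyclic (α : G →* Equiv.Perm Ω) (r : Ω → G) (hr : ∀ g ω, r (α g ω) = g * r ω)
    (n : ℕ) : Subsingleton (HG (permRep k α) (n + 1)) := by
  rw [HG_subsingleton_iff]
  intro z hz
  refine ⟨contraction α r (n + 1) z, ?_⟩
  have h := bd_contraction α r hr n z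
  rwa [show bd (permRep k α) n z = 0 from hz, map_zero, add_zero] at h

/-- If the fibres of `π` are the orbits, then the coinvariants of `k[Ω]` embed into `k[Ω']`. -/
theorem mem_coinvariantsKer_permRep {Ω' : Type u} (α : G →* Equiv.Perm Ω) (π : Ω → Ω')
    (h : ∀ a b, π a = π b → ∃ g, α g a = b) (x : Ω →₀ k)
    (hx : Finsupp.lmapDomain k k π x = 0) : x ∈ Representation.Coinvariants.ker (permRep k α) := by
  rcases isEmpty_or_nonempty Ω with h0 | h0
  · rw [Subsingleton.elim x 0]; exact zero_mem _
  · have key : ∀ y : Ω →₀ k, Finsupp.lmapDomain k k (Function.invFun π ∘ π) y - y ∈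
        Representation.Coinvariants.ker (permRep k α) := by
      intro y
      induction y using Finsupp.induction_linear with
      | zero => simp
      | add f g hf hg =>
        have := add_mem hf hg
        rw [map_add]
        convert this using 1
        abel
      | single ω a =>
        obtain ⟨g, hg⟩ := h ω (Function.invFun π (π ω)) (Function.invFun_eq ⟨ω, rfl⟩).symm
        have := Representation.Coinvariants.sub_mem_ker (ρ := permRep k α) g (Finsupp.single ω a)
        rw [permRep_single, hg] at this
        simpa using this
    have h1 := key x
    rw [Finsupp.lmapDomain_comp, LinearMap.comp_apply, hx, map_zero, zero_sub] at h1
    simpa using h1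

end Permutation

/-! ### Direct sums of copies of a representation -/

section Finsupp

variable {k : Type u} [CommRing k] {G : Type u} [Group G] {V W : Type u} [AddCommGroup V]
  [Module k V] [AddCommGroup W] [Module k W]

theorem finsupp_acyclic (ρ : Representation k G V) (X : Type u) (n : ℕ)
    (h : Subsingleton (HG ρ n)) : Subsingleton (HG (ρ.finsupp X) n) := by
  refine subsingleton_of_forall_eq 0 fun x => ?_
  have hj : ∀ i : X, Equivar (MonoidHom.id G) ρ (ρ.finsupp X) (Finsupp.lsingle i) := by
    intro i g v
    simp
  have hp : ∀ i : X, Equivar (MonoidHom.id G) (ρ.finsupp X) ρ (Finsupp.lapply i) := by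
    intro i g v
    induction v using Finsupp.induction_linear with
    | zero => simp
    | add f g hf hg => simp only [map_add, hf, hg]
    | single y a =>
      classical
      rcases eq_or_ne y i with rfl | hy
      · simp
      · simp [hy]
  obtain ⟨s, hs⟩ := exists_finset_sum_eq hj hp (fun x => ⟨x.support, fun t ht => by
    conv_rhs => rw [← Finsupp.sum_single x]
    exact (Finsupp.sum_of_support_subset x ht _ (by simp)).symm⟩) n x
  rw [← hs]
  refine Finset.sum_eq_zero fun i _ => ?_
  rw [Subsingleton.elim ((hp i).H n x) 0, map_zero]

/-- If the coinvariants of `V` embed into `W` by means of `q`, then those of the direct sum of copies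
of `V` embed into the direct sum of copies of `W`. -/
theorem mem_coinvariantsKer_finsupp (ρ : Representation k G V) (X : Type u) (q : V →ₗ[k] W)
    (h : ∀ x, q x = 0 → x ∈ Representation.Coinvariants.ker ρ) (x : X →₀ V)
    (hx : Finsupp.mapRange.linearMap q x = 0) :
    x ∈ Representation.Coinvariants.ker (ρ.finsupp X) := by
  rw [← Finsupp.sum_single x]
  refine sum_mem fun i _ => ?_
  have hi : x i ∈ Representation.Coinvariants.ker ρ := h _ (by
    simpa using DFunLike.congr_fun hx i)
  generalize x i = y at hi
  induction hi using Submodule.span_induction with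
  | mem y h =>
    obtain ⟨⟨g, a⟩, rfl⟩ := h
    have := Representation.Coinvariants.sub_mem_ker (ρ := ρ.finsupp X) g (Finsupp.single i a)
    simpa using this
  | zero => simp
  | add y z _ _ hy hz => rw [Finsupp.single_add]; exact add_mem hy hz
  | smul a y _ hy => rw [← Finsupp.smul_single]; exact Submodule.smul_mem _ _ hy

end Finsupp

/-! ### Complexes of representations -/

/-- A chain complex of representations of `G`. -/
structure RepCx (k : Type u) [CommRing k] (G : Type u) [Group G] where
  X : ℕ → Type u
  [acg : ∀ n, AddCommGroup (X n)]
  [mod : ∀ n, Module k (X n)]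
  ρ : ∀ n, Representation k G (X n)
  d : ∀ n, X (n + 1) →ₗ[k] X n
  hd : ∀ n, Equivar (MonoidHom.id G) (ρ (n + 1)) (ρ n) (d n)
  dd : ∀ n x, d n (d (n + 1) x) = 0

attribute [instance] RepCx.acg RepCx.mod

namespace RepCx

variable {k : Type u} [CommRing k] {G : Type u} [Group G] (K : RepCx k G)

/-- The boundaries in degree `n`. -/
def B (n : ℕ) : Submodule k (K.X n) := LinearMap.range (K.d n)

theorem d_mem_B (n : ℕ) (x) : K.d n x ∈ K.B n := ⟨x, rfl⟩

theorem B_le (n : ℕ) (g : G) : K.B n ≤ (K.B n).comap (K.ρ n g) := by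
  rintro _ ⟨x, rfl⟩
  exact ⟨K.ρ (n + 1) g x, K.hd n g x⟩

theorem ker_le (n : ℕ) (g : G) :
    LinearMap.ker (K.d n) ≤ (LinearMap.ker (K.d n)).comap (K.ρ (n + 1) g) := by
  intro x hx
  have hx : K.d n x = 0 := hx
  change K.d n (K.ρ (n + 1) g x) = 0
  rw [K.hd n g x, hx, map_zero]

/-- The representation on the boundaries. -/
def rB (n : ℕ) : Representation k G (K.B n) := (K.ρ n).subrepresentation (K.B n) (K.B_le n)

/-- The representation on the quotient by the boundaries. -/
def rY (n : ℕ) : Representation k G (K.X n ⧸ K.B n) := (K.ρ n).quotient (K.B n) (K.B_le n)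

/-- The representation on the cycles in degree `n + 1`. -/
def rZ (n : ℕ) : Representation k G (LinearMap.ker (K.d n)) :=
  (K.ρ (n + 1)).subrepresentation (LinearMap.ker (K.d n)) (K.ker_le n)

/-- The boundaries in degree `n + 1`, as a submodule of the cycles. -/
def BZ (n : ℕ) : Submodule k (LinearMap.ker (K.d n)) :=
  (K.B (n + 1)).comap (LinearMap.ker (K.d n)).subtype

theorem BZ_le (n : ℕ) (g : G) : K.BZ n ≤ (K.BZ n).comap (K.rZ n g) :=
  fun x hx => K.B_le (n + 1) g (show x.1 ∈ K.B (n + 1) from hx)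

/-- The representation on the homology in degree `n + 1`. -/
def rH (n : ℕ) : Representation k G (LinearMap.ker (K.d n) ⧸ K.BZ n) :=
  (K.rZ n).quotient (K.BZ n) (K.BZ_le n)

/-- The exact sequence `0 → B_n → X_n → X_n / B_n → 0`. -/
theorem ses₁ (n : ℕ) : SES (K.rB n) (K.ρ n) (K.rY n) (K.B n).subtype (K.B n).mkQ where
  hi _ _ := rfl
  hp _ _ := rfl
  inj := Subtype.val_injective
  surj := Submodule.mkQ_surjective _
  exact := by
    rw [LinearMap.exact_iff, Submodule.ker_mkQ, Submodule.range_subtype]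

/-- The map from the homology to the quotient by the boundaries. -/
def toY (n : ℕ) : (LinearMap.ker (K.d n) ⧸ K.BZ n) →ₗ[k] (K.X (n + 1) ⧸ K.B (n + 1)) :=
  Submodule.mapQ _ _ (LinearMap.ker (K.d n)).subtype le_rfl

/-- The map induced by the differential from the quotient by the boundaries to the boundaries. -/
def toB (n : ℕ) : (K.X (n + 1) ⧸ K.B (n + 1)) →ₗ[k] K.B n :=
  Submodule.liftQ _ (K.d n).rangeRestrict (by
    rintro _ ⟨x, rfl⟩
    exact Subtype.ext (K.dd n x))

/-- The exact sequence `0 → H_{n+1} → X_{n+1} / B_{n+1} → B_n → 0`. -/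
theorem ses₂ (n : ℕ) : SES (K.rH n) (K.rY (n + 1)) (K.rB n) (K.toY n) (K.toB n) where
  hi g x := by
    obtain ⟨x, rfl⟩ := Submodule.mkQ_surjective _ x
    rfl
  hp g x := by
    obtain ⟨x, rfl⟩ := Submodule.mkQ_surjective _ x
    exact Subtype.ext (K.hd n g x)
  inj := by
    refine (injective_iff_map_eq_zero _).2 fun x hx => ?_
    obtain ⟨x, rfl⟩ := Submodule.mkQ_surjective _ x
    have : (K.B (n + 1)).mkQ x.1 = 0 := hx
    rw [Submodule.mkQ_apply, Submodule.Quotient.mk_eq_zero] at this ⊢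
    exact this
  surj := by
    rintro ⟨_, x, rfl⟩
    exact ⟨(K.B (n + 1)).mkQ x, rfl⟩
  exact := by
    intro y
    obtain ⟨y, rfl⟩ := Submodule.mkQ_surjective _ y
    constructor
    · intro h
      have h' : K.d n y = 0 := congrArg Subtype.val h
      exact ⟨(K.BZ n).mkQ ⟨y, h'⟩, rfl⟩
    · rintro ⟨x, hx⟩
      obtain ⟨x, rfl⟩ := Submodule.mkQ_surjective _ x
      rw [← hx]
      exact Subtype.ext x.2

/-- An element whose image in the coinvariants of `X_n / B_n` vanishes is a boundary, up to
coinvariants. -/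
theorem exists_H0mk_d (n : ℕ) (x : K.X n) (h : H0mk (K.rY n) ((K.B n).mkQ x) = 0) :
    ∃ w, H0mk (K.ρ n) x = H0mk (K.ρ n) (K.d n w) := by
  rw [← (K.ses₁ n).hp.H_H0mk] at h
  obtain ⟨b, hb⟩ := ((K.ses₁ n).exact₂ 0 _).1 h
  obtain ⟨⟨_, w, rfl⟩, rfl⟩ := H0mk_surjective _ b
  rw [(K.ses₁ n).hi.H_H0mk] at hb
  exact ⟨w, hb.symm⟩

end RepCx

/-- A morphism of complexes of representations along a group homomorphism. -/
structure RepCxHom {k : Type u} [CommRing k] {G G' : Type u} [Group G] [Group G'] (φ : G' →* G)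
    (K' : RepCx k G') (K : RepCx k G) where
  f : ∀ n, K'.X n →ₗ[k] K.X n
  hf : ∀ n, Equivar φ (K'.ρ n) (K.ρ n) (f n)
  comm : ∀ n x, f n (K'.d n x) = K.d n (f (n + 1) x)

namespace RepCxHom

variable {k : Type u} [CommRing k] {G G' : Type u} [Group G] [Group G'] {φ : G' →* G}
  {K' : RepCx k G'} {K : RepCx k G} (F : RepCxHom φ K' K)

theorem map_B (n : ℕ) : K'.B n ≤ (K.B n).comap (F.f n) := by
  rintro _ ⟨x, rfl⟩
  exact ⟨F.f (n + 1) x, (F.comm n x).symm⟩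

theorem map_ker (n : ℕ) (x : K'.X (n + 1)) (hx : x ∈ LinearMap.ker (K'.d n)) :
    F.f (n + 1) x ∈ LinearMap.ker (K.d n) := by
  have hx : K'.d n x = 0 := hx
  change K.d n _ = 0
  rw [← F.comm, hx, map_zero]

/-- The map induced on boundaries. -/
def fB (n : ℕ) : K'.B n →ₗ[k] K.B n := (F.f n).restrict (F.map_B n)

/-- The map induced on the quotients by the boundaries. -/
def fY (n : ℕ) : (K'.X n ⧸ K'.B n) →ₗ[k] (K.X n ⧸ K.B n) := Submodule.mapQ _ _ (F.f n) (F.map_B n)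

/-- The map induced on the homology in degree `n + 1`. -/
def fH (n : ℕ) : (LinearMap.ker (K'.d n) ⧸ K'.BZ n) →ₗ[k] (LinearMap.ker (K.d n) ⧸ K.BZ n) :=
  Submodule.mapQ _ _ ((F.f (n + 1)).restrict (F.map_ker n)) (fun x hx => F.map_B (n + 1)
    (show x.1 ∈ K'.B (n + 1) from hx))

theorem hom₁ (n : ℕ) : SESHom (K'.ses₁ n) (K.ses₁ n) φ (F.fB n) (F.f n) (F.fY n) where
  h₁ g x := Subtype.ext (F.hf n g x.1)
  h₂ := F.hf n
  h₃ g x := by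
    obtain ⟨x, rfl⟩ := Submodule.mkQ_surjective _ x
    exact congrArg (K.B n).mkQ (F.hf n g x)
  c₁ _ := rfl
  c₂ _ := rfl

theorem hom₂ (n : ℕ) : SESHom (K'.ses₂ n) (K.ses₂ n) φ (F.fH n) (F.fY (n + 1)) (F.fB n) where
  h₁ g x := by
    obtain ⟨x, rfl⟩ := Submodule.mkQ_surjective _ x
    exact congrArg (K.BZ n).mkQ (Subtype.ext (F.hf (n + 1) g x.1))
  h₂ := (F.hom₁ (n + 1)).h₃
  h₃ := (F.hom₁ n).h₁
  c₁ x := by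
    obtain ⟨x, rfl⟩ := Submodule.mkQ_surjective _ x
    rfl
  c₂ x := by
    obtain ⟨x, rfl⟩ := Submodule.mkQ_surjective _ x
    exact Subtype.ext (F.comm n x)

open Function

/-- The map on the homology of the group with coefficients in the homology of the complex. -/
noncomputable abbrev HH (n p : ℕ) := (F.hom₂ n).h₁.H p

/-- The map on the homology of the group with coefficients in `X_n / B_n`. -/
noncomputable abbrev HY (n p : ℕ) := (F.hom₁ n).h₃.H p

/-- The map on the homology of the group with coefficients in `B_n`. -/
noncomputable abbrev HB (n p : ℕ) := (F.hom₁ n).h₁.H p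

/-- As `X_n` is acyclic, the homology with coefficients in `B_n` is that with coefficients in
`X_n / B_n` in one degree more. -/
theorem HB_surjective (n p : ℕ) (hK : Subsingleton (HG (K.ρ n) p))
    (h : Surjective (F.HY n (p + 1))) : Surjective (F.HB n p) := by
  intro e
  obtain ⟨c, rfl⟩ := ((K.ses₁ n).exact₁ p e).1 (Subsingleton.elim _ _)
  obtain ⟨c', rfl⟩ := h c
  exact ⟨_, (congr($((F.hom₁ n).sq₃ p) c')).symm⟩

theorem HB_injective (n p : ℕ) (hK' : Subsingleton (HG (K'.ρ n) p))
    (hK : Subsingleton (HG (K.ρ n) (p + 1)))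
    (h : Injective (F.HY n (p + 1))) : Injective (F.HB n p) := by
  refine (injective_iff_map_eq_zero _).2 fun b hb => ?_
  obtain ⟨c, rfl⟩ := ((K'.ses₁ n).exact₁ p b).1 (Subsingleton.elim _ _)
  have h1 : (K.ses₁ n).δ p (F.HY n (p + 1) c) = 0 := (congr($((F.hom₁ n).sq₃ p) c)).trans hb
  obtain ⟨y, hy⟩ := ((K.ses₁ n).exact₃ p _).1 h1
  rw [Subsingleton.elim y 0, map_zero] at hy
  have : c = 0 := h (hy.symm.trans (map_zero _).symm)
  rw [this, map_zero]

variable (aK' : ∀ n p, Subsingleton (HG (K'.ρ n) (p + 1)))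
  (aK : ∀ n p, Subsingleton (HG (K.ρ n) (p + 1)))

include aK in
/-- The passage from `X_n / B_n` to `X_{n+1} / B_{n+1}`, by means of the homology `H_{n+1}` of the
complex. -/
theorem HY_surjective (n p : ℕ) (h₁ : Surjective (F.HH n (p + 1)))
    (h₂ : Surjective (F.HY n (p + 2))) (h₃ : Injective (F.HH n p)) :
    Surjective (F.HY (n + 1) (p + 1)) :=
  (F.hom₂ n).surjective₂ p h₁ (F.HB_surjective n (p + 1) (aK _ _) h₂) h₃

include aK aK' in
theorem HY_injective (n p : ℕ) (h₁ : Injective (F.HH n (p + 1)))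
    (h₂ : Injective (F.HY n (p + 2))) (h₃ : Surjective (F.HY n (p + 3))) :
    Injective (F.HY (n + 1) (p + 1)) :=
  (F.hom₂ n).injective₂ (p + 1) (F.HB_surjective n (p + 2) (aK _ _) h₃) h₁
    (F.HB_injective n (p + 1) (aK' _ _) (aK _ _) h₂)

/-- A cycle of the complex of coinvariants of `K` comes from a cycle of the complex of coinvariants
of `K'`, up to a boundary. The coinvariants are the homology in degree zero, and the classes in the
homology with coefficients in `B_n`, `X_n / B_n` and `H_{n+1}` are chased through the two exact
sequences. -/
theorem exists_of_H0mk_d_eq_zero (n : ℕ) (h₁ : Surjective (F.HH n 0)) (h₂ : Surjective (F.HY n 1))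
    (x : K.X (n + 1)) (hx : H0mk (K.ρ n) (K.d n x) = 0) :
    ∃ x' w, H0mk (K'.ρ n) (K'.d n x') = 0 ∧
      H0mk (K.ρ (n + 1)) x = H0mk (K.ρ (n + 1)) (F.f (n + 1) x' + K.d (n + 1) w) := by
  have hb : (K.ses₁ n).hi.H 0 ((K.ses₂ n).hp.H 0 (H0mk _ ((K.B (n + 1)).mkQ x))) = 0 := by
    rw [(K.ses₂ n).hp.H_H0mk, (K.ses₁ n).hi.H_H0mk]
    exact hx
  obtain ⟨c, hc⟩ := ((K.ses₁ n).exact₁ 0 _).1 hb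
  obtain ⟨c', rfl⟩ := h₂ c
  obtain ⟨y', hy'⟩ := (K'.ses₂ n).H_zero_surjective ((K'.ses₁ n).δ 0 c')
  have e₁ : (K.ses₂ n).hp.H 0 (H0mk _ ((K.B (n + 1)).mkQ x) - F.HY (n + 1) 0 y') = 0 := by
    rw [map_sub, sub_eq_zero, ← hc]
    refine Eq.trans ?_ (congr($((F.hom₂ n).sq₂ 0) y')).symm
    exact (congr($((F.hom₁ n).sq₃ 0) c')).trans (congrArg _ hy'.symm)
  obtain ⟨t, ht⟩ := ((K.ses₂ n).exact₂ 0 _).1 e₁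
  obtain ⟨t', rfl⟩ := h₁ t
  obtain ⟨y'', hy''⟩ := H0mk_surjective (K'.rY (n + 1)) (y' + (K'.ses₂ n).hi.H 0 t')
  obtain ⟨x', rfl⟩ := Submodule.mkQ_surjective _ y''
  have e₂ : H0mk (K.rY (n + 1)) ((K.B (n + 1)).mkQ (x - F.f (n + 1) x')) = 0 := by
    have e₃ : H0mk (K.rY (n + 1)) ((K.B (n + 1)).mkQ (F.f (n + 1) x')) =
        F.HY (n + 1) 0 (y' + (K'.ses₂ n).hi.H 0 t') := by
      rw [← hy'', (F.hom₁ (n + 1)).h₃.H_H0mk]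
      rfl
    have e₄ : F.HY (n + 1) 0 ((K'.ses₂ n).hi.H 0 t') =
        H0mk _ ((K.B (n + 1)).mkQ x) - F.HY (n + 1) 0 y' :=
      (congr($((F.hom₂ n).sq₁ 0) t')).symm.trans ht
    rw [map_sub, map_sub, e₃, map_add, e₄]
    abel
  obtain ⟨w, hw⟩ := K.exists_H0mk_d (n + 1) _ e₂
  refine ⟨x', w, ?_, ?_⟩
  · have e₅ : H0mk (K'.ρ n) (K'.d n x') =
        (K'.ses₁ n).hi.H 0 ((K'.ses₂ n).hp.H 0 (H0mk _ ((K'.B (n + 1)).mkQ x'))) := by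
      rw [(K'.ses₂ n).hp.H_H0mk, (K'.ses₁ n).hi.H_H0mk]
      rfl
    rw [e₅, hy'', map_add, (K'.ses₂ n).exact₂ 0 |>.apply_apply_eq_zero, add_zero, hy']
    exact ((K'.ses₁ n).exact₁ 0).apply_apply_eq_zero _
  · rw [map_add, ← hw, map_sub]
    abel

include aK in
/-- A cycle of the complex of coinvariants of `K'` that becomes a boundary in the complex of
coinvariants of `K` is a boundary. -/
theorem exists_H0mk_eq (n : ℕ) (h₁ : Injective (F.HH n 0)) (h₂ : Injective (F.HY n 1))
    (h₃ : Surjective (F.HY n 2)) (x' : K'.X (n + 1)) (hx' : H0mk (K'.ρ n) (K'.d n x') = 0)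
    (w : K.X (n + 2))
    (hw : H0mk (K.ρ (n + 1)) (F.f (n + 1) x') = H0mk (K.ρ (n + 1)) (K.d (n + 1) w)) :
    ∃ w', H0mk (K'.ρ (n + 1)) x' = H0mk (K'.ρ (n + 1)) (K'.d (n + 1) w') := by
  apply K'.exists_H0mk_d
  set y' := H0mk (K'.rY (n + 1)) ((K'.B (n + 1)).mkQ x') with hy'
  have e₁ : F.HY (n + 1) 0 y' = 0 := by
    rw [hy', (F.hom₁ (n + 1)).h₃.H_H0mk]
    change H0mk _ ((K.B (n + 1)).mkQ (F.f (n + 1) x')) = 0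
    rw [← (K.ses₁ (n + 1)).hp.H_H0mk, hw, (K.ses₁ (n + 1)).hp.H_H0mk, Submodule.mkQ_apply,
      (Submodule.Quotient.mk_eq_zero _).2 (K.d_mem_B (n + 1) w), map_zero]
  have e₂ : (K'.ses₁ n).hi.H 0 ((K'.ses₂ n).hp.H 0 y') = 0 := by
    rw [hy', (K'.ses₂ n).hp.H_H0mk, (K'.ses₁ n).hi.H_H0mk]
    exact hx'
  obtain ⟨c', hc'⟩ := ((K'.ses₁ n).exact₁ 0 _).1 e₂
  have e₃ : (K.ses₁ n).δ 0 (F.HY n 1 c') = 0 := by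
    refine (congr($((F.hom₁ n).sq₃ 0) c')).trans ?_
    change F.HB n 0 ((K'.ses₁ n).δ 0 c') = 0
    rw [hc']
    refine (congr($((F.hom₂ n).sq₂ 0) y')).symm.trans ?_
    change (K.ses₂ n).hp.H 0 (F.HY (n + 1) 0 y') = 0
    rw [e₁, map_zero]
  obtain ⟨t, ht⟩ := ((K.ses₁ n).exact₃ 0 _).1 e₃
  have := aK n 0
  rw [Subsingleton.elim t 0, map_zero] at ht
  have e₄ : c' = 0 := h₂ (ht.symm.trans (map_zero _).symm)
  rw [e₄, map_zero] at hc'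
  obtain ⟨s, hs⟩ := ((K'.ses₂ n).exact₂ 0 _).1 hc'.symm
  have e₅ : (K.ses₂ n).hi.H 0 (F.HH n 0 s) = 0 := by
    refine (congr($((F.hom₂ n).sq₁ 0) s)).trans ?_
    change F.HY (n + 1) 0 ((K'.ses₂ n).hi.H 0 s) = 0
    rw [hs, e₁]
  obtain ⟨e, he⟩ := ((K.ses₂ n).exact₁ 0 _).1 e₅
  obtain ⟨e', rfl⟩ := F.HB_surjective n 1 (aK _ _) h₃ e
  have e₆ : s = (K'.ses₂ n).δ 0 e' := by
    apply h₁
    rw [← he]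
    exact congr($((F.hom₂ n).sq₃ 0) e')
  rw [← hs, e₆]
  exact ((K'.ses₂ n).exact₁ 0).apply_apply_eq_zero _

end RepCxHom

/-! ### Chains with coefficients in a bimodule -/

section FreeActions

variable {H Ω : Type u} [Group H]

/-- A free `H`-set has an equivariant map to `H`. -/
theorem exists_equivariant (α : H →* Equiv.Perm Ω) (hα : ∀ h ω, α h ω = ω → h = 1) :
    ∃ r : Ω → H, ∀ h ω, r (α h ω) = h * r ω := by
  let s : Setoid Ω :=
    { r := fun a b => ∃ h, α h a = b
      iseqv :=
        { refl := fun a => ⟨1, by simp⟩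
          symm := by
            rintro a _ ⟨h, rfl⟩
            exact ⟨h⁻¹, by simp⟩
          trans := by
            rintro a _ _ ⟨h, rfl⟩ ⟨h', rfl⟩
            exact ⟨h' * h, by simp⟩ } }
  have h1 : ∀ ω, ∃ h, α h (Quotient.mk s ω).out = ω := fun ω =>
    Quotient.exact (s := s) (Quotient.out_eq (Quotient.mk s ω))
  choose r hr using h1
  refine ⟨r, fun h ω => ?_⟩
  have h2 : Quotient.mk s (α h ω) = Quotient.mk s ω :=
    (Quotient.sound (s := s) (show s.r ω (α h ω) from ⟨h, rfl⟩)).symm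
  have h3 := hr (α h ω)
  rw [h2] at h3
  have h4 : α ((h * r ω)⁻¹ * r (α h ω)) (Quotient.mk s ω).out = (Quotient.mk s ω).out := by
    rw [map_mul, Equiv.Perm.mul_apply, h3, map_inv, Equiv.Perm.inv_eq_iff_eq, map_mul,
      Equiv.Perm.mul_apply, hr]
  exact (inv_mul_eq_one.1 (hα _ _ h4)).symm

variable {G : Type u} [Group G]

/-- The action of `H` on `G` by right multiplication, along a homomorphism `H → G`. -/
def rightPerm (ι : H →* G) : H →* Equiv.Perm G where
  toFun h := Equiv.mulRight (ι h)⁻¹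
  map_one' := by ext; simp
  map_mul' a b := by ext; simp [mul_assoc]

theorem rightPerm_apply (ι : H →* G) (h : H) (x : G) : rightPerm ι h x = x * (ι h)⁻¹ := rfl

/-- The action of `G` on itself by left multiplication. -/
def leftPerm (G : Type u) [Group G] : G →* Equiv.Perm G := MulAction.toPermHom G G

theorem leftPerm_apply (g x : G) : leftPerm G g x = g * x := rfl

variable {k : Type u} [CommRing k]

theorem rightPerm_acyclic (ι : H →* G) (hι : Function.Injective ι) (n : ℕ) :
    Subsingleton (HG (permRep k (rightPerm ι)) (n + 1)) := by
  obtain ⟨r, hr⟩ := exists_equivariant (rightPerm ι) (fun h x hx => by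
    rw [rightPerm_apply, mul_eq_left, inv_eq_one] at hx
    exact hι (hx.trans (map_one ι).symm))
  exact permRep_acyclic _ r hr n

theorem leftPerm_acyclic (n : ℕ) : Subsingleton (HG (permRep k (leftPerm G)) (n + 1)) :=
  permRep_acyclic _ (fun x => x) (fun _ _ => rfl) n

end FreeActions

section CoefCx

variable {k : Type u} [CommRing k] {S H S' H' : Type u} [Group S] [Group H] [Group S'] [Group H']
  {V V' : Type u} [AddCommGroup V] [Module k V] [AddCommGroup V'] [Module k V']

theorem Equivar.C_id {ρ : Representation k S V} {ρ' : Representation k S V'} {f : V →ₗ[k] V'}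
    (h : Equivar (MonoidHom.id S) ρ ρ' f) (n : ℕ) : h.C n = Finsupp.mapRange.linearMap f := by
  refine Finsupp.lhom_ext fun a b => ?_
  rw [h.C_single]
  simp

theorem finsupp_eq_C (ρ : Representation k S V) (τ : Representation k H V)
    (c : ∀ h, Equivar (MonoidHom.id S) ρ ρ (τ h)) (n : ℕ) (h : H) (x : (Fin n → S) →₀ V) :
    τ.finsupp (Fin n → S) h x = (c h).C n x := by
  rw [(c h).C_id]
  induction x using Finsupp.induction_linear with
  | zero => simp
  | add f g hf hg => simp only [map_add, hf, hg]
  | single g a => simp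

/-- The inhomogeneous chains of `S` with coefficients in a representation of `S` on which a group
`H` acts by automorphisms, as a complex of representations of `H`. -/
noncomputable abbrev coefCx (ρ : Representation k S V) (τ : Representation k H V)
    (c : ∀ h, Equivar (MonoidHom.id S) ρ ρ (τ h)) : RepCx k H where
  X n := (Fin n → S) →₀ V
  ρ n := τ.finsupp _
  d n := bd ρ n
  hd n h x := by
    rw [finsupp_eq_C ρ τ c, MonoidHom.id_apply, finsupp_eq_C ρ τ c, (c h).C_bd]
  dd n x := bd_bd ρ n x

theorem coefCx_acyclic (ρ : Representation k S V) (τ : Representation k H V)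
    (c : ∀ h, Equivar (MonoidHom.id S) ρ ρ (τ h)) (hτ : ∀ p, Subsingleton (HG τ (p + 1)))
    (n p : ℕ) : Subsingleton (HG ((coefCx ρ τ c).ρ n) (p + 1)) :=
  finsupp_acyclic τ _ _ (hτ p)

theorem subsingleton_HG (ρ : Representation k S V) [Subsingleton V] (n : ℕ) :
    Subsingleton (HG ρ n) := by
  rw [HG_subsingleton_iff]
  exact fun z _ => ⟨0, Finsupp.ext fun _ => Subsingleton.elim _ _⟩

theorem Equivar.C_finsupp {ρ : Representation k S V} {τ : Representation k H V}
    {ρ' : Representation k S' V'} {τ' : Representation k H' V'} {π : S' →* S} {φ : H' →* H}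
    {f : V' →ₗ[k] V} (hf : Equivar π ρ' ρ f) (hf' : Equivar φ τ' τ f) (n : ℕ) :
    Equivar φ (τ'.finsupp (Fin n → S')) (τ.finsupp (Fin n → S)) (hf.C n) := by
  intro g x
  induction x using Finsupp.induction_linear with
  | zero => simp
  | add f g hf hg => simp only [map_add, hf, hg]
  | single s a =>
    rw [Representation.finsupp_single, hf.C_single, hf.C_single, Representation.finsupp_single,
      hf' g a]

/-- Functoriality of `coefCx`. -/
noncomputable def coefCxHom {ρ : Representation k S V} {τ : Representation k H V}
    {ρ' : Representation k S' V'} {τ' : Representation k H' V'}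
    (c : ∀ h, Equivar (MonoidHom.id S) ρ ρ (τ h)) (c' : ∀ h, Equivar (MonoidHom.id S') ρ' ρ' (τ' h))
    {π : S' →* S} {φ : H' →* H} {f : V' →ₗ[k] V} (hf : Equivar π ρ' ρ f)
    (hf' : Equivar φ τ' τ f) : RepCxHom φ (coefCx ρ' τ' c') (coefCx ρ τ c) where
  f n := hf.C n
  hf n := hf.C_finsupp hf' n
  comm n x := hf.C_bd n x

end CoefCx

/-! ### Coinvariants of complexes -/

section Coinvariants

variable {k : Type u} [CommRing k]

/-- A chain complex of modules that is isomorphic to the complex of coinvariants of `K`, by means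
of a map `q` from `K`. -/
structure CoinvCx {G : Type u} [Group G] (K : RepCx k G) where
  X : ℕ → Type u
  [acg : ∀ n, AddCommGroup (X n)]
  [mod : ∀ n, Module k (X n)]
  d : ∀ n, X (n + 1) →ₗ[k] X n
  q : ∀ n, K.X n →ₗ[k] X n
  surj : ∀ n, Function.Surjective (q n)
  comm : ∀ n x, q n (K.d n x) = d n (q (n + 1) x)
  iff : ∀ n x, H0mk (K.ρ n) x = 0 ↔ q n x = 0

attribute [instance] CoinvCx.acg CoinvCx.mod

namespace RepCxHom

variable {G G' : Type u} [Group G] [Group G'] {φ : G' →* G}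
  {K' : RepCx k G'} {K : RepCx k G} (F : RepCxHom φ K' K) (Q' : CoinvCx K') (Q : CoinvCx K)
  (f : ∀ n, Q'.X n →ₗ[k] Q.X n) (hf : ∀ n x, Q.q n (F.f n x) = f n (Q'.q n x))

include F hf in
/-- The comparison of the complexes of coinvariants: surjectivity on homology. -/
theorem coinv_surjective (n : ℕ) (h₁ : Function.Surjective (F.HH n 0))
    (h₂ : Function.Surjective (F.HY n 1)) (z : Q.X (n + 1)) (hz : Q.d n z = 0) :
    ∃ y b, Q'.d n y = 0 ∧ z = f (n + 1) y + Q.d (n + 1) b := by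
  obtain ⟨x, rfl⟩ := Q.surj _ z
  rw [← Q.comm, ← Q.iff] at hz
  obtain ⟨x', w, h, h'⟩ := F.exists_of_H0mk_d_eq_zero n h₁ h₂ x hz
  refine ⟨Q'.q _ x', Q.q _ w, ?_, ?_⟩
  · rw [← Q'.comm, ← Q'.iff, h]
  · rw [← hf, ← Q.comm, ← map_add, ← sub_eq_zero, ← map_sub, ← Q.iff, map_sub, h', sub_self]

include F hf in
/-- The comparison of the complexes of coinvariants: injectivity on homology. -/
theorem coinv_injective (aK : ∀ n p, Subsingleton (HG (K.ρ n) (p + 1))) (n : ℕ)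
    (h₁ : Function.Injective (F.HH n 0)) (h₂ : Function.Injective (F.HY n 1))
    (h₃ : Function.Surjective (F.HY n 2)) (z : Q'.X (n + 1)) (hz : Q'.d n z = 0)
    (b : Q.X (n + 2)) (hb : f (n + 1) z = Q.d (n + 1) b) : ∃ b', z = Q'.d (n + 1) b' := by
  obtain ⟨x, rfl⟩ := Q'.surj _ z
  obtain ⟨w, rfl⟩ := Q.surj _ b
  rw [← Q'.comm, ← Q'.iff] at hz
  rw [← hf, ← Q.comm, ← sub_eq_zero, ← map_sub, ← Q.iff, map_sub, sub_eq_zero] at hb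
  obtain ⟨w', hw'⟩ := F.exists_H0mk_eq aK n h₁ h₂ h₃ x hz w hb
  refine ⟨Q'.q _ w', ?_⟩
  rw [← Q'.comm, ← sub_eq_zero, ← map_sub, ← Q'.iff, map_sub, hw', sub_self]

end RepCxHom

end Coinvariants

/-! ### Shapiro's lemma for permutation representations -/

section Shapiro

variable {k : Type u} [CommRing k] {G H : Type u} [Group G] [Group H]

/-- The sum of the coefficients of an element of `k[Ω]`. -/
noncomputable def aug (k Ω : Type u) [CommRing k] : (Ω →₀ k) →ₗ[k] k :=
  Finsupp.linearCombination k fun _ => (1 : k)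

theorem aug_single {Ω : Type u} (ω : Ω) (a : k) : aug k Ω (Finsupp.single ω a) = a := by
  simp [aug]

theorem aug_equivar {Ω : Type u} (α : G →* Equiv.Perm Ω) :
    Equivar (MonoidHom.id G) (permRep k α) (Representation.trivial k G k) (aug k Ω) := by
  intro g x
  induction x using Finsupp.induction_linear with
  | zero => simp
  | add f g hf hg => simp only [map_add, hf, hg]
  | single ω a => rw [permRep_single, aug_single, aug_single]; rfl

theorem aug_eq_zero_of_mem {Ω : Type u} (α : G →* Equiv.Perm Ω) {x : Ω →₀ k}
    (hx : x ∈ Representation.Coinvariants.ker (permRep k α)) : aug k Ω x = 0 := by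
  induction hx using Submodule.span_induction with
  | mem x h =>
    obtain ⟨⟨g, a⟩, rfl⟩ := h
    rw [map_sub, sub_eq_zero]
    exact aug_equivar α g a
  | zero => simp
  | add x y _ _ hx hy => rw [map_add, hx, hy, add_zero]
  | smul a x _ hx => rw [map_smul, hx, smul_zero]

theorem mem_of_aug_eq_zero {Ω : Type u} (α : G →* Equiv.Perm Ω) (hα : ∀ a b, ∃ g, α g a = b)
    {x : Ω →₀ k} (hx : aug k Ω x = 0) : x ∈ Representation.Coinvariants.ker (permRep k α) := by
  refine mem_coinvariantsKer_permRep α (fun _ => PUnit.unit.{u + 1}) (fun a b _ => hα a b) x ?_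
  have : ∀ y : Ω →₀ k, Finsupp.lmapDomain k k (fun _ => PUnit.unit.{u + 1}) y =
      Finsupp.single PUnit.unit (aug k Ω y) := by
    intro y
    induction y using Finsupp.induction_linear with
    | zero => simp
    | add f g hf hg => rw [map_add, map_add, hf, hg, Finsupp.single_add]
    | single ω a => rw [aug_single]; simp
  rw [this, hx, Finsupp.single_zero]

theorem single_mem_range_bd {V : Type u} [AddCommGroup V] [Module k V] (ρ : Representation k G V)
    (z : (Fin 0 → G) →₀ V) :
    z ∈ LinearMap.range (bd ρ 0) ↔ z default ∈ Representation.Coinvariants.ker ρ := by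
  rw [← H0mk_eq_zero_iff, H0mk, LinearMap.comp_apply, cls_eq_zero_iff]
  have : Finsupp.single default (z default) = z := by
    refine Finsupp.ext fun t => ?_
    obtain rfl := Subsingleton.elim t default
    exact Finsupp.single_eq_same
  rw [LinearMap.codRestrict_apply, Finsupp.lsingle_apply, this]
  rfl

theorem regular_comm (ι : H →* G) (h : H) :
    Equivar (MonoidHom.id G) (permRep k (leftPerm G)) (permRep k (leftPerm G))
      (permRep k (rightPerm ι) h) := by
  intro g x
  induction x using Finsupp.induction_linear with
  | zero => simp
  | add f g hf hg => simp only [map_add, hf, hg]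
  | single ω a =>
    simp only [permRep_single, MonoidHom.id_apply, leftPerm_apply, rightPerm_apply, mul_assoc]

/-- The inhomogeneous chains of `G` with coefficients in `k[G]`, as a complex of representations
of `H`, which acts on the coefficients by right multiplication. -/
noncomputable abbrev regularCx (k : Type u) [CommRing k] (ι : H →* G) : RepCx k H :=
  coefCx (permRep k (leftPerm G)) (permRep k (rightPerm ι)) (regular_comm ι)

/-- The regular complex is a resolution of the trivial module. -/
theorem regularCx_homology (ι : H →* G) (n : ℕ) :
    Subsingleton (LinearMap.ker ((regularCx k ι).d n) ⧸ (regularCx k ι).BZ n) := by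
  rw [Submodule.Quotient.subsingleton_iff, eq_top_iff]
  rintro ⟨x, hx⟩ -
  obtain ⟨b, hb⟩ := (HG_subsingleton_iff _ _).1 (leftPerm_acyclic (k := k) (G := G) n) x hx
  exact ⟨b, hb⟩

theorem lmapDomain_equivar {Ω Ω' : Type u} {φ : H →* G} (α : H →* Equiv.Perm Ω)
    (β : G →* Equiv.Perm Ω') (j : Ω → Ω') (hj : ∀ h ω, j (α h ω) = β (φ h) (j ω)) :
    Equivar φ (permRep k α) (permRep k β) (Finsupp.lmapDomain k k j) := by
  intro g x
  induction x using Finsupp.induction_linear with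
  | zero => simp
  | add f g hf hg => simp only [map_add, hf, hg]
  | single ω a =>
    rw [permRep_single, Finsupp.lmapDomain_apply, Finsupp.lmapDomain_apply,
      Finsupp.mapDomain_single, Finsupp.mapDomain_single, permRep_single, hj]

theorem regular_equivar (ι : H →* G) : Equivar ι (permRep k (leftPerm H)) (permRep k (leftPerm G))
    (Finsupp.lmapDomain k k ι) :=
  lmapDomain_equivar _ _ _ fun h ω => by simp [leftPerm_apply]

/-- The inclusion of the regular complex of a subgroup. -/
noncomputable def regularHom (k : Type u) [CommRing k] (ι : H →* G) :
    RepCxHom (MonoidHom.id H) (regularCx k (MonoidHom.id H)) (regularCx k ι) :=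
  coefCxHom _ _ (regular_equivar ι)
    (lmapDomain_equivar _ _ _ fun h ω => by simp [rightPerm_apply])

theorem regularHom_f_single (ι : H →* G) (n : ℕ) (g : Fin n → H) (a : H →₀ k) :
    (regularHom k ι).f n (Finsupp.single g a) =
      Finsupp.single (ι ∘ g) (Finsupp.lmapDomain k k ι a) :=
  (regular_equivar ι).C_single _ _ _

theorem aug_lmapDomain {Ω Ω' : Type u} (j : Ω → Ω') (x : Ω →₀ k) :
    aug k Ω' (Finsupp.lmapDomain k k j x) = aug k Ω x := by
  induction x using Finsupp.induction_linear with
  | zero => simp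
  | add f g hf hg => simp only [map_add, hf, hg]
  | single ω a => rw [Finsupp.lmapDomain_apply, Finsupp.mapDomain_single, aug_single, aug_single]

/-- The sum of the coefficients of a `0`-chain. -/
noncomputable def aug₀ (k G : Type u) [CommRing k] : ((Fin 0 → G) →₀ (G →₀ k)) →ₗ[k] k :=
  aug k G ∘ₗ Finsupp.lapply default

omit [Group G] in
theorem aug₀_single (g : Fin 0 → G) (a : G →₀ k) : aug₀ k G (Finsupp.single g a) = aug k G a := by
  rw [Subsingleton.elim g default]
  exact congrArg (aug k G) Finsupp.single_eq_same

theorem mem_B_regularCx (ι : H →* G) (z : (Fin 0 → G) →₀ (G →₀ k)) :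
    (Submodule.Quotient.mk z : (regularCx k ι).X 0 ⧸ (regularCx k ι).B 0) = 0 ↔
      aug₀ k G z = 0 := by
  rw [Submodule.Quotient.mk_eq_zero]
  refine (single_mem_range_bd _ z).trans ⟨aug_eq_zero_of_mem _, mem_of_aug_eq_zero _ ?_⟩
  exact fun a b => ⟨b * a⁻¹, by rw [leftPerm_apply]; simp⟩

theorem regularHom_f_zero (ι : H →* G) (z : (Fin 0 → H) →₀ (H →₀ k)) :
    aug₀ k G ((regularHom k ι).f 0 z) = aug₀ k H z := by
  induction z using Finsupp.induction_linear with
  | zero => rw [map_zero, map_zero, map_zero]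
  | add f g hf hg => rw [map_add, map_add, map_add, hf, hg]
  | single g a =>
    rw [aug₀_single, regularHom_f_single]
    exact (aug₀_single _ _).trans (aug_lmapDomain _ _)

/-- In degree zero, both quotients by the boundaries are the trivial module. -/
theorem regularHom_HY_zero (ι : H →* G) (p : ℕ) :
    Function.Bijective ((regularHom k ι).HY 0 p) := by
  have hb : Function.Bijective ((regularHom k ι).fY 0) := by
    constructor
    · refine (injective_iff_map_eq_zero _).2 fun x hx => ?_
      obtain ⟨x, rfl⟩ := Submodule.mkQ_surjective _ x
      exact (mem_B_regularCx _ x).2 ((regularHom_f_zero ι x).symm.trans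
        ((mem_B_regularCx ι ((regularHom k ι).f 0 x)).1 hx))
    · intro y
      obtain ⟨y, rfl⟩ := Submodule.mkQ_surjective _ y
      let x : (regularCx k (MonoidHom.id H)).X 0 :=
        Finsupp.single default (Finsupp.single (1 : H) (aug₀ k G y))
      refine ⟨Submodule.mkQ _ x, ?_⟩
      refine sub_eq_zero.1 ((mem_B_regularCx ι ((regularHom k ι).f 0 x - y)).2 ?_)
      refine (map_sub (aug₀ k G) ((regularHom k ι).f 0 x) y).trans (sub_eq_zero.2 ?_)
      exact (regularHom_f_zero ι x).trans ((aug₀_single _ _).trans (aug_single _ _))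
  exact Equivar.H_bijective_of_equiv (MulEquiv.refl H) (LinearEquiv.ofBijective _ hb)
    ((regularHom k ι).hom₁ 0).h₃ p

theorem regularHom_HH (ι : H →* G) (n p : ℕ) :
    Function.Bijective ((regularHom k ι).HH n p) := by
  have := regularCx_homology (k := k) ι n
  have := regularCx_homology (k := k) (MonoidHom.id H) n
  have := subsingleton_HG ((regularCx k ι).rH n) p
  have := subsingleton_HG ((regularCx k (MonoidHom.id H)).rH n) p
  exact ⟨fun _ _ _ => Subsingleton.elim _ _, fun y => ⟨0, Subsingleton.elim _ _⟩⟩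

theorem regularHom_HY (ι : H →* G) (hι : Function.Injective ι) (n p : ℕ) :
    Function.Bijective ((regularHom k ι).HY n (p + 1)) := by
  have aK' := coefCx_acyclic (permRep k (leftPerm H)) _ (regular_comm (MonoidHom.id H))
    (rightPerm_acyclic (k := k) (MonoidHom.id H) Function.injective_id)
  have aK := coefCx_acyclic (permRep k (leftPerm G)) _ (regular_comm ι)
    (rightPerm_acyclic (k := k) ι hι)
  induction n generalizing p with
  | zero => exact regularHom_HY_zero ι _
  | succ n ih =>
    exact ⟨(regularHom k ι).HY_injective aK' aK n p (regularHom_HH ι _ _).1 (ih _).1 (ih _).2,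
      (regularHom k ι).HY_surjective aK n p (regularHom_HH ι _ _).2 (ih _).2 (regularHom_HH ι _ _).1⟩

/-- If `q : V → W` is surjective and identifies `W` with the coinvariants of `V` under `H`, then
the coinvariants of the chains of `S` with coefficients in `V` are the chains with coefficients in
`W`. -/
noncomputable abbrev coefCoinv {S V W : Type u} [Group S] [AddCommGroup V] [Module k V]
    [AddCommGroup W] [Module k W] {ρ : Representation k S V} {τ : Representation k H V}
    {μ : Representation k S W} (c : ∀ h, Equivar (MonoidHom.id S) ρ ρ (τ h)) {q : V →ₗ[k] W}
    (hq : Equivar (MonoidHom.id S) ρ μ q)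
    (hs : Function.Surjective q) (hq' : ∀ h x, q (τ h x) = q x)
    (hker : ∀ x, q x = 0 → x ∈ Representation.Coinvariants.ker τ) : CoinvCx (coefCx ρ τ c) where
  X n := (Fin n → S) →₀ W
  d n := bd μ n
  q n := hq.C n
  surj n := by
    intro z
    induction z using Finsupp.induction_linear with
    | zero => exact ⟨0, map_zero _⟩
    | add f g hf hg =>
      obtain ⟨x, rfl⟩ := hf
      obtain ⟨y, rfl⟩ := hg
      exact ⟨x + y, map_add _ _ _⟩
    | single g a =>
      obtain ⟨a, rfl⟩ := hs a
      exact ⟨Finsupp.single g a, hq.C_single _ _ _⟩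
  comm n x := hq.C_bd n x
  iff n x := by
    rw [H0mk_eq_zero_iff]
    constructor
    · intro h
      induction h using Submodule.span_induction with
      | mem x h =>
        obtain ⟨⟨g, a⟩, rfl⟩ := h
        rw [map_sub, sub_eq_zero]
        induction a using Finsupp.induction_linear with
        | zero => simp
        | add f g hf hg => simp only [map_add, hf, hg]
        | single g a => rw [Representation.finsupp_single, hq.C_single, hq.C_single, hq']
      | zero => simp
      | add x y _ _ hx hy => rw [map_add, hx, hy, add_zero]
      | smul a x _ hx => rw [map_smul, hx, smul_zero]
    · intro h
      exact mem_coinvariantsKer_finsupp τ _ q hker _ (by rw [← hq.C_id, h])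

variable {Ω : Type u}

theorem single_equivar (ι : H →* G) (α : G →* Equiv.Perm Ω) (ω : Ω) (hω : ∀ h, α (ι h) ω = ω) :
    Equivar ι (Representation.trivial k H k) (permRep k α) (Finsupp.lsingle ω) := by
  intro h a
  rw [Finsupp.lsingle_apply, Finsupp.lsingle_apply, permRep_single, hω]
  rfl

/-- Shapiro's lemma for a transitive permutation representation: the homology of `G` with
coefficients in `k[Ω]` is the homology of the stabilizer `H` of a point `ω`. Both sides are computed
by the coinvariants under `H` of a resolution, the chains of `H` with coefficients in `k[H]` and the
chains of `G` with coefficients in `k[G]`. -/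
theorem shapiro (ι : H →* G) (hι : Function.Injective ι) (α : G →* Equiv.Perm Ω) (ω : Ω)
    (hω : ∀ h, α (ι h) ω = ω) (hstab : ∀ g, α g ω = ω → ∃ h, ι h = g) (htr : ∀ a, ∃ g, α g ω = a)
    (n : ℕ) : Function.Bijective ((single_equivar (k := k) ι α ω hω).H n) := by
  have hs := single_equivar (k := k) ι α ω hω
  cases n with
  | zero =>
    constructor
    · refine (injective_iff_map_eq_zero _).2 fun x hx => ?_
      obtain ⟨x, rfl⟩ := H0mk_surjective _ x
      rw [hs.H_H0mk, H0mk_eq_zero_iff] at hx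
      have : x = 0 := (aug_single ω x).symm.trans (aug_eq_zero_of_mem α hx)
      rw [this, map_zero]
    · intro y
      obtain ⟨y, rfl⟩ := H0mk_surjective _ y
      refine ⟨H0mk _ (aug k Ω y), ?_⟩
      rw [hs.H_H0mk, ← sub_eq_zero, ← map_sub, H0mk_eq_zero_iff]
      refine mem_of_aug_eq_zero α (fun a b => ?_) ?_
      · obtain ⟨g, rfl⟩ := htr a
        obtain ⟨h, rfl⟩ := htr b
        exact ⟨h * g⁻¹, by rw [← Equiv.Perm.mul_apply, ← map_mul, inv_mul_cancel_right]⟩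
      · rw [map_sub, Finsupp.lsingle_apply, aug_single, sub_self]
  | succ m =>
    have hq : Equivar (MonoidHom.id G) (permRep k (leftPerm G)) (permRep k α)
        (Finsupp.lmapDomain k k fun g => α g ω) :=
      lmapDomain_equivar _ _ _ fun h g => by simp [leftPerm_apply]
    have hq' := aug_equivar (k := k) (leftPerm H)
    let Q := coefCoinv (regular_comm ι) hq (by
        intro z
        induction z using Finsupp.induction_linear with
        | zero => exact ⟨0, map_zero _⟩
        | add f g hf hg =>
          obtain ⟨x, rfl⟩ := hf
          obtain ⟨y, rfl⟩ := hg
          exact ⟨x + y, map_add _ _ _⟩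
        | single b a =>
          obtain ⟨g, rfl⟩ := htr b
          exact ⟨Finsupp.single g a, Finsupp.mapDomain_single⟩)
      (by
        intro h x
        induction x using Finsupp.induction_linear with
        | zero => simp
        | add f g hf hg => simp only [map_add, hf, hg]
        | single g a =>
          rw [permRep_single, Finsupp.lmapDomain_apply, Finsupp.lmapDomain_apply,
            Finsupp.mapDomain_single, Finsupp.mapDomain_single, rightPerm_apply, map_mul,
            Equiv.Perm.mul_apply, ← map_inv, hω])
      (mem_coinvariantsKer_permRep _ _ (by
        intro a b hab
        obtain ⟨h, hh⟩ := hstab (a⁻¹ * b) (by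
          rw [map_mul, Equiv.Perm.mul_apply, ← hab, ← Equiv.Perm.mul_apply, ← map_mul]; simp)
        exact ⟨h⁻¹, by rw [rightPerm_apply, map_inv, hh]; simp⟩))
    let Q' := coefCoinv (regular_comm (k := k) (MonoidHom.id H)) hq'
      (fun a => ⟨Finsupp.single 1 a, aug_single _ _⟩)
      (fun h x => aug_equivar _ _ _)
      (fun x hx => mem_of_aug_eq_zero _ (fun a b => ⟨b⁻¹ * a, by rw [rightPerm_apply]; simp⟩) hx)
    have hsq : ∀ m x, hq.C m ((regularHom k ι).f m x) = hs.C m (hq'.C m x) := by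
      intro m x
      have h1 : Finsupp.lmapDomain k k (fun g => α g ω) ∘ₗ Finsupp.lmapDomain k k ι =
          Finsupp.lsingle ω ∘ₗ aug k H := by
        refine Finsupp.lhom_ext fun h a => ?_
        simp only [LinearMap.comp_apply, Finsupp.lmapDomain_apply, Finsupp.mapDomain_single,
          aug_single, hω, Finsupp.lsingle_apply]
      induction x using Finsupp.induction_linear with
      | zero => rw [map_zero, map_zero, map_zero, map_zero]
      | add f g hf hg => rw [map_add, map_add, map_add, map_add, hf, hg]
      | single g a =>
        rw [regularHom_f_single, hq.C_single, hq'.C_single, hs.C_single]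
        exact congrArg (Finsupp.single (ι ∘ g)) (congr($h1 a))
    have aK := coefCx_acyclic (permRep k (leftPerm G)) _ (regular_comm ι)
      (rightPerm_acyclic (k := k) ι hι)
    constructor
    · rw [Equivar.H_injective_iff]
      rintro z hz ⟨b, hb⟩
      obtain ⟨b', hb'⟩ := (regularHom k ι).coinv_injective Q' Q (fun n => hs.C n) hsq aK m
        (regularHom_HH ι _ _).1 (regularHom_HY ι hι _ _).1 (regularHom_HY ι hι _ _).2 z hz b hb.symm
      exact ⟨b', hb'.symm⟩
    · rw [Equivar.H_surjective_iff]
      intro z hz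
      obtain ⟨y, b, hy, h⟩ := (regularHom k ι).coinv_surjective Q' Q (fun n => hs.C n) hsq m
        (regularHom_HH ι _ _).2 (regularHom_HY ι hι _ _).2 z hz
      exact ⟨y, hy, b, h⟩

end Shapiro

/-! ### Inner automorphisms act trivially on homology -/

section Inner

variable {k : Type u} [CommRing k] {G G' : Type u} [Group G] [Group G']
variable {V W : Type u} [AddCommGroup V] [AddCommGroup W] [Module k V] [Module k W]

/-- The permutations `(x, v) ↦ (g x, v)` of `G × V`. -/
def coverPerm (G V : Type u) [Group G] : G →* Equiv.Perm (G × V) where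
  toFun g := (leftPerm G g).prodCongr (Equiv.refl V)
  map_one' := by ext <;> simp
  map_mul' a b := by ext <;> simp [leftPerm_apply]

/-- The surjection from the free representation `k[G × V]` to `V`. -/
noncomputable def coverMap (ρ : Representation k G V) : (G × V →₀ k) →ₗ[k] V :=
  Finsupp.linearCombination k fun x => ρ x.1 x.2

theorem coverMap_single (ρ : Representation k G V) (x : G × V) (a : k) :
    coverMap ρ (Finsupp.single x a) = a • ρ x.1 x.2 :=
  Finsupp.linearCombination_single _ _ _

theorem coverMap_equivar (ρ : Representation k G V) :
    Equivar (MonoidHom.id G) (permRep k (coverPerm G V)) ρ (coverMap ρ) := by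
  intro g x
  induction x using Finsupp.induction_linear with
  | zero => simp
  | add f g hf hg => simp only [map_add, hf, hg]
  | single x a =>
    rw [permRep_single, coverMap_single, coverMap_single]
    simp [coverPerm, leftPerm_apply]

theorem ker_coverMap_le (ρ : Representation k G V) (g : G) :
    LinearMap.ker (coverMap ρ) ≤
      (LinearMap.ker (coverMap ρ)).comap (permRep k (coverPerm G V) g) := by
  intro x hx
  have hx : coverMap ρ x = 0 := hx
  change coverMap ρ _ = 0
  rw [coverMap_equivar, hx, map_zero]

/-- The representation on the kernel of `coverMap`. -/
noncomputable def coverKer (ρ : Representation k G V) :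
    Representation k G (LinearMap.ker (coverMap ρ)) :=
  (permRep k (coverPerm G V)).subrepresentation (LinearMap.ker (coverMap ρ)) (ker_coverMap_le ρ)

theorem cover_ses (ρ : Representation k G V) :
    SES (V₁ := LinearMap.ker (coverMap ρ)) (coverKer ρ) (permRep k (coverPerm G V)) ρ
      (LinearMap.ker (coverMap ρ)).subtype (coverMap ρ) where
  hi _ _ := rfl
  hp := coverMap_equivar ρ
  inj := Subtype.val_injective
  surj v := ⟨Finsupp.single (1, v) 1, by rw [coverMap_single]; simp⟩
  exact := by rw [LinearMap.exact_iff, Submodule.range_subtype]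

theorem cover_acyclic (V : Type u) (n : ℕ) :
    Subsingleton (HG (permRep k (coverPerm G V)) (n + 1)) :=
  permRep_acyclic _ Prod.fst (fun _ _ => rfl) n

theorem conj_equivar (ρ : Representation k G V) (g : G) :
    Equivar (MulAut.conj g).toMonoidHom ρ ρ (ρ g) := by
  intro h x
  simp [← Module.End.mul_apply, ← map_mul]

/-- An inner automorphism, together with the action of the corresponding element on the
coefficients, induces the identity on homology. -/
theorem H_conj (ρ : Representation k G V) (g : G) (n : ℕ) (x : HG ρ n) :
    (conj_equivar ρ g).H n x = x := by
  induction n generalizing V with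
  | zero =>
    obtain ⟨x, rfl⟩ := H0mk_surjective _ x
    rw [Equivar.H_H0mk, H0mk_rho]
  | succ n ih =>
    have hacyc := cover_acyclic (k := k) (G := G) V n
    have hinj : Function.Injective ((cover_ses ρ).δ n) := by
      refine (injective_iff_map_eq_zero _).2 fun y hy => ?_
      obtain ⟨z, rfl⟩ := ((cover_ses ρ).exact₃ n y).1 hy
      rw [Subsingleton.elim z 0, map_zero]
    apply hinj
    rw [SES.δ_naturality (cover_ses ρ) (cover_ses ρ) (conj_equivar _ g) (conj_equivar _ g)
      (conj_equivar ρ g) (fun _ => rfl) (fun x => (coverMap_equivar ρ g x).symm) n x]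
    exact ih _ _

end Inner

/-! ### Comparison of equivariant maps -/

section Comparison

variable {k : Type u} [CommRing k] {G G' : Type u} [Group G] [Group G']
variable {V V' W W' : Type u} [AddCommGroup V] [AddCommGroup W] [Module k V] [Module k W]
  [AddCommGroup V'] [AddCommGroup W'] [Module k V'] [Module k W']
variable {ρ : Representation k G V} {ρ' : Representation k G' V'} {τ : Representation k G W}
  {τ' : Representation k G' W'} {φ : G' →* G} {f : V' →ₗ[k] V} {e : W' →ₗ[k] W} {a : V →ₗ[k] W}
  {a' : V' →ₗ[k] W'}

theorem Equivar.H_square {H H' : Type u} [Group H] [Group H'] {τ : Representation k H W}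
    {τ' : Representation k H' W'} {α : G →* H} {α' : G' →* H'} {ψ : H' →* H}
    (hf : Equivar φ ρ' ρ f) (he : Equivar ψ τ' τ e)
    (ha : Equivar α ρ τ a) (ha' : Equivar α' ρ' τ' a') (hα : ∀ x, α (φ x) = ψ (α' x))
    (hc : ∀ x, a (f x) = e (a' x)) (n : ℕ) (x : HG ρ' n) :
    ha.H n (hf.H n x) = he.H n (ha'.H n x) := by
  rw [← hf.H_comp ha (hf.comp ha) (fun _ => rfl) (fun _ => rfl),
    ← ha'.H_comp he (hf.comp ha) (fun x => hα x) (fun x => hc x)]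

section Square

variable {H H' : Type u} [Group H] [Group H'] {τ : Representation k H W}
  {τ' : Representation k H' W'} {α : G →* H} {α' : G' →* H'} {ψ : H' →* H}

theorem Equivar.H_injective_iff_of_square (hf : Equivar φ ρ' ρ f) (he : Equivar ψ τ' τ e)
    (ha : Equivar α ρ τ a) (ha' : Equivar α' ρ' τ' a') (hα : ∀ x, α (φ x) = ψ (α' x))
    (hc : ∀ x, a (f x) = e (a' x)) (n : ℕ) (h1 : Function.Bijective (ha.H n))
    (h2 : Function.Bijective (ha'.H n)) :
    Function.Injective (hf.H n) ↔ Function.Injective (he.H n) := by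
  constructor
  · intro h x y hxy
    obtain ⟨x, rfl⟩ := h2.2 x
    obtain ⟨y, rfl⟩ := h2.2 y
    rw [← hf.H_square he ha ha' hα hc, ← hf.H_square he ha ha' hα hc] at hxy
    rw [h (h1.1 hxy)]
  · intro h x y hxy
    apply h2.1
    apply h
    rw [← hf.H_square he ha ha' hα hc, ← hf.H_square he ha ha' hα hc, hxy]

theorem Equivar.H_surjective_iff_of_square (hf : Equivar φ ρ' ρ f) (he : Equivar ψ τ' τ e)
    (ha : Equivar α ρ τ a) (ha' : Equivar α' ρ' τ' a') (hα : ∀ x, α (φ x) = ψ (α' x))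
    (hc : ∀ x, a (f x) = e (a' x)) (n : ℕ) (h1 : Function.Bijective (ha.H n))
    (h2 : Function.Bijective (ha'.H n)) :
    Function.Surjective (hf.H n) ↔ Function.Surjective (he.H n) := by
  constructor
  · intro h y
    obtain ⟨y, rfl⟩ := h1.2 y
    obtain ⟨x, rfl⟩ := h y
    exact ⟨ha'.H n x, (hf.H_square he ha ha' hα hc n x).symm⟩
  · intro h x
    obtain ⟨y, hy⟩ := h (ha.H n x)
    obtain ⟨y, rfl⟩ := h2.2 y
    refine ⟨y, h1.1 ?_⟩
    rw [hf.H_square he ha ha' hα hc, hy]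

end Square

theorem Equivar.H_bijective_of_bijective (h : Equivar (MonoidHom.id G) ρ τ a)
    (hb : Function.Bijective a) (n : ℕ) : Function.Bijective (h.H n) :=
  Equivar.H_bijective_of_equiv (MulEquiv.refl G) (LinearEquiv.ofBijective a hb) h n

/-- Isomorphic maps of representations induce isomorphic maps on homology: injectivity. -/
theorem Equivar.H_injective_iff_of_bijective (hf : Equivar φ ρ' ρ f) (he : Equivar φ τ' τ e)
    (ha : Equivar (MonoidHom.id G) ρ τ a) (ha' : Equivar (MonoidHom.id G') ρ' τ' a')
    (hb : Function.Bijective a) (hb' : Function.Bijective a') (hc : ∀ x, a (f x) = e (a' x))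
    (n : ℕ) : Function.Injective (hf.H n) ↔ Function.Injective (he.H n) :=
  hf.H_injective_iff_of_square he ha ha' (fun _ => rfl) hc n (ha.H_bijective_of_bijective hb n)
    (ha'.H_bijective_of_bijective hb' n)

/-- Isomorphic maps of representations induce isomorphic maps on homology: surjectivity. -/
theorem Equivar.H_surjective_iff_of_bijective (hf : Equivar φ ρ' ρ f) (he : Equivar φ τ' τ e)
    (ha : Equivar (MonoidHom.id G) ρ τ a) (ha' : Equivar (MonoidHom.id G') ρ' τ' a')
    (hb : Function.Bijective a) (hb' : Function.Bijective a') (hc : ∀ x, a (f x) = e (a' x))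
    (n : ℕ) : Function.Surjective (hf.H n) ↔ Function.Surjective (he.H n) :=
  hf.H_surjective_iff_of_square he ha ha' (fun _ => rfl) hc n (ha.H_bijective_of_bijective hb n)
    (ha'.H_bijective_of_bijective hb' n)

end Comparison

/-! ### Group actions on homology -/

section HomologyRep

variable {k : Type u} [CommRing k] {G S : Type u} [Group G] [Group S]
variable {V : Type u} [AddCommGroup V] [Module k V]

/-- The representation of `G` on `H_n(S; V)` induced by actions of `G` on `S` and on `V`. -/
noncomputable def homologyRep {ρ : Representation k S V} (φ : G → S →* S) (τ : Representation k G V)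
    (h₁ : ∀ x, φ 1 x = x) (h₂ : ∀ g h x, φ (g * h) x = φ g (φ h x))
    (c : ∀ g, Equivar (φ g) ρ ρ (τ g)) (n : ℕ) : Representation k G (HG ρ n) where
  toFun g := (c g).H n
  map_one' := by
    refine LinearMap.ext fun x => ?_
    exact Equivar.H_id _ h₁ (fun x => by simp) n x
  map_mul' g h := by
    refine LinearMap.ext fun x => ?_
    exact (c h).H_comp (c g) (c (g * h)) (h₂ g h) (fun x => by simp) n x

/-- The representation of `G` on `H_n(K; k)` induced by an action of `G` on `K`. -/
noncomputable def kerRep (k : Type u) [CommRing k] {K : Type u} [Group K] (a : G →* MulAut K)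
    (n : ℕ) : Representation k G (HG (Representation.trivial k K k) n) :=
  homologyRep (fun g => (a g).toMonoidHom) (Representation.trivial k G k) (fun x => by simp)
    (fun g h x => by simp) (fun _ _ _ => rfl) n

end HomologyRep

/-! ### Reduced chains of a split extension -/

section Split

variable {k : Type u} [CommRing k] {S G S' G' : Type u} [Group S] [Group G] [Group S'] [Group G']
variable {V V' : Type u} [AddCommGroup V] [Module k V] [AddCommGroup V'] [Module k V']

theorem Equivar.C_comp {S₁ S₂ S₃ V₁ V₂ V₃ : Type u} [Group S₁] [Group S₂] [Group S₃]
    [AddCommGroup V₁] [Module k V₁] [AddCommGroup V₂] [Module k V₂] [AddCommGroup V₃] [Module k V₃]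
    {ρ₁ : Representation k S₁ V₁} {ρ₂ : Representation k S₂ V₂} {ρ₃ : Representation k S₃ V₃}
    {φ : S₁ →* S₂} {ψ : S₂ →* S₃} {χ : S₁ →* S₃}
    {f : V₁ →ₗ[k] V₂} {g : V₂ →ₗ[k] V₃} {e : V₁ →ₗ[k] V₃}
    (h : Equivar φ ρ₁ ρ₂ f) (h' : Equivar ψ ρ₂ ρ₃ g) (h'' : Equivar χ ρ₁ ρ₃ e)
    (hχ : ∀ x, χ x = ψ (φ x)) (he : ∀ x, e x = g (f x)) (n : ℕ) (x : (Fin n → S₁) →₀ V₁) :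
    h''.C n x = h'.C n (h.C n x) := by
  induction x using Finsupp.induction_linear with
  | zero => simp only [map_zero]
  | add f g hf hg => simp only [map_add, hf, hg]
  | single t a =>
    rw [h.C_single, h'.C_single, h''.C_single, he]
    exact congrArg (Finsupp.single · _) (funext fun i => hχ _)

/-- A split surjection `π : S → G` with section `s`, and a module on which both groups act in a
compatible way. -/
structure SplitPair (π : S →* G) (s : G →* S) (ρS : Representation k S V)
    (ρG : Representation k G V) : Prop where
  he : Equivar π ρS ρG LinearMap.id
  hσ : Equivar s ρG ρS LinearMap.id
  hπ : ∀ x, π (s x) = x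

namespace SplitPair

variable {π : S →* G} {s : G →* S} {ρS : Representation k S V} {ρG : Representation k G V}
  (P : SplitPair π s ρS ρG)

/-- The kernel of the map from the chains of `S` to the chains of `G`. -/
noncomputable def red (n : ℕ) : Submodule k ((Fin n → S) →₀ V) := LinearMap.ker (P.he.C n)

theorem C_C (n : ℕ) (x : (Fin n → G) →₀ V) : P.he.C n (P.hσ.C n x) = x := by
  rw [← P.hσ.C_comp P.he (Equivar.id ρG) (fun x => (P.hπ x).symm) (fun _ => rfl), Equivar.C_id]
  simp

/-- The projection from the chains of `S` to the reduced chains. -/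
noncomputable def pr (n : ℕ) : ((Fin n → S) →₀ V) →ₗ[k] P.red n :=
  LinearMap.codRestrict _ (LinearMap.id - P.hσ.C n ∘ₗ P.he.C n) fun x => by
    change P.he.C n (x - P.hσ.C n (P.he.C n x)) = 0
    rw [map_sub, P.C_C, sub_self]

theorem coe_pr (n : ℕ) (x : (Fin n → S) →₀ V) :
    (P.pr n x : (Fin n → S) →₀ V) = x - P.hσ.C n (P.he.C n x) := rfl

theorem pr_coe (n : ℕ) (x : P.red n) : P.pr n x = x := by
  refine Subtype.ext ?_
  rw [coe_pr, show P.he.C n x = 0 from x.2, map_zero, sub_zero]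

theorem bd_mem_red (n : ℕ) (x : (Fin (n + 1) → S) →₀ V) (hx : x ∈ P.red (n + 1)) :
    bd ρS n x ∈ P.red n := by
  change P.he.C n _ = 0
  rw [P.he.C_bd, show P.he.C _ x = 0 from hx, map_zero]

/-- The differential of the reduced chains. -/
noncomputable def d (n : ℕ) : P.red (n + 1) →ₗ[k] P.red n := (bd ρS n).restrict (P.bd_mem_red n)

theorem coe_d (n : ℕ) (x : P.red (n + 1)) :
    (P.d n x : (Fin n → S) →₀ V) = bd ρS n x := rfl

theorem pr_bd (n : ℕ) (x : (Fin (n + 1) → S) →₀ V) : P.pr n (bd ρS n x) = P.d n (P.pr _ x) := by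
  refine Subtype.ext ?_
  rw [coe_d, coe_pr, coe_pr, map_sub, P.he.C_bd, P.hσ.C_bd]

/-- The `0`-chains of `S` and of `G` are the same. -/
theorem subsingleton_red_zero : Subsingleton (P.red 0) := by
  refine subsingleton_of_forall_eq 0 fun x => ?_
  obtain ⟨x, hx⟩ := x
  have hx : P.he.C 0 x = 0 := hx
  have h : Finsupp.single default (x default) = x := by
    refine Finsupp.ext fun t => ?_
    obtain rfl := Subsingleton.elim t default
    exact Finsupp.single_eq_same
  rw [← h, P.he.C_single, LinearMap.id_apply, Finsupp.single_eq_zero] at hx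
  exact Subtype.ext (h.symm.trans (by rw [hx, Finsupp.single_zero]; rfl))

end SplitPair

section SplitHom

variable {π : S →* G} {s : G →* S} {ρS : Representation k S V} {ρG : Representation k G V}
  {π' : S' →* G'} {s' : G' →* S'} {ρS' : Representation k S' V'} {ρG' : Representation k G' V'}
  {α : S' →* S} {φ : G' →* G} {f : V' →ₗ[k] V}

/-- A morphism of split pairs. -/
structure SplitPairHom (P' : SplitPair π' s' ρS' ρG') (P : SplitPair π s ρS ρG) (α : S' →* S)
    (φ : G' →* G) (f : V' →ₗ[k] V) : Prop where
  hf : Equivar α ρS' ρS f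
  hg : Equivar φ ρG' ρG f
  hπ : ∀ x, π (α x) = φ (π' x)
  hs : ∀ x, α (s' x) = s (φ x)

namespace SplitPairHom

variable {P' : SplitPair π' s' ρS' ρG'} {P : SplitPair π s ρS ρG} (F : SplitPairHom P' P α φ f)

include F

theorem he_C (n : ℕ) (x) : P.he.C n (F.hf.C n x) = F.hg.C n (P'.he.C n x) := by
  rw [← F.hf.C_comp P.he (F.hf.comp P.he) (fun _ => rfl) (fun _ => rfl),
    ← P'.he.C_comp F.hg (F.hf.comp P.he) F.hπ (fun _ => rfl)]

theorem hσ_C (n : ℕ) (x) : P.hσ.C n (F.hg.C n x) = F.hf.C n (P'.hσ.C n x) := by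
  rw [← F.hg.C_comp P.hσ (F.hg.comp P.hσ) (fun _ => rfl) (fun _ => rfl),
    ← P'.hσ.C_comp F.hf (F.hg.comp P.hσ) (fun x => (F.hs x).symm) (fun _ => rfl)]

theorem C_mem_red (n : ℕ) (x) (hx : x ∈ P'.red n) : F.hf.C n x ∈ P.red n := by
  change P.he.C n _ = 0
  rw [F.he_C, show P'.he.C n x = 0 from hx, map_zero]

/-- The map induced on reduced chains. -/
noncomputable def map (n : ℕ) : P'.red n →ₗ[k] P.red n := (F.hf.C n).restrict (F.C_mem_red n)

theorem coe_map (n : ℕ) (x : P'.red n) : (F.map n x : (Fin n → S) →₀ V) = F.hf.C n x := rfl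

theorem map_d (n : ℕ) (x) : F.map n (P'.d n x) = P.d n (F.map (n + 1) x) :=
  Subtype.ext (F.hf.C_bd n x)

theorem map_pr (n : ℕ) (x) : F.map n (P'.pr n x) = P.pr n (F.hf.C n x) := by
  refine Subtype.ext ?_
  rw [coe_map, SplitPair.coe_pr, SplitPair.coe_pr, map_sub, F.he_C, F.hσ_C]

/-- Surjectivity on the homology of `S`, from the reduced chains and the homology of `G`. -/
theorem H_surjective (n : ℕ) (hred : ∀ z, P.d n z = 0 → ∃ y b, P'.d n y = 0 ∧
    z = F.map (n + 1) y + P.d (n + 1) b) (hG : Function.Surjective (F.hg.H (n + 1))) :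
    Function.Surjective (F.hf.H (n + 1)) := by
  rw [Equivar.H_surjective_iff] at hG ⊢
  intro z hz
  have hz' : bd ρS n z = 0 := hz
  obtain ⟨y, b, hy, h⟩ := hred (P.pr _ z) (by rw [← P.pr_bd, hz', map_zero])
  obtain ⟨y', hy', b', h'⟩ := hG (P.he.C _ z) (P.he.C_mem_cyc _ hz)
  refine ⟨y + P'.hσ.C _ y', add_mem (congrArg Subtype.val hy) (P'.hσ.C_mem_cyc _ hy'),
    b + P.hσ.C _ b', ?_⟩
  have h1 : z = (P.pr _ z : (Fin (n + 1) → S) →₀ V) + P.hσ.C _ (P.he.C _ z) := by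
    rw [SplitPair.coe_pr, sub_add_cancel]
  rw [h1, h, h', map_add, map_add, map_add, Submodule.coe_add, coe_map, SplitPair.coe_d, F.hσ_C,
    P.hσ.C_bd]
  abel

/-- Injectivity on the homology of `S`, from the reduced chains and the homology of `G`. -/
theorem H_injective (n : ℕ) (hred : ∀ z, P'.d n z = 0 → ∀ b, F.map (n + 1) z = P.d (n + 1) b →
    ∃ b', z = P'.d (n + 1) b') (hG : Function.Injective (F.hg.H (n + 1))) :
    Function.Injective (F.hf.H (n + 1)) := by
  rw [Equivar.H_injective_iff] at hG ⊢
  rintro z hz ⟨b, hb⟩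
  have hz' : bd ρS' n z = 0 := hz
  obtain ⟨b₁, h₁⟩ := hG (P'.he.C _ z) (P'.he.C_mem_cyc _ hz)
    ⟨P.he.C _ b, by rw [← P.he.C_bd, hb, F.he_C]⟩
  obtain ⟨b₂, h₂⟩ := hred (P'.pr _ z) (by rw [← P'.pr_bd, hz', map_zero]) (P.pr _ b)
    (by rw [F.map_pr, ← hb, P.pr_bd])
  refine ⟨b₂ + P'.hσ.C _ b₁, ?_⟩
  rw [map_add, ← P'.hσ.C_bd, h₁, ← SplitPair.coe_d, ← h₂, SplitPair.coe_pr, sub_add_cancel]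

end SplitPairHom

end SplitHom

/-! ### The reduced chains as a complex of representations -/

namespace SplitPair

variable {H : Type u} [Group H] {W : Type u} [AddCommGroup W] [Module k W]
variable {π : S →* G} {s : G →* S} {ρS : Representation k S V} {ρG : Representation k G V}
  (P : SplitPair π s ρS ρG) (τ : Representation k H V)
  (c : ∀ h, Equivar (MonoidHom.id S) ρS ρS (τ h))

theorem C_finsupp (n : ℕ) (h : H) (x) :
    P.he.C n (τ.finsupp _ h x) = τ.finsupp _ h (P.he.C n x) :=
  P.he.C_finsupp (Equivar.id τ) n h x

theorem C_finsupp' (n : ℕ) (h : H) (x) :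
    P.hσ.C n (τ.finsupp _ h x) = τ.finsupp _ h (P.hσ.C n x) :=
  P.hσ.C_finsupp (Equivar.id τ) n h x

theorem red_le (n : ℕ) (h : H) : P.red n ≤ (P.red n).comap (τ.finsupp (Fin n → S) h) := by
  intro x hx
  change P.he.C n _ = 0
  rw [P.C_finsupp, show P.he.C n x = 0 from hx, map_zero]

/-- The representation of `H` on the reduced chains. -/
noncomputable def redRep (n : ℕ) : Representation k H (P.red n) :=
  (τ.finsupp (Fin n → S)).subrepresentation (P.red n) (P.red_le τ n)

/-- The reduced chains as a complex of representations of `H`. -/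
noncomputable abbrev redCx : RepCx k H where
  X n := P.red n
  ρ n := P.redRep τ n
  d n := P.d n
  hd n h x := Subtype.ext ((coefCx ρS τ c).hd n h x)
  dd n x := Subtype.ext (bd_bd ρS n x.1)

theorem incl_equivar (n : ℕ) : Equivar (MonoidHom.id H) (P.redRep τ n)
    (τ.finsupp (Fin n → S)) (P.red n).subtype := fun _ _ => rfl

theorem pr_equivar (n : ℕ) : Equivar (MonoidHom.id H) (τ.finsupp (Fin n → S)) (P.redRep τ n)
    (P.pr n) := by
  intro h x
  refine Subtype.ext ?_
  change _ = τ.finsupp _ h (P.pr n x).1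
  rw [coe_pr, coe_pr, P.C_finsupp, P.C_finsupp', map_sub]

theorem redCx_acyclic (hτ : ∀ p, Subsingleton (HG τ (p + 1))) (n p : ℕ) :
    Subsingleton (HG ((P.redCx τ c).ρ n) (p + 1)) := by
  have := finsupp_acyclic τ (Fin n → S) (p + 1) (hτ p)
  refine subsingleton_of_forall_eq 0 fun x => ?_
  have h := (P.incl_equivar τ n).H_comp (P.pr_equivar τ n) (Equivar.id _) (fun _ => rfl)
    (fun x => (P.pr_coe n x).symm) (p + 1) x
  rw [Equivar.H_id _ (fun _ => rfl) (fun _ => rfl)] at h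
  rw [h, Subsingleton.elim ((P.incl_equivar τ n).H (p + 1) x) 0, map_zero]

variable {μS : Representation k S W} {μG : Representation k G W} (Q : SplitPair π s μS μG)
  {q : V →ₗ[k] W}

/-- The coinvariants of the reduced chains. -/
noncomputable abbrev redCoinv (F : SplitPairHom P Q (MonoidHom.id S) (MonoidHom.id G) q)
    (hs : Function.Surjective q) (hq' : ∀ h x, q (τ h x) = q x)
    (hker : ∀ x, q x = 0 → x ∈ Representation.Coinvariants.ker τ) : CoinvCx (P.redCx τ c) where
  X n := Q.red n
  d n := Q.d n
  q n := F.map n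
  surj n z := by
    obtain ⟨x, hx⟩ := (coefCoinv c F.hf hs hq' hker).surj n z.1
    refine ⟨P.pr n x, ?_⟩
    rw [F.map_pr]
    exact (congrArg (Q.pr n) hx).trans (Q.pr_coe n z)
  comm n x := F.map_d n x
  iff n x := by
    have h := (coefCoinv c F.hf hs hq' hker).iff n x.1
    constructor
    · intro hx
      have h1 := (P.incl_equivar τ n).H_H0mk x
      rw [hx, map_zero] at h1
      exact Subtype.ext (h.1 h1.symm)
    · intro hx
      have h1 := (P.pr_equivar τ n).H_H0mk x.1
      rw [P.pr_coe] at h1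
      rw [← h1, h.2 (congrArg Subtype.val hx), map_zero]

/-- The map from the homology of the reduced chains to the homology of `S`. -/
noncomputable def toHG (n : ℕ) : (LinearMap.ker ((P.redCx τ c).d n) ⧸ (P.redCx τ c).BZ n) →ₗ[k]
    HG ρS (n + 1) :=
  Submodule.liftQ _ (cls ρS (n + 1) ∘ₗ
    LinearMap.codRestrict (cyc ρS (n + 1))
      ((P.red (n + 1)).subtype ∘ₗ (LinearMap.ker ((P.redCx τ c).d n)).subtype)
      (fun x => congrArg Subtype.val (LinearMap.mem_ker.1 x.2))) (by
    rintro x ⟨b, hb⟩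
    exact (cls_eq_zero_iff _ _ _).2 ⟨b.1, congrArg Subtype.val hb⟩)

theorem toHG_mk (n : ℕ) (x : P.red (n + 1)) (hx : P.d n x = 0) :
    P.toHG τ c n (Submodule.mkQ _ ⟨x, hx⟩) =
      cls ρS (n + 1) ⟨x.1, congrArg Subtype.val hx⟩ := rfl

/-- If the module is acyclic for `G`, then the homology of the reduced chains is the homology of `S`
in positive degrees. -/
theorem toHG_bijective (hG : ∀ n, Subsingleton (HG ρG (n + 1))) (n : ℕ) :
    Function.Bijective (P.toHG τ c n) := by
  constructor
  · refine (injective_iff_map_eq_zero _).2 fun x hx => ?_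
    obtain ⟨⟨x, hx'⟩, rfl⟩ := Submodule.mkQ_surjective _ x
    rw [toHG_mk _ _ _ _ _ hx', cls_eq_zero_iff] at hx
    obtain ⟨b, hb⟩ := hx
    refine (Submodule.Quotient.mk_eq_zero _).2 ⟨P.pr _ b, ?_⟩
    change P.d _ _ = x
    rw [← P.pr_bd, hb, P.pr_coe]
  · intro y
    obtain ⟨⟨z, hz⟩, rfl⟩ := cls_surjective ρS (n + 1) y
    have hz' : bd ρS n z = 0 := hz
    have hp : P.d n (P.pr _ z) = 0 := by rw [← P.pr_bd, hz', map_zero]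
    refine ⟨Submodule.mkQ _ ⟨P.pr _ z, hp⟩, ?_⟩
    · rw [toHG_mk _ _ _ _ _ hp, ← sub_eq_zero, ← map_sub, cls_eq_zero_iff]
      obtain ⟨b, hb⟩ := (HG_subsingleton_iff ρG (n + 1)).1 (hG n) (P.he.C _ z)
        (P.he.C_mem_cyc _ hz)
      refine ⟨-P.hσ.C _ b, ?_⟩
      rw [map_neg, ← P.hσ.C_bd, hb]
      change _ = (P.pr _ z : (Fin (n + 1) → S) →₀ V) - z
      rw [coe_pr]
      abel

theorem toHG_equivar (n : ℕ) : Equivar (MonoidHom.id H) ((P.redCx τ c).rH n)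
    (homologyRep (fun _ => MonoidHom.id S) τ (fun _ => rfl) (fun _ _ _ => rfl) c (n + 1))
    (P.toHG τ c n) := by
  intro h x
  obtain ⟨⟨x, hx⟩, rfl⟩ := Submodule.mkQ_surjective _ x
  rw [toHG_mk _ _ _ _ _ hx]
  refine Eq.trans ?_ ((c h).H_cls (n + 1) _).symm
  refine congrArg (cls ρS (n + 1)) (Subtype.ext ?_)
  exact finsupp_eq_C ρS τ c (n + 1) h x.1

end SplitPair

namespace SplitPairHom

variable {H H' : Type u} [Group H] [Group H']
variable {π : S →* G} {s : G →* S} {ρS : Representation k S V} {ρG : Representation k G V}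
  {π' : S' →* G'} {s' : G' →* S'} {ρS' : Representation k S' V'} {ρG' : Representation k G' V'}
  {α : S' →* S} {φ : G' →* G} {f : V' →ₗ[k] V}
  {P' : SplitPair π' s' ρS' ρG'} {P : SplitPair π s ρS ρG} (F : SplitPairHom P' P α φ f)
  (τ' : Representation k H' V') (c' : ∀ h, Equivar (MonoidHom.id S') ρS' ρS' (τ' h))
  (τ : Representation k H V) (c : ∀ h, Equivar (MonoidHom.id S) ρS ρS (τ h))
  {ψ : H' →* H} (hτ : Equivar ψ τ' τ f)

/-- The map induced on reduced chains, as a morphism of complexes of representations. -/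
noncomputable def redCxHom : RepCxHom ψ (P'.redCx τ' c') (P.redCx τ c) where
  f n := F.map n
  hf n g x := Subtype.ext (F.hf.C_finsupp hτ n g x.1)
  comm n x := F.map_d n x

theorem toHG_fH (n : ℕ) (x) : P.toHG τ c n ((F.redCxHom τ' c' τ c hτ).fH n x) =
    F.hf.H (n + 1) (P'.toHG τ' c' n x) := by
  obtain ⟨⟨x, hx⟩, rfl⟩ := Submodule.mkQ_surjective _ x
  have hx' : P.d n (F.map (n + 1) x) = 0 := by
    rw [← F.map_d]
    exact (congrArg _ hx).trans (map_zero _)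
  refine (P.toHG_mk τ c n (F.map (n + 1) x) hx').trans ?_
  exact (F.hf.H_cls (n + 1) ⟨x.1, congrArg Subtype.val hx⟩).symm

end SplitPairHom

end Split

/-! ### The homology of a semidirect product -/

section Semidirect

open SemidirectProduct

variable {k : Type u} [CommRing k] {K G K' G' : Type u} [Group K] [Group G] [Group K'] [Group G']

theorem homologyRep_equivar {S S' V V' : Type u} [Group S] [Group S'] [AddCommGroup V] [Module k V]
    [AddCommGroup V'] [Module k V'] {ρ : Representation k S V} {ρ' : Representation k S' V'}
    {ψ : G → S →* S} {τ : Representation k G V} {ψ' : G' → S' →* S'} {τ' : Representation k G' V'}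
    (h₁ : ∀ x, ψ 1 x = x) (h₂ : ∀ g h x, ψ (g * h) x = ψ g (ψ h x))
    (c : ∀ g, Equivar (ψ g) ρ ρ (τ g))
    (h₁' : ∀ x, ψ' 1 x = x) (h₂' : ∀ g h x, ψ' (g * h) x = ψ' g (ψ' h x))
    (c' : ∀ g, Equivar (ψ' g) ρ' ρ' (τ' g)) {φ : G' →* G} {α : S' →* S} {f : V' →ₗ[k] V}
    (hf : Equivar α ρ' ρ f) (hα : ∀ g x, α (ψ' g x) = ψ (φ g) (α x))
    (hτ : Equivar φ τ' τ f) (n : ℕ) :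
    Equivar φ (homologyRep ψ' τ' h₁' h₂' c' n) (homologyRep ψ τ h₁ h₂ c n) (hf.H n) := by
  intro g x
  exact ((c' g).H_square (c (φ g)) hf hf (fun x => hα g x) (fun x => hτ g x) n x)

theorem trivial_equivar (k : Type u) [CommRing k] (φ : G' →* G) :
    Equivar φ (Representation.trivial k G' k) (Representation.trivial k G k) LinearMap.id :=
  fun _ _ => rfl

/-- The map induced on the homology of the kernels of two semidirect products. -/
theorem kerRep_equivar (k : Type u) [CommRing k] {a : G →* MulAut K} {a' : G' →* MulAut K'}
    {φ : G' →* G} {f : K' →* K} (hf : ∀ g x, f (a' g x) = a (φ g) (f x)) (n : ℕ) :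
    Equivar φ (kerRep k a' n) (kerRep k a n) ((trivial_equivar k f).H n) :=
  homologyRep_equivar _ _ _ _ _ _ _ hf (fun _ _ => rfl) n

variable (k) (a : G →* MulAut K) (a' : G' →* MulAut K')

/-- The representation of `K ⋊ G` on `k[G]` by left multiplication. -/
noncomputable def extRep : Representation k (K ⋊[a] G) (G →₀ k) :=
  permRep k ((leftPerm G).comp rightHom)

theorem extRep_single (x : K ⋊[a] G) (g : G) (b : k) :
    extRep k a x (Finsupp.single g b) = Finsupp.single (x.right * g) b :=
  permRep_single _ _ _ _

theorem extRep_comm (g : G) : Equivar (MonoidHom.id (K ⋊[a] G)) (extRep k a) (extRep k a)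
    (permRep k (rightPerm (MonoidHom.id G)) g) :=
  fun x y => regular_comm (MonoidHom.id G) g (rightHom x) y

/-- The coefficients `k[G]`, acyclic for `G`. -/
theorem extPair : SplitPair rightHom inr (extRep k a) (permRep k (leftPerm G)) where
  he _ _ := rfl
  hσ _ _ := rfl
  hπ _ := rfl

/-- The trivial coefficients. -/
theorem trivPair : SplitPair (rightHom : K ⋊[a] G →* G) inr
    (Representation.trivial k (K ⋊[a] G) k) (Representation.trivial k G k) where
  he _ _ := rfl
  hσ _ _ := rfl
  hπ _ := rfl

theorem augHom : SplitPairHom (extPair k a) (trivPair k a) (MonoidHom.id _) (MonoidHom.id G)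
    (aug k G) where
  hf := aug_equivar ((leftPerm G).comp rightHom)
  hg := aug_equivar (leftPerm G)
  hπ _ := rfl
  hs _ := rfl

/-- The reduced chains of `K ⋊ G` with coefficients in `k[G]`, on which `G` acts by right
multiplication on the coefficients. -/
noncomputable abbrev extCx : RepCx k G :=
  (extPair k a).redCx (permRep k (rightPerm (MonoidHom.id G))) (extRep_comm k a)

theorem extCx_acyclic (n p : ℕ) : Subsingleton (HG ((extCx k a).ρ n) (p + 1)) :=
  (extPair k a).redCx_acyclic _ _ (rightPerm_acyclic _ Function.injective_id) n p

/-- The coinvariants of `extCx` are the reduced chains of `K ⋊ G` with coefficients in `k`. -/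
noncomputable abbrev extCoinv : CoinvCx (extCx k a) :=
  (extPair k a).redCoinv _ _ (trivPair k a) (augHom k a)
    (fun b => ⟨Finsupp.single 1 b, aug_single _ _⟩) (fun h x => aug_equivar _ _ _)
    (fun x hx => mem_of_aug_eq_zero _ (fun a b => ⟨b⁻¹ * a, by rw [rightPerm_apply]; simp⟩) hx)

/-- The representation of `G` on `H_n(K ⋊ G; k[G])`. -/
noncomputable def extHomologyRep (n : ℕ) : Representation k G (HG (extRep k a) n) :=
  homologyRep (fun _ => MonoidHom.id _) (permRep k (rightPerm (MonoidHom.id G))) (fun _ => rfl)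
    (fun _ _ _ => rfl) (extRep_comm k a) n

theorem leftPerm_rightHom_inl (h : K) :
    ((leftPerm G).comp (rightHom : K ⋊[a] G →* G)) (inl h) 1 = 1 := by
  rw [MonoidHom.comp_apply, rightHom_inl, leftPerm_apply, mul_one]

theorem inl_equivar : Equivar (inl : K →* K ⋊[a] G) (Representation.trivial k K k) (extRep k a)
    (Finsupp.lsingle 1) :=
  single_equivar inl ((leftPerm G).comp rightHom) 1 (leftPerm_rightHom_inl a)

/-- The homology of `K ⋊ G` with coefficients in `k[G]` is the homology of `K`. -/
theorem inl_bijective (n : ℕ) : Function.Bijective ((inl_equivar k a).H n) := by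
  refine shapiro inl inl_injective ((leftPerm G).comp rightHom) 1
    (leftPerm_rightHom_inl a) ?_ ?_ n
  · intro x hx
    refine ⟨x.left, ?_⟩
    rw [MonoidHom.comp_apply, leftPerm_apply, mul_one] at hx
    exact SemidirectProduct.ext rfl hx.symm
  · intro g
    exact ⟨inr g, by rw [MonoidHom.comp_apply, leftPerm_apply, rightHom_inr, mul_one]⟩

/-- The isomorphism of Shapiro's lemma is equivariant, because inner automorphisms of `K ⋊ G` act
trivially. -/
theorem inl_H_equivar (n : ℕ) : Equivar (MonoidHom.id G) (kerRep k a n) (extHomologyRep k a n)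
    ((inl_equivar k a).H n) := by
  intro g x
  have c₁ : Equivar (a g).toMonoidHom (Representation.trivial k K k)
    (Representation.trivial k K k) (Representation.trivial k G k g) := fun _ _ => rfl
  have c₂ := extRep_comm k a g
  -- the map given by `inl` and `b ↦ b • g⁻¹` is compared with both sides
  have c₃ := (inl_equivar k a).comp c₂
  change (inl_equivar k a).H n (c₁.H n x) = c₂.H n ((inl_equivar k a).H n x)
  rw [← (inl_equivar k a).H_comp c₂ c₃ (fun _ => rfl) (fun _ => rfl),
    ← H_conj (extRep k a) (inr g) n (c₃.H n x)]
  refine c₁.H_square (conj_equivar (extRep k a) (inr g)) (inl_equivar k a) c₃ ?_ ?_ n x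
  · intro x
    refine (inl_aut g x).trans ?_
    simp
  · intro b
    change Finsupp.single 1 b = extRep k a (inr g) (permRep k _ g (Finsupp.single 1 b))
    rw [permRep_single, extRep_single, rightPerm_apply]
    simp

variable {k a a'}

section Hom

variable {φ : G' →* G} {f : K' →* K} (hf : ∀ g x, f (a' g x) = a (φ g) (f x))
  (α : (K' ⋊[a'] G') →* (K ⋊[a] G)) (hl : ∀ x, α (inl x) = inl (f x))
  (hr : ∀ g, α (inr g) = inr (φ g))

include hl hr in
theorem right_map (x : K' ⋊[a'] G') : (α x).right = φ x.right := by
  conv_lhs => rw [← inl_left_mul_inr_right x]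
  rw [map_mul, hl, hr]
  simp

include hl hr

theorem extHom : SplitPairHom (extPair k a') (extPair k a) α φ (Finsupp.lmapDomain k k φ) where
  hf := lmapDomain_equivar _ _ _ fun x g => by
    have := right_map α hl hr x
    simp only [MonoidHom.comp_apply, leftPerm_apply, map_mul]
    exact congrArg (· * φ g) this.symm
  hg := lmapDomain_equivar _ _ _ fun x g => by rw [leftPerm_apply, leftPerm_apply, map_mul]
  hπ := right_map α hl hr
  hs := hr

theorem trivHom : SplitPairHom (trivPair k a') (trivPair k a) α φ LinearMap.id where
  hf := trivial_equivar k α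
  hg := trivial_equivar k φ
  hπ := right_map α hl hr
  hs := hr

omit hl hr in
theorem rightPerm_equivar (φ : G' →* G) : Equivar φ (permRep k (rightPerm (MonoidHom.id G')))
    (permRep k (rightPerm (MonoidHom.id G))) (Finsupp.lmapDomain k k φ) :=
  lmapDomain_equivar _ _ _ fun x g => by
    rw [rightPerm_apply, rightPerm_apply, map_mul, map_inv]; rfl

/-- The map induced on reduced chains by a morphism of semidirect products. -/
noncomputable def extCxHom : RepCxHom φ (extCx k a') (extCx k a) :=
  (extHom α hl hr).redCxHom _ _ _ _ (rightPerm_equivar φ)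

theorem extHomologyRep_equivar (n : ℕ) : Equivar φ (extHomologyRep k a' n) (extHomologyRep k a n)
    ((extHom α hl hr).hf.H n) :=
  homologyRep_equivar _ _ _ _ _ _ _ (fun _ _ => rfl) (rightPerm_equivar φ) n

theorem toHG_fH (n : ℕ) (x) : (extPair k a).toHG _ (extRep_comm k a) n
    ((extCxHom (k := k) α hl hr).fH n x) =
      (extHom α hl hr).hf.H (n + 1) ((extPair k a').toHG _ (extRep_comm k a') n x) :=
  (extHom α hl hr).toHG_fH _ _ _ _ (rightPerm_equivar φ) n x

theorem inl_square (n : ℕ) (x) : (inl_equivar k a).H n ((trivial_equivar k f).H n x) =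
    (extHom α hl hr).hf.H n ((inl_equivar k a').H n x) :=
  (trivial_equivar k f).H_square (extHom α hl hr).hf (inl_equivar k a) (inl_equivar k a')
    (fun x => (hl x).symm) (fun b => by simp) n x

/-- The homology of `extCx` in degree `n + 1` is the homology of `K`, as a representation of `G`. -/
theorem extCxHom_HH_injective (n p : ℕ) (h : Function.Injective ((kerRep_equivar k hf (n + 1)).H p)) :
    Function.Injective ((extCxHom (k := k) α hl hr).HH n p) := by
  have h' : Function.Injective ((extHomologyRep_equivar (k := k) α hl hr (n + 1)).H p) :=
    ((kerRep_equivar k hf (n + 1)).H_injective_iff_of_bijective _ (inl_H_equivar k a (n + 1))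
      (inl_H_equivar k a' (n + 1)) (inl_bijective k a _) (inl_bijective k a' _)
      (inl_square α hl hr (n + 1)) p).1 h
  exact (((extCxHom (k := k) α hl hr).hom₂ n).h₁.H_injective_iff_of_bijective _
    ((extPair k a).toHG_equivar _ (extRep_comm k a) n)
    ((extPair k a').toHG_equivar _ (extRep_comm k a') n)
    ((extPair k a).toHG_bijective _ (extRep_comm k a) leftPerm_acyclic n)
    ((extPair k a').toHG_bijective _ (extRep_comm k a') leftPerm_acyclic n)
    (toHG_fH α hl hr n) p).2 h'

theorem extCxHom_HH_surjective (n p : ℕ)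
    (h : Function.Surjective ((kerRep_equivar k hf (n + 1)).H p)) :
    Function.Surjective ((extCxHom (k := k) α hl hr).HH n p) := by
  have h' : Function.Surjective ((extHomologyRep_equivar (k := k) α hl hr (n + 1)).H p) :=
    ((kerRep_equivar k hf (n + 1)).H_surjective_iff_of_bijective _ (inl_H_equivar k a (n + 1))
      (inl_H_equivar k a' (n + 1)) (inl_bijective k a _) (inl_bijective k a' _)
      (inl_square α hl hr (n + 1)) p).1 h
  exact (((extCxHom (k := k) α hl hr).hom₂ n).h₁.H_surjective_iff_of_bijective _
    ((extPair k a).toHG_equivar _ (extRep_comm k a) n)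
    ((extPair k a').toHG_equivar _ (extRep_comm k a') n)
    ((extPair k a).toHG_bijective _ (extRep_comm k a) leftPerm_acyclic n)
    ((extPair k a').toHG_bijective _ (extRep_comm k a') leftPerm_acyclic n)
    (toHG_fH α hl hr n) p).2 h'

theorem ext_square (n : ℕ) (x : (extCx k a').X n) :
    (extCoinv k a).q n ((extCxHom (k := k) α hl hr).f n x) =
      (trivHom (k := k) α hl hr).map n ((extCoinv k a').q n x) := by
  refine Subtype.ext ?_
  have h1 := (extHom (k := k) α hl hr).hf
  have h2 := h1.comp (augHom k a).hf
  have e : ∀ x, aug k G' x = aug k G (Finsupp.lmapDomain k k φ x) :=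
    fun x => (aug_lmapDomain φ x).symm
  exact (h1.C_comp (augHom k a).hf h2 (fun _ => rfl) (fun _ => rfl) n x.1).symm.trans
    ((augHom k a').hf.C_comp (trivial_equivar k α) h2 (fun _ => rfl) (fun x => (e x).symm) n x.1)

section Range

variable {i : ℕ} {flag : Prop}
  (hinj : ∀ q p, 1 ≤ q → q + p ≤ i → Function.Injective ((kerRep_equivar k hf q).H p))
  (hsurj : ∀ q p, 1 ≤ q → (q + p ≤ i ∨ (q + p = i + 1 ∧ (2 ≤ p ∨ flag))) →
    Function.Surjective ((kerRep_equivar k hf q).H p))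

include hinj hsurj

theorem extCxHom_HY_surjective (n p : ℕ)
    (h : n + (p + 1) ≤ i ∨ (n + (p + 1) = i + 1 ∧ (2 ≤ p + 1 ∨ flag))) :
    Function.Surjective ((extCxHom (k := k) α hl hr).HY n (p + 1)) := by
  induction n generalizing p with
  | zero =>
    have := (extPair k a).subsingleton_red_zero
    have : Subsingleton ((extCx k a).X 0 ⧸ (extCx k a).B 0) := Quot.Subsingleton
    have := subsingleton_HG ((extCx k a).rY 0) (p + 1)
    exact fun y => ⟨0, Subsingleton.elim _ _⟩
  | succ n ih =>
    refine (extCxHom α hl hr).HY_surjective (extCx_acyclic k a) n p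
      (extCxHom_HH_surjective hf α hl hr n _ (hsurj _ _ (by omega) ?_)) (ih (p + 1) ?_)
      (extCxHom_HH_injective hf α hl hr n _ (hinj _ _ (by omega) (by omega)))
    · rcases h with h | ⟨h, h'⟩
      · exact Or.inl (by omega)
      · exact Or.inr ⟨by omega, h'⟩
    · rcases h with h | ⟨h, h'⟩
      · exact Or.inl (by omega)
      · exact Or.inr ⟨by omega, Or.inl (by omega)⟩

theorem extCxHom_HY_injective (n p : ℕ) (h : n + (p + 1) ≤ i) :
    Function.Injective ((extCxHom (k := k) α hl hr).HY n (p + 1)) := by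
  induction n generalizing p with
  | zero =>
    have := (extPair k a').subsingleton_red_zero
    have : Subsingleton ((extCx k a').X 0 ⧸ (extCx k a').B 0) := Quot.Subsingleton
    have := subsingleton_HG ((extCx k a').rY 0) (p + 1)
    exact fun x y _ => Subsingleton.elim _ _
  | succ n ih =>
    refine (extCxHom α hl hr).HY_injective (extCx_acyclic k a') (extCx_acyclic k a) n p
      (extCxHom_HH_injective hf α hl hr n _ (hinj _ _ (by omega) (by omega))) (ih (p + 1) (by omega))
      (extCxHom_HY_surjective hf α hl hr hinj hsurj n (p + 2) ?_)
    by_cases h' : n + (p + 2 + 1) ≤ i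
    · exact Or.inl h'
    · exact Or.inr ⟨by omega, Or.inl (by omega)⟩

/-- Comparison of the homology of two semidirect products, from the homology of the quotients and
from the homology of the quotients with coefficients in the homology of the kernels. The case in
which `flag` holds gives surjectivity in one degree more. -/
theorem semidirect_surjective (n : ℕ) (h : n + 1 ≤ i ∨ (n + 1 = i + 1 ∧ flag))
    (hG : Function.Surjective ((trivial_equivar k φ).H (n + 1))) :
    Function.Surjective ((trivial_equivar k α).H (n + 1)) := by
  refine (trivHom α hl hr).H_surjective n ?_ hG
  refine (extCxHom α hl hr).coinv_surjective (extCoinv k a') (extCoinv k a) _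
    (ext_square α hl hr) n
    (extCxHom_HH_surjective hf α hl hr n _ (hsurj _ _ (by omega) ?_))
    (extCxHom_HY_surjective hf α hl hr hinj hsurj n 0 ?_)
  all_goals
    rcases h with h | ⟨h, h'⟩
    · exact Or.inl (by omega)
    · exact Or.inr ⟨by omega, Or.inr h'⟩

theorem semidirect_injective (n : ℕ) (h : n + 1 ≤ i)
    (hG : Function.Injective ((trivial_equivar k φ).H (n + 1))) :
    Function.Injective ((trivial_equivar k α).H (n + 1)) := by
  refine (trivHom α hl hr).H_injective n ?_ hG
  refine (extCxHom α hl hr).coinv_injective (extCoinv k a') (extCoinv k a) _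
    (ext_square α hl hr) (extCx_acyclic k a) n
    (extCxHom_HH_injective hf α hl hr n _ (hinj _ _ (by omega) (by omega)))
    (extCxHom_HY_injective hf α hl hr hinj hsurj n 0 (by omega))
    (extCxHom_HY_surjective hf α hl hr hinj hsurj n 1 ?_)
  by_cases h' : n + (1 + 1) ≤ i
  · exact Or.inl h'
  · exact Or.inr ⟨by omega, Or.inl (by omega)⟩

end Range

end Hom

end Semidirect

/-! ### Graded representations -/

section Graded

variable {k : Type u} [CommRing k] {G G' : Type u} [Group G] [Group G'] {E : Type}
variable {N P : Type u} [AddCommGroup N] [Module k N] [AddCommGroup P] [Module k P]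

/-- The vector `x` is homogeneous of degree `V` for the family of idempotents `δ`. -/
def Homog (δ : Set E → N →ₗ[k] N) (V : Set E) (x : N) : Prop :=
  δ V x = x ∧ ∀ W, ¬ V ⊆ W → δ W x = 0

/-- Every vector is a sum of homogeneous vectors. -/
theorem span_homog [Finite E] (δ : Set E → N →ₗ[k] N)
    (inter : ∀ U V x, δ U (δ V x) = δ (U ∩ V) x) (univ : ∀ x, δ Set.univ x = x) :
    Submodule.span k {x | ∃ V, Homog δ V x} = ⊤ := by
  classical
  have := Fintype.ofFinite E
  have main : ∀ U : Set E, ∀ x, δ U x = x → x ∈ Submodule.span k {x | ∃ V, Homog δ V x} := by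
    intro U
    induction U using WellFoundedLT.induction with
    | ind U ih =>
      intro x hx
      -- the components of degree smaller than `U` are split off, one element of `U` at a time
      have key : ∀ s : Finset E, ∃ z, δ U z = z ∧
          x - z ∈ Submodule.span k {x | ∃ V, Homog δ V x} ∧
          ∀ u ∈ s, u ∈ U → δ (U \ {u}) z = 0 := by
        intro s
        induction s using Finset.induction_on with
        | empty => exact ⟨x, hx, by simp, by simp⟩
        | insert u s _ ih' =>
          obtain ⟨z, hz, hxz, h⟩ := ih'
          by_cases hu : u ∈ U
          · refine ⟨z - δ (U \ {u}) z, ?_, ?_, ?_⟩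
            · rw [map_sub, inter, hz, Set.inter_eq_right.2 Set.sdiff_subset]
            · have h1 := ih (U \ {u}) (Set.sdiff_singleton_ssubset.2 hu) (δ (U \ {u}) z)
                (by rw [inter, Set.inter_self])
              have h2 := add_mem hxz h1
              rwa [sub_add] at h2
            · intro v hv hvU
              rcases Finset.mem_insert.1 hv with rfl | hv
              · rw [map_sub, inter, Set.inter_self, sub_self]
              · rw [map_sub, inter, Set.inter_comm, ← inter, h v hv hvU, map_zero, sub_zero]
          · refine ⟨z, hz, hxz, fun v hv hvU => h v ?_ hvU⟩
            rcases Finset.mem_insert.1 hv with rfl | hv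
            · exact absurd hvU hu
            · exact hv
      obtain ⟨z, hz, hxz, h⟩ := key Finset.univ
      have hhom : Homog δ U z := by
        refine ⟨hz, fun W hW => ?_⟩
        obtain ⟨u, hu, huW⟩ := Set.not_subset.1 hW
        have : W ∩ U = W ∩ (U \ {u}) := by
          ext y
          simp only [Set.mem_inter_iff, Set.mem_sdiff, Set.mem_singleton_iff]
          exact ⟨fun ⟨h, h'⟩ => ⟨h, h', fun e => huW (e ▸ h)⟩, fun ⟨h, h', _⟩ => ⟨h, h'⟩⟩
        rw [← hz, inter, this, ← inter, h u (Finset.mem_univ u) hu, map_zero]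
      have := add_mem hxz (Submodule.subset_span ⟨U, hhom⟩)
      rwa [sub_add_cancel] at this
  rw [eq_top_iff]
  exact fun x _ => main Set.univ x (univ x)

/-- The situation in which representations are graded by the subsets of a finite set `E` with an
action of `G`. The subgroup `Q U` plays the role of the pointwise stabilizer of `U`, the group `G'`
that of the automorphisms of `M ⊆ E`, and `𝒲` is a set of representatives of the degrees that
occur. -/
structure StabData (act : G →* Equiv.Perm E) (Q : Set E → Subgroup G) (φ : G' →* G) (M : Set E)
    (𝒲 : Set (Set E)) : Prop where
  image_eq : ∀ U, ∀ g ∈ Q U, act g '' U = U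
  anti : ∀ U V, U ⊆ V → Q V ≤ Q U
  conj : ∀ U h, ∀ g ∈ Q (act h '' U), h⁻¹ * g * h ∈ Q U
  map : ∀ g, act (φ g) '' M = M
  sub : ∀ U ∈ 𝒲, U ⊆ M
  ext : ∀ U ∈ 𝒲, ∀ g, act g '' U ⊆ M → ∃ g', g⁻¹ * φ g' ∈ Q U

/-- A representation of `G` graded by the subsets of `E`: the idempotent `δ U` is the projection to
the sum of the homogeneous components of degree contained in `U`. -/
structure Graded (act : G →* Equiv.Perm E) (Q : Set E → Subgroup G) (𝒲 : Set (Set E))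
    (ρ : Representation k G N) (δ : Set E → N →ₗ[k] N) : Prop where
  inter : ∀ U V x, δ U (δ V x) = δ (U ∩ V) x
  univ : ∀ x, δ Set.univ x = x
  equivar : ∀ g U x, ρ g (δ U x) = δ (act g '' U) (ρ g x)
  fixed : ∀ U, ∀ g ∈ Q U, ∀ x, ρ g (δ U x) = δ U x
  degree : ∀ V x, Homog δ V x → x ≠ 0 → ∃ U ∈ 𝒲, ∃ g, act g '' U = V

variable {act : G →* Equiv.Perm E} {Q : Set E → Subgroup G} {φ : G' →* G} {M : Set E}
  {𝒲 : Set (Set E)}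

theorem act_mul_image (g h : G) (U : Set E) : act (g * h) '' U = act g '' (act h '' U) := by
  rw [map_mul, Equiv.Perm.coe_mul, Set.image_comp]

theorem act_inv_image (g : G) (U : Set E) : act g⁻¹ '' (act g '' U) = U := by
  rw [← act_mul_image, inv_mul_cancel, map_one, Equiv.Perm.coe_one, Set.image_id]

theorem act_image_subset (g : G) (U W : Set E) : act g '' U ⊆ W ↔ U ⊆ act g⁻¹ '' W := by
  constructor
  · intro h
    rw [← act_inv_image (act := act) g U]
    exact Set.image_mono h
  · intro h
    have := Set.image_mono (f := act g) h
    rwa [← act_mul_image (act := act) g g⁻¹, mul_inv_cancel, map_one, Equiv.Perm.coe_one,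
      Set.image_id] at this

namespace Graded

variable {ρ : Representation k G N} {δ : Set E → N →ₗ[k] N} (A : Graded act Q 𝒲 ρ δ)
include A

theorem homog_smul (g : G) {V : Set E} {x : N} (hx : Homog δ V x) :
    Homog δ (act g '' V) (ρ g x) := by
  refine ⟨by rw [← A.equivar, hx.1], fun W hW => ?_⟩
  rw [act_image_subset] at hW
  have := A.equivar g (act g⁻¹ '' W) x
  rw [hx.2 _ hW, map_zero, ← act_mul_image, mul_inv_cancel, map_one, Equiv.Perm.coe_one,
    Set.image_id] at this
  exact this.symm

theorem rho_mem_range (D : StabData act Q φ M 𝒲) (g : G') :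
    LinearMap.range (δ M) ≤ (LinearMap.range (δ M)).comap ((ρ.comp φ) g) := by
  rintro _ ⟨x, rfl⟩
  refine ⟨ρ (φ g) x, ?_⟩
  conv_lhs => rw [← D.map g]
  exact (A.equivar _ _ _).symm

/-- The representation of `G'` on the part of degree contained in `M`. -/
def part (D : StabData act Q φ M 𝒲) : Representation k G' (LinearMap.range (δ M)) :=
  Representation.subrepresentation (ρ.comp φ) (LinearMap.range (δ M)) (A.rho_mem_range D)

theorem part_equivar (D : StabData act Q φ M 𝒲) :
    Equivar φ (A.part D) ρ (LinearMap.range (δ M)).subtype := fun _ _ => rfl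

theorem δ_coe (x : LinearMap.range (δ M)) : δ M x = x := by
  obtain ⟨_, x, rfl⟩ := x
  exact (A.inter M M x).trans (by rw [Set.inter_self])

end Graded

/-! ### Graded permutation representations -/

section Cover

variable {I : Type u} (U : I → Set E)

/-- The disjoint union of the orbits `G / Q (U i)`. -/
abbrev Orb (Q : Set E → Subgroup G) : Type u := Σ i, G ⧸ Q (U i)

/-- The action of `G` on the disjoint union of orbits. -/
def orbPerm (Q : Set E → Subgroup G) : G →* Equiv.Perm (Orb U Q) where
  toFun g := Equiv.sigmaCongrRight fun _ => MulAction.toPerm g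
  map_one' := Equiv.ext fun ⟨i, x⟩ => congrArg (Sigma.mk i) (one_smul G x)
  map_mul' g h := Equiv.ext fun ⟨i, x⟩ => congrArg (Sigma.mk i) (mul_smul g h x)

variable (act Q) in
/-- The degree of an element of an orbit. -/
noncomputable def orbDeg (ω : Orb U Q) : Set E := act ω.2.out '' U ω.1

variable (D : StabData act Q φ M 𝒲)

include D

theorem orbDeg_mk (i : I) (g : G) : orbDeg act Q U ⟨i, (g : G ⧸ Q (U i))⟩ = act g '' U i := by
  obtain ⟨h, hh⟩ := QuotientGroup.mk_out_eq_mul (Q (U i)) g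
  change act (Quotient.out (g : G ⧸ Q (U i))) '' U i = _
  rw [hh, act_mul_image, D.image_eq _ _ h.2]

theorem orbDeg_smul (g : G) (ω : Orb U Q) :
    orbDeg act Q U (orbPerm U Q g ω) = act g '' orbDeg act Q U ω := by
  obtain ⟨i, x⟩ := ω
  induction x using QuotientGroup.induction_on with
  | H h =>
    rw [orbDeg_mk U D, ← act_mul_image]
    exact orbDeg_mk U D i (g * h)

omit D

open Classical in
variable (k act Q) in
/-- The projection of `k[Ω]`, for a disjoint union of orbits `Ω`, to the span of the elements of
degree contained in `W`. -/
noncomputable def orbProj (W : Set E) : (Orb U Q →₀ k) →ₗ[k] (Orb U Q →₀ k) :=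
  Finsupp.lsum k fun ω => if orbDeg act Q U ω ⊆ W then Finsupp.lsingle ω else 0

open Classical in
theorem orbProj_single (W : Set E) (ω : Orb U Q) (a : k) :
    orbProj k act Q U W (Finsupp.single ω a) =
      if orbDeg act Q U ω ⊆ W then Finsupp.single ω a else 0 := by
  refine (Finsupp.lsum_single _ _ _ _).trans ?_
  split_ifs <;> rfl

open Classical in
theorem orbProj_apply (W : Set E) (x : Orb U Q →₀ k) (ω : Orb U Q) :
    orbProj k act Q U W x ω = if orbDeg act Q U ω ⊆ W then x ω else 0 := by
  induction x using Finsupp.induction_linear with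
  | zero => simp
  | add f g hf hg =>
    rw [map_add, Finsupp.add_apply, hf, hg, Finsupp.add_apply]
    split_ifs <;> simp
  | single ω' a =>
    rw [orbProj_single]
    rcases eq_or_ne ω' ω with rfl | h
    · split_ifs <;> simp
    · rw [Finsupp.single_eq_of_ne' h]
      split_ifs <;> simp [Finsupp.single_eq_of_ne' h]

include D in
/-- The graded permutation representation on a disjoint union of orbits. -/
theorem orb_graded (hU : ∀ i, U i ∈ 𝒲) :
    Graded act Q 𝒲 (permRep k (orbPerm U Q)) (orbProj k act Q U) where
  inter V W x := by
    classical
    refine Finsupp.ext fun ω => ?_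
    simp only [orbProj_apply, Set.subset_inter_iff]
    split_ifs <;> simp_all
  univ x := by
    classical
    refine Finsupp.ext fun ω => ?_
    simp [orbProj_apply]
  equivar g W x := by
    classical
    induction x using Finsupp.induction_linear with
    | zero => simp
    | add f g hf hg => simp only [map_add, hf, hg]
    | single ω a =>
      have h : orbDeg act Q U (orbPerm U Q g ω) ⊆ act g '' W ↔ orbDeg act Q U ω ⊆ W := by
        rw [orbDeg_smul U D, act_image_subset, act_inv_image]
      rw [permRep_single, orbProj_single, orbProj_single]
      simp only [h]
      split_ifs
      · rw [permRep_single]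
      · rw [map_zero]
  fixed W g hg x := by
    classical
    induction x using Finsupp.induction_linear with
    | zero => simp
    | add f g hf hg => simp only [map_add, hf, hg]
    | single ω a =>
      rw [orbProj_single]
      split_ifs with h
      · rw [permRep_single]
        congr 1
        obtain ⟨i, x⟩ := ω
        induction x using QuotientGroup.induction_on with
        | H y =>
          rw [orbDeg_mk U D] at h
          refine congrArg (Sigma.mk i) (QuotientGroup.eq.2 ?_).symm
          change y⁻¹ * (g * y) ∈ Q (U i)
          rw [← mul_assoc]
          exact D.conj _ _ _ (D.anti _ _ h hg)
      · rw [map_zero]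
  degree V x hx h0 := by
    classical
    obtain ⟨ω, hω⟩ := Finsupp.ne_iff.1 h0
    have h1 : orbDeg act Q U ω ⊆ V := by
      by_contra h
      apply hω
      rw [← hx.1, orbProj_apply, if_neg h]
      rfl
    have h2 : V ⊆ orbDeg act Q U ω := by
      by_contra h
      apply hω
      have := congr($(hx.2 _ h) ω)
      rwa [orbProj_apply, if_pos subset_rfl] at this
    exact ⟨U ω.1, hU _, _, h1.antisymm h2⟩

end Cover

end Graded

/-! ### Comparison for graded permutation representations -/

section OrbitPieces

variable {k : Type u} [CommRing k] {G G' : Type u} [Group G] [Group G'] {E : Type}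
variable {act : G →* Equiv.Perm E} {Q : Set E → Subgroup G} {φ : G' →* G} {M : Set E}
  {𝒲 : Set (Set E)}

theorem permRep_apply {Ω : Type u} (α : G →* Equiv.Perm Ω) (g : G) (x : Ω →₀ k) (ω : Ω) :
    permRep k α g x ω = x (α g⁻¹ ω) := by
  rw [map_inv]
  exact Finsupp.mapDomain_equiv_apply (f := α g) x ω

variable {I : Type u} (U : I → Set E) (D : StabData act Q φ M 𝒲)

/-- The permutation representation on one orbit. -/
noncomputable abbrev pieceRep (k : Type u) [CommRing k] (Q : Set E → Subgroup G) (i : I) :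
    Representation k G ((G ⧸ Q (U i)) →₀ k) :=
  permRep k (MulAction.toPermHom G (G ⧸ Q (U i)))

variable (act Q M) in
/-- The elements of an orbit that have degree contained in `M`. -/
def pieceSet (i : I) : Set (G ⧸ Q (U i)) := {x | orbDeg act Q U ⟨i, x⟩ ⊆ M}

include D in
theorem smul_mem_pieceSet (i : I) (g : G') (x : G ⧸ Q (U i)) :
    φ g • x ∈ pieceSet act Q M U i ↔ x ∈ pieceSet act Q M U i := by
  have h := orbDeg_smul U D (φ g) ⟨i, x⟩
  change orbDeg act Q U (orbPerm U Q (φ g) ⟨i, x⟩) ⊆ M ↔ _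
  rw [h]
  conv_lhs => rw [← D.map g]
  exact Set.image_subset_image_iff (act (φ g)).injective

/-- The action of `G'` on the elements of an orbit of degree contained in `M`. -/
def piecePerm (i : I) : G' →* Equiv.Perm (pieceSet act Q M U i) where
  toFun g := (MulAction.toPermHom G (G ⧸ Q (U i)) (φ g)).subtypePerm
    (smul_mem_pieceSet U D i g)
  map_one' := by
    ext x
    simp
  map_mul' g h := by
    refine Equiv.ext fun x => Subtype.ext ?_
    change φ (g * h) • x.1 = φ g • φ h • x.1
    rw [map_mul, mul_smul]

theorem pieceMap_equivar (i : I) : Equivar φ (permRep k (piecePerm U D i)) (pieceRep U k Q i)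
    (Finsupp.lmapDomain k k Subtype.val) :=
  lmapDomain_equivar _ _ _ fun _ _ => rfl

section Stab

variable (i : I)

include D in
theorem mk_one_mem (hU : U i ∈ 𝒲) : ((1 : G) : G ⧸ Q (U i)) ∈ pieceSet act Q M U i := by
  change orbDeg act Q U _ ⊆ M
  rw [orbDeg_mk U D, map_one, Equiv.Perm.coe_one, Set.image_id]
  exact D.sub _ hU

theorem smul_mk_one (h : Q (U i)) :
    (MulAction.toPermHom G (G ⧸ Q (U i)) ((Q (U i)).subtype h)) ((1 : G) : G ⧸ Q (U i)) =
      ((1 : G) : G ⧸ Q (U i)) := by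
  refine QuotientGroup.eq.2 ?_
  change (h.1 * 1)⁻¹ * 1 ∈ _
  simp

theorem smul_mk_one' (hU : U i ∈ 𝒲) (h : (Q (U i)).comap φ) :
    piecePerm U D i (((Q (U i)).comap φ).subtype h) ⟨((1 : G) : G ⧸ Q (U i)), mk_one_mem U D i hU⟩ =
      ⟨((1 : G) : G ⧸ Q (U i)), mk_one_mem U D i hU⟩ :=
  Subtype.ext (smul_mk_one U i ⟨φ h.1, h.2⟩)

theorem stab_equivar (k : Type u) [CommRing k] (Q : Set E → Subgroup G) :
    Equivar (Q (U i)).subtype (Representation.trivial k (Q (U i)) k) (pieceRep U k Q i)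
      (Finsupp.lsingle ((1 : G) : G ⧸ Q (U i))) :=
  single_equivar (Q (U i)).subtype (MulAction.toPermHom G (G ⧸ Q (U i))) _ (smul_mk_one U i)

theorem stab_equivar' (k : Type u) [CommRing k] (hU : U i ∈ 𝒲) :
    Equivar ((Q (U i)).comap φ).subtype (Representation.trivial k ((Q (U i)).comap φ) k)
      (permRep k (piecePerm U D i))
      (Finsupp.lsingle ⟨((1 : G) : G ⧸ Q (U i)), mk_one_mem U D i hU⟩) :=
  single_equivar ((Q (U i)).comap φ).subtype (piecePerm U D i) _ (smul_mk_one' U D i hU)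

/-- The homology of an orbit is the homology of the stabilizer of the base point. -/
theorem shapiro_piece (n : ℕ) :
    Function.Bijective ((stab_equivar U i k Q).H n) := by
  refine shapiro (Q (U i)).subtype Subtype.val_injective (MulAction.toPermHom G (G ⧸ Q (U i))) _
    (smul_mk_one U i) ?_ ?_ n
  · intro g hg
    have hg : (1 : G)⁻¹ * (g * 1) ∈ Q (U i) := QuotientGroup.eq.1 hg.symm
    exact ⟨⟨g, by simpa using hg⟩, rfl⟩
  · intro x
    induction x using QuotientGroup.induction_on with
    | H g => exact ⟨g, congrArg _ (mul_one g)⟩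

/-- The elements of an orbit that have degree contained in `M` form a single orbit of `G'`, by the
condition `ext`. -/
theorem shapiro_piece' (hU : U i ∈ 𝒲) (n : ℕ) :
    Function.Bijective ((stab_equivar' U D i k hU).H n) := by
  refine shapiro ((Q (U i)).comap φ).subtype Subtype.val_injective (piecePerm U D i) _
    (smul_mk_one' U D i hU) ?_ ?_ n
  · intro g hg
    have hg : (1 : G)⁻¹ * (φ g * 1) ∈ Q (U i) := QuotientGroup.eq.1 (congrArg Subtype.val hg).symm
    exact ⟨⟨g, by simpa using hg⟩, rfl⟩
  · rintro ⟨x, hx⟩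
    induction x using QuotientGroup.induction_on with
    | H g =>
      change orbDeg act Q U _ ⊆ M at hx
      rw [orbDeg_mk U D] at hx
      obtain ⟨g', hg'⟩ := D.ext _ hU g hx
      refine ⟨g', Subtype.ext (QuotientGroup.eq.2 ?_).symm⟩
      change g⁻¹ * (φ g' * 1) ∈ _
      rwa [mul_one]

theorem piece_injective_iff (hU : U i ∈ 𝒲) (n : ℕ) :
    Function.Injective ((pieceMap_equivar (k := k) U D i).H n) ↔
      Function.Injective ((trivial_equivar k (φ.subgroupComap (Q (U i)))).H n) :=
  ((trivial_equivar k (φ.subgroupComap (Q (U i)))).H_injective_iff_of_square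
    (pieceMap_equivar (k := k) U D i) (stab_equivar U i k Q)
    (stab_equivar' U D i k hU) (fun _ => rfl)
    (fun b => by simp) n (shapiro_piece U i n) (shapiro_piece' U D i hU n)).symm

theorem piece_surjective_iff (hU : U i ∈ 𝒲) (n : ℕ) :
    Function.Surjective ((pieceMap_equivar (k := k) U D i).H n) ↔
      Function.Surjective ((trivial_equivar k (φ.subgroupComap (Q (U i)))).H n) :=
  ((trivial_equivar k (φ.subgroupComap (Q (U i)))).H_surjective_iff_of_square
    (pieceMap_equivar (k := k) U D i) (stab_equivar U i k Q)
    (stab_equivar' U D i k hU) (fun _ => rfl)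
    (fun b => by simp) n (shapiro_piece U i n) (shapiro_piece' U D i hU n)).symm

end Stab

/-- The inclusion of an orbit in the disjoint union. -/
def orbMk (Q : Set E → Subgroup G) (i : I) (x : G ⧸ Q (U i)) : Orb U Q := ⟨i, x⟩

theorem orbMk_injective (i : I) : Function.Injective (orbMk U Q i) := by
  intro x y h
  cases h
  rfl

/-- The inclusion of a piece of `k[Ω]`. -/
noncomputable def pieceIncl (k : Type u) [CommRing k] (Q : Set E → Subgroup G) (i : I) :
    ((G ⧸ Q (U i)) →₀ k) →ₗ[k] (Orb U Q →₀ k) :=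
  Finsupp.lmapDomain k k (orbMk U Q i)

/-- The projection to a piece of `k[Ω]`. -/
noncomputable def pieceProj (k : Type u) [CommRing k] (Q : Set E → Subgroup G) (i : I) :
    (Orb U Q →₀ k) →ₗ[k] ((G ⧸ Q (U i)) →₀ k) :=
  Finsupp.lcomapDomain (orbMk U Q i) (orbMk_injective U i)

theorem pieceProj_apply (i : I) (x : Orb U Q →₀ k) (y : G ⧸ Q (U i)) :
    pieceProj U k Q i x y = x ⟨i, y⟩ := rfl

theorem pieceIncl_equivar (i : I) : Equivar (MonoidHom.id G) (pieceRep U k Q i)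
    (permRep k (orbPerm U Q)) (pieceIncl U k Q i) :=
  lmapDomain_equivar _ _ (orbMk U Q i) fun _ _ => rfl

theorem pieceProj_equivar (i : I) : Equivar (MonoidHom.id G) (permRep k (orbPerm U Q))
    (pieceRep U k Q i) (pieceProj U k Q i) := by
  intro g x
  refine Finsupp.ext fun y => ?_
  rw [pieceProj_apply, permRep_apply, permRep_apply, pieceProj_apply]
  rfl

open Classical in
theorem pieceIncl_pieceProj (i : I) (x : Orb U Q →₀ k) (ω : Orb U Q) :
    pieceIncl U k Q i (pieceProj U k Q i x) ω = if ω.1 = i then x ω else 0 := by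
  obtain ⟨i', y⟩ := ω
  split_ifs with h
  · obtain rfl : i' = i := h
    exact Finsupp.mapDomain_apply (orbMk_injective U i') (pieceProj U k Q i' x) y
  · refine Finsupp.mapDomain_of_notMem_range (pieceProj U k Q i x) _ ?_
    rintro ⟨y', hy'⟩
    exact h (congrArg Sigma.fst hy').symm

theorem exists_sum_piece (x : Orb U Q →₀ k) : ∃ s : Finset I, ∀ t, s ⊆ t →
    ∑ i ∈ t, pieceIncl U k Q i (pieceProj U k Q i x) = x := by
  classical
  refine ⟨x.support.image Sigma.fst, fun t ht => Finsupp.ext fun ω => ?_⟩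
  rw [Finsupp.finsetSum_apply]
  simp only [pieceIncl_pieceProj, Finset.sum_ite_eq]
  split_ifs with h
  · rfl
  · by_contra h'
    exact h (ht (Finset.mem_image_of_mem _ (Finsupp.mem_support_iff.2 (Ne.symm h'))))

variable (hU : ∀ i, U i ∈ 𝒲)

/-- The inclusion of a piece of the part of `k[Ω]` of degree contained in `M`. -/
noncomputable def pieceIncl' (i : I) :
    (pieceSet act Q M U i →₀ k) →ₗ[k] LinearMap.range (orbProj k act Q U M) :=
  LinearMap.codRestrict (LinearMap.range (orbProj k act Q U M))
    (pieceIncl U k Q i ∘ₗ Finsupp.lmapDomain k k Subtype.val) fun x => by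
    classical
    refine ⟨(pieceIncl U k Q i ∘ₗ Finsupp.lmapDomain k k Subtype.val) x, ?_⟩
    induction x using Finsupp.induction_linear with
    | zero => simp
    | add f g hf hg => rw [map_add, map_add, hf, hg]
    | single y a =>
      rw [LinearMap.comp_apply, Finsupp.lmapDomain_apply, Finsupp.mapDomain_single, pieceIncl,
          Finsupp.lmapDomain_apply, Finsupp.mapDomain_single, orbProj_single]
      exact if_pos y.2

/-- The projection to a piece of the part of `k[Ω]` of degree contained in `M`. -/
noncomputable def pieceProj' (i : I) :
    LinearMap.range (orbProj k act Q U M) →ₗ[k] (pieceSet act Q M U i →₀ k) :=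
  Finsupp.lsubtypeDomain (pieceSet act Q M U i) ∘ₗ pieceProj U k Q i ∘ₗ
    (LinearMap.range (orbProj k act Q U M)).subtype

theorem pieceIncl'_equivar (i : I) :
    Equivar (V₂ := LinearMap.range (orbProj k act Q U M)) (MonoidHom.id G')
    (permRep k (piecePerm U D i)) ((orb_graded (k := k) U D hU).part D) (pieceIncl' U i) := by
  intro g x
  refine Subtype.ext ?_
  exact (pieceMap_equivar U D i).comp (pieceIncl_equivar U i) g x

theorem pieceProj'_equivar (i : I) :
    Equivar (V₁ := LinearMap.range (orbProj k act Q U M)) (MonoidHom.id G')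
    ((orb_graded (k := k) U D hU).part D) (permRep k (piecePerm U D i)) (pieceProj' U i) := by
  intro g x
  refine Finsupp.ext fun y => ?_
  have h := congr($(pieceProj_equivar U i (φ g) x.1) y.1)
  rw [permRep_apply]
  refine h.trans ?_
  rw [permRep_apply]
  change pieceProj U k Q i x.1 ((φ g)⁻¹ • y.1) = pieceProj U k Q i x.1 (φ g⁻¹ • y.1)
  rw [map_inv]

theorem pieceProj_coe (i : I) (x : LinearMap.range (orbProj k act Q U M)) :
    pieceProj U k Q i x.1 = Finsupp.lmapDomain k k Subtype.val (pieceProj' U i x) := by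
  classical
  refine Finsupp.ext fun y => ?_
  by_cases hy : y ∈ pieceSet act Q M U i
  · exact (Finsupp.mapDomain_apply Subtype.val_injective (pieceProj' U i x) ⟨y, hy⟩).symm
  · rw [Finsupp.lmapDomain_apply, Finsupp.mapDomain_of_notMem_range _ _ (by simpa using hy),
      pieceProj_apply]
    obtain ⟨_, x, rfl⟩ := x
    exact (orbProj_apply _ _ _ _).trans (if_neg hy)

theorem exists_sum_piece' (x : LinearMap.range (orbProj k act Q U M)) :
    ∃ s : Finset I, ∀ t, s ⊆ t → ∑ i ∈ t, pieceIncl' U i (pieceProj' U i x) = x := by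
  obtain ⟨s, hs⟩ := exists_sum_piece U x.1
  refine ⟨s, fun t ht => Subtype.ext ?_⟩
  rw [AddSubmonoidClass.coe_finsetSum, ← hs t ht]
  refine Finset.sum_congr rfl fun i _ => ?_
  rw [pieceProj_coe]
  rfl

theorem orbPart_equivar : Equivar (V₁ := LinearMap.range (orbProj k act Q U M)) φ
    ((orb_graded (k := k) U D hU).part D) (permRep k (orbPerm U Q))
    (LinearMap.range (orbProj k act Q U M)).subtype :=
  (orb_graded (k := k) U D hU).part_equivar D

theorem orb_surjective (n : ℕ)
    (h : ∀ i, Function.Surjective ((trivial_equivar k (φ.subgroupComap (Q (U i)))).H n)) :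
    Function.Surjective ((orbPart_equivar (k := k) U D hU).H n) := by
  have h1 := fun i => (piece_surjective_iff (k := k) U D i (hU i) n).2 (h i)
  have := @H_surjective_of_pieces k _ G G' _ _ (Orb U Q →₀ k)
    (LinearMap.range (orbProj k act Q U M)) _ _ _ _ I (fun i => (G ⧸ Q (U i)) →₀ k)
    (fun i => pieceSet act Q M U i →₀ k) _ _ _ _ (permRep k (orbPerm U Q))
    (fun i => pieceRep U k Q i) (fun i => pieceIncl U k Q i) (fun i => pieceProj U k Q i)
    ((orb_graded (k := k) U D hU).part D) (fun i => permRep k (piecePerm U D i))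
    (fun i => pieceIncl' U i) φ (LinearMap.range (orbProj k act Q U M)).subtype
    (fun _ => Finsupp.lmapDomain k k Subtype.val)
  specialize this (pieceIncl_equivar U) (pieceProj_equivar U) (exists_sum_piece U)
    (pieceIncl'_equivar U D hU)
  specialize this (orbPart_equivar U D hU) (pieceMap_equivar U D) (fun _ _ => rfl)
  exact this n h1

theorem orb_injective (n : ℕ)
    (h : ∀ i, Function.Injective ((trivial_equivar k (φ.subgroupComap (Q (U i)))).H n)) :
    Function.Injective ((orbPart_equivar (k := k) U D hU).H n) := by
  have h1 := fun i => (piece_injective_iff (k := k) U D i (hU i) n).2 (h i)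
  have := @H_injective_of_pieces k _ G G' _ _ (Orb U Q →₀ k)
    (LinearMap.range (orbProj k act Q U M)) _ _ _ _ I (fun i => (G ⧸ Q (U i)) →₀ k)
    (fun i => pieceSet act Q M U i →₀ k) _ _ _ _ (permRep k (orbPerm U Q))
    (fun i => pieceRep U k Q i) (fun i => pieceProj U k Q i)
    ((orb_graded (k := k) U D hU).part D) (fun i => permRep k (piecePerm U D i))
    (fun i => pieceIncl' U i) (fun i => pieceProj' U i) φ
    (LinearMap.range (orbProj k act Q U M)).subtype
    (fun _ => Finsupp.lmapDomain k k Subtype.val)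
  specialize this (pieceProj_equivar U) (pieceIncl'_equivar U D hU) (pieceProj'_equivar U D hU)
    (exists_sum_piece' U)
  specialize this (orbPart_equivar U D hU) (pieceMap_equivar U D)
    (fun i x => pieceProj_coe U i x)
  exact this n h1

end OrbitPieces

/-! ### Comparison for graded representations -/

section DimensionShift

variable {k : Type u} [CommRing k] {G G' : Type u} [Group G] [Group G'] {E : Type}
variable {act : G →* Equiv.Perm E} {Q : Set E → Subgroup G} {φ : G' →* G} {M : Set E}
  {𝒲 : Set (Set E)}
variable {N P : Type u} [AddCommGroup N] [Module k N] [AddCommGroup P] [Module k P]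
variable {ρ : Representation k G N} {δ : Set E → N →ₗ[k] N}
  {τ : Representation k G P} {ε : Set E → P →ₗ[k] P} {c : P →ₗ[k] N}

theorem ker_le_comap (hc : Equivar (MonoidHom.id G) τ ρ c) (g : G) :
    LinearMap.ker c ≤ (LinearMap.ker c).comap (τ g) := by
  intro x hx
  have hx : c x = 0 := hx
  change c _ = 0
  rw [hc, hx, map_zero]

/-- The representation on the kernel of an equivariant map. -/
def kernelRep (hc : Equivar (MonoidHom.id G) τ ρ c) : Representation k G (LinearMap.ker c) :=
  τ.subrepresentation (LinearMap.ker c) (ker_le_comap hc)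

/-- The grading of the kernel of a graded map. -/
def kernelProj (hε : ∀ W x, c (ε W x) = δ W (c x)) (W : Set E) :
    LinearMap.ker c →ₗ[k] LinearMap.ker c :=
  (ε W).restrict fun x hx => by
    have hx : c x = 0 := hx
    change c _ = 0
    rw [hε, hx, map_zero]

theorem kernel_graded (A : Graded act Q 𝒲 τ ε) (hc : Equivar (MonoidHom.id G) τ ρ c)
    (hε : ∀ W x, c (ε W x) = δ W (c x)) :
    Graded (N := LinearMap.ker c) act Q 𝒲 (kernelRep hc) (kernelProj hε) where
  inter U V x := Subtype.ext (A.inter U V x.1)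
  univ x := Subtype.ext (A.univ x.1)
  equivar g U x := Subtype.ext (A.equivar g U x.1)
  fixed U g hg x := Subtype.ext (A.fixed U g hg x.1)
  degree V x hx h0 := A.degree V x.1
    ⟨congrArg Subtype.val hx.1, fun W hW => congrArg Subtype.val (hx.2 W hW)⟩
    fun h => h0 (Subtype.ext h)

theorem kernel_ses (hc : Equivar (MonoidHom.id G) τ ρ c) (hs : Function.Surjective c) :
    SES (V₁ := LinearMap.ker c) (kernelRep hc) τ ρ (LinearMap.ker c).subtype c where
  hi _ _ := rfl
  hp := hc
  inj := Subtype.val_injective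
  surj := hs
  exact := by rw [LinearMap.exact_iff, Submodule.range_subtype]

section Part

variable (D : StabData act Q φ M 𝒲) (A : Graded act Q 𝒲 τ ε) (B : Graded act Q 𝒲 ρ δ)
  (hc : Equivar (MonoidHom.id G) τ ρ c) (hε : ∀ W x, c (ε W x) = δ W (c x))

variable (M) in
/-- The inclusion of the kernel, on the parts of degree contained in `M`. -/
def partIncl : LinearMap.range (kernelProj hε M) →ₗ[k] LinearMap.range (ε M) :=
  (LinearMap.ker c).subtype.restrict (by
    rintro _ ⟨x, rfl⟩
    exact ⟨x.1, rfl⟩)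

variable (M) in
include hε in
/-- The quotient map, on the parts of degree contained in `M`. -/
def partQuot : LinearMap.range (ε M) →ₗ[k] LinearMap.range (δ M) :=
  c.restrict (by
    rintro _ ⟨x, rfl⟩
    exact ⟨c x, (hε M x).symm⟩)

/-- The part of degree contained in `M` is an exact functor, because `δ M` is idempotent. -/
theorem part_ses (hs : Function.Surjective c) :
    SES (V₁ := LinearMap.range (kernelProj hε M)) (V₂ := LinearMap.range (ε M))
      (V₃ := LinearMap.range (δ M)) ((kernel_graded A hc hε).part D) (A.part D) (B.part D)
      (partIncl M hε) (partQuot M hε) where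
  hi _ _ := rfl
  hp g x := Subtype.ext (hc (φ g) x.1)
  inj x y h := Subtype.ext (Subtype.ext (congrArg (fun z : LinearMap.range (ε M) => z.1) h))
  surj := by
    rintro ⟨_, y, rfl⟩
    obtain ⟨x, rfl⟩ := hs y
    exact ⟨⟨ε M x, x, rfl⟩, Subtype.ext (hε M x)⟩
  exact := by
    intro x
    constructor
    · intro h
      have h' : c x.1 = 0 := congrArg Subtype.val h
      exact ⟨⟨⟨x.1, h'⟩, ⟨x.1, h'⟩, Subtype.ext (A.δ_coe x)⟩, rfl⟩
    · rintro ⟨y, rfl⟩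
      exact Subtype.ext y.1.2

theorem part_sesHom (hs : Function.Surjective c) :
    SESHom (part_ses D A B hc hε hs) (kernel_ses hc hs) φ
      (LinearMap.range (kernelProj hε M)).subtype (LinearMap.range (ε M)).subtype
      (LinearMap.range (δ M)).subtype where
  h₁ := (kernel_graded A hc hε).part_equivar D
  h₂ := A.part_equivar D
  h₃ := B.part_equivar D
  c₁ _ := rfl
  c₂ _ := rfl

variable (hs : Function.Surjective c) (n : ℕ)

include hc hε hs

theorem part_surjective_zero (s₂ : Function.Surjective ((A.part_equivar D).H 0)) :
    Function.Surjective ((B.part_equivar D).H 0) :=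
  (part_sesHom D A B hc hε hs).surjective₃_zero s₂

theorem part_injective_zero
    (s₁ : Function.Surjective (((kernel_graded A hc hε).part_equivar D).H 0))
    (i₂ : Function.Injective ((A.part_equivar D).H 0)) :
    Function.Injective ((B.part_equivar D).H 0) :=
  (part_sesHom D A B hc hε hs).injective₃_zero s₁ i₂

theorem part_surjective (s₂ : Function.Surjective ((A.part_equivar D).H (n + 1)))
    (s₁ : Function.Surjective (((kernel_graded A hc hε).part_equivar D).H n))
    (i₂ : Function.Injective ((A.part_equivar D).H n)) :
    Function.Surjective ((B.part_equivar D).H (n + 1)) :=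
  (part_sesHom D A B hc hε hs).surjective₃ n s₂ s₁ i₂

theorem part_injective
    (s₁ : Function.Surjective (((kernel_graded A hc hε).part_equivar D).H (n + 1)))
    (i₂ : Function.Injective ((A.part_equivar D).H (n + 1)))
    (i₁ : Function.Injective (((kernel_graded A hc hε).part_equivar D).H n)) :
    Function.Injective ((B.part_equivar D).H (n + 1)) :=
  (part_sesHom D A B hc hε hs).injective₃ n s₁ i₂ i₁

end Part

/-! ### The cover of a graded representation -/

section Cover

variable (𝒲 δ) in
/-- The homogeneous vectors of degree in `𝒲`. -/
def HomogIdx : Type u := {p : Set E × N // p.1 ∈ 𝒲 ∧ Homog δ p.1 p.2}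

/-- The degree of a homogeneous vector. -/
def HomogIdx.deg (i : HomogIdx 𝒲 δ) : Set E := i.1.1

variable (D : StabData act Q φ M 𝒲) (B : Graded act Q 𝒲 ρ δ)

variable (Q ρ 𝒲 δ) in
/-- The map from a graded permutation representation that hits the homogeneous vectors. -/
noncomputable def homogCover : (Orb (HomogIdx.deg (𝒲 := 𝒲) (δ := δ)) Q →₀ k) →ₗ[k] N :=
  Finsupp.linearCombination k fun ω => ρ ω.2.out ω.1.1.2

include B in
theorem homogCover_single (i : HomogIdx 𝒲 δ) (g : G) (a : k) :
    homogCover Q 𝒲 ρ δ (Finsupp.single ⟨i, (g : G ⧸ Q i.deg)⟩ a) = a • ρ g i.1.2 := by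
  refine (Finsupp.linearCombination_single _ _ _).trans ?_
  obtain ⟨h, hh⟩ := QuotientGroup.mk_out_eq_mul (Q i.deg) g
  change a • ρ (Quotient.out (g : G ⧸ Q i.deg)) i.1.2 = _
  have := B.fixed _ _ h.2 i.1.2
  rw [show δ i.deg i.1.2 = i.1.2 from i.2.2.1] at this
  rw [hh, map_mul, Module.End.mul_apply, this]

include B in
theorem homogCover_equivar : Equivar (MonoidHom.id G)
    (permRep k (orbPerm (HomogIdx.deg (𝒲 := 𝒲) (δ := δ)) Q)) ρ (homogCover Q 𝒲 ρ δ) := by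
  intro g x
  induction x using Finsupp.induction_linear with
  | zero => simp
  | add f g hf hg => simp only [map_add, hf, hg]
  | single ω a =>
    obtain ⟨i, y⟩ := ω
    induction y using QuotientGroup.induction_on with
    | H h =>
      rw [permRep_single, homogCover_single B, map_smul, MonoidHom.id_apply,
        ← Module.End.mul_apply, ← map_mul]
      exact homogCover_single B i (g * h) a

include D B in
theorem homogCover_proj (W : Set E) (x) :
    homogCover Q 𝒲 ρ δ (orbProj k act Q HomogIdx.deg W x) = δ W (homogCover Q 𝒲 ρ δ x) := by
  classical
  induction x using Finsupp.induction_linear with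
  | zero => simp
  | add f g hf hg => simp only [map_add, hf, hg]
  | single ω a =>
    obtain ⟨i, y⟩ := ω
    induction y using QuotientGroup.induction_on with
    | H h =>
      have hom := B.homog_smul h i.2.2
      rw [orbProj_single, orbDeg_mk _ D, homogCover_single B, map_smul]
      split_ifs with hW
      · rw [homogCover_single B]
        have : W ∩ act h '' i.1.1 = act h '' i.1.1 := Set.inter_eq_right.2 hW
        rw [← hom.1, B.inter, this]
      · rw [map_zero, hom.2 W hW, smul_zero]

include B in
theorem homogCover_surjective [Finite E] : Function.Surjective (homogCover Q 𝒲 ρ δ) := by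
  rw [← LinearMap.range_eq_top, eq_top_iff, ← span_homog δ B.inter B.univ, Submodule.span_le]
  rintro x ⟨V, hx⟩
  by_cases h0 : x = 0
  · rw [h0]; exact zero_mem _
  · obtain ⟨U, hU, g, rfl⟩ := B.degree V x hx h0
    have h := B.homog_smul g⁻¹ hx
    rw [act_inv_image] at h
    let i : HomogIdx 𝒲 δ := ⟨(U, ρ g⁻¹ x), hU, h⟩
    refine ⟨Finsupp.single ⟨i, (g : G ⧸ Q i.deg)⟩ 1, ?_⟩
    rw [homogCover_single B, one_smul]
    change ρ g (ρ g⁻¹ x) = x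
    rw [← Module.End.mul_apply, ← map_mul, mul_inv_cancel, map_one,
      Module.End.one_apply]

end Cover

/-- Comparison for graded representations: if the stabilizers of the degrees that occur have the
same homology in a range, then the part of degree contained in `M` has the same homology as the
whole representation in this range. The proof is by dimension shifting along covers by permutation
representations, for which the result is Shapiro's lemma. -/
theorem graded_compare [Finite E] (D : StabData act Q φ M 𝒲) {a b : ℕ} (hba : b ≤ a)
    (hab : a ≤ b + 1)
    (hs : ∀ U ∈ 𝒲, ∀ l, l < a →
      Function.Surjective ((trivial_equivar k (φ.subgroupComap (Q U))).H l))
    (hi : ∀ U ∈ 𝒲, ∀ l, l < b →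
      Function.Injective ((trivial_equivar k (φ.subgroupComap (Q U))).H l))
    (p : ℕ) : ∀ {N : Type u} [AddCommGroup N] [Module k N] {ρ : Representation k G N}
      {δ : Set E → N →ₗ[k] N} (B : Graded act Q 𝒲 ρ δ),
      (p < a → Function.Surjective ((B.part_equivar D).H p)) ∧
      (p < b → Function.Injective ((B.part_equivar D).H p)) := by
  have hU : ∀ {N : Type u} [AddCommGroup N] [Module k N] (δ : Set E → N →ₗ[k] N)
    (i : HomogIdx 𝒲 δ), i.deg ∈ 𝒲 := fun δ i => i.2.1
  have s₂ : ∀ {N : Type u} [AddCommGroup N] [Module k N] (δ : Set E → N →ₗ[k] N) (l : ℕ), l < a →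
      Function.Surjective ((orbPart_equivar (k := k) HomogIdx.deg D (hU δ)).H l) :=
    fun δ l hl => orb_surjective _ D (hU δ) l fun i => hs _ (hU δ i) l hl
  have i₂ : ∀ {N : Type u} [AddCommGroup N] [Module k N] (δ : Set E → N →ₗ[k] N) (l : ℕ), l < b →
      Function.Injective ((orbPart_equivar (k := k) HomogIdx.deg D (hU δ)).H l) :=
    fun δ l hl => orb_injective _ D (hU δ) l fun i => hi _ (hU δ i) l hl
  induction p with
  | zero =>
    have surj : ∀ {N : Type u} [AddCommGroup N] [Module k N] {ρ : Representation k G N}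
        {δ : Set E → N →ₗ[k] N} (B : Graded act Q 𝒲 ρ δ), 0 < a →
        Function.Surjective ((B.part_equivar D).H 0) := fun {N} _ _ {ρ δ} B ha =>
      part_surjective_zero D (orb_graded (k := k) _ D (hU δ)) B (homogCover_equivar B)
        (homogCover_proj D B) (homogCover_surjective B) (s₂ δ 0 ha)
    intro N _ _ ρ δ B
    exact ⟨surj B, fun hb => part_injective_zero D (orb_graded (k := k) _ D (hU δ)) B
      (homogCover_equivar B) (homogCover_proj D B) (homogCover_surjective B) (surj _ (by omega))
      (i₂ δ 0 hb)⟩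
  | succ p ih =>
    have surj : ∀ {N : Type u} [AddCommGroup N] [Module k N] {ρ : Representation k G N}
        {δ : Set E → N →ₗ[k] N} (B : Graded act Q 𝒲 ρ δ), p + 1 < a →
        Function.Surjective ((B.part_equivar D).H (p + 1)) := fun {N} _ _ {ρ δ} B ha =>
      part_surjective D (orb_graded (k := k) _ D (hU δ)) B (homogCover_equivar B)
        (homogCover_proj D B) (homogCover_surjective B) p (s₂ δ _ ha) ((ih _).1 (by omega))
        (i₂ δ p (by omega))
    intro N _ _ ρ δ B
    exact ⟨surj B, fun hb => part_injective D (orb_graded (k := k) _ D (hU δ)) B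
      (homogCover_equivar B) (homogCover_proj D B) (homogCover_surjective B) p (surj _ (by omega))
      (i₂ δ _ hb) ((ih _).2 (by omega))⟩

/-- A form of `graded_compare` for a representation of `G'` that is mapped isomorphically to the
part of degree contained in `M`. -/
theorem graded_compare_of_range [Finite E] (D : StabData act Q φ M 𝒲) {a b : ℕ} (hba : b ≤ a)
    (hab : a ≤ b + 1)
    (hs : ∀ U ∈ 𝒲, ∀ l, l < a →
      Function.Surjective ((trivial_equivar k (φ.subgroupComap (Q U))).H l))
    (hi : ∀ U ∈ 𝒲, ∀ l, l < b →
      Function.Injective ((trivial_equivar k (φ.subgroupComap (Q U))).H l))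
    (p : ℕ) {N P : Type u} [AddCommGroup N] [Module k N] [AddCommGroup P] [Module k P]
    {ρ : Representation k G N} {δ : Set E → N →ₗ[k] N} (B : Graded act Q 𝒲 ρ δ)
    {τ : Representation k G' P} {f : P →ₗ[k] N} (hf : Equivar φ τ ρ f)
    (hinj : Function.Injective f) (hrange : LinearMap.range f = LinearMap.range (δ M)) :
    (p < a → Function.Surjective (hf.H p)) ∧ (p < b → Function.Injective (hf.H p)) := by
  let e : P →ₗ[k] LinearMap.range (δ M) :=
    f.codRestrict _ fun x => hrange ▸ LinearMap.mem_range_self f x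
  have he : Equivar (V₂ := LinearMap.range (δ M)) (MonoidHom.id _) τ (B.part D) e := fun g x =>
    Subtype.ext (hf g x)
  have hbij : Function.Bijective e := by
    refine ⟨fun x y hxy => hinj (congrArg Subtype.val hxy), fun y => ?_⟩
    obtain ⟨x, hx⟩ : y.1 ∈ LinearMap.range f := by rw [hrange]; exact y.2
    exact ⟨x, Subtype.ext hx⟩
  have h := graded_compare D hba hab hs hi p B
  exact ⟨fun hp => (hf.H_surjective_iff_of_bijective (B.part_equivar D) (Equivar.id _) he
      Function.bijective_id hbij (fun _ => rfl) p).2 (h.1 hp),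
    fun hp => (hf.H_injective_iff_of_bijective (B.part_equivar D) (Equivar.id _) he
      Function.bijective_id hbij (fun _ => rfl) p).2 (h.2 hp)⟩

end DimensionShift

/-! ### Restrictions of families of objects -/

namespace Wreath

variable {𝒞 : Type u} [Category.{v} 𝒞] {Λ : MorphismProperty FinPart}

section Agree

variable [Λ.IsMultiplicative] {X Y Z : Wreath 𝒞 Λ}

/-- The morphisms `f` and `f'` agree at the index `e`. -/
def Agree (f f' : X ⟶ Y) (e : X.idx) : Prop :=
  (∀ y, y ∈ f.base.pfun e ↔ y ∈ f'.base.pfun e) ∧ ∀ y h h', f.app e y h = f'.app e y h'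

theorem eq_iff_agree {f f' : X ⟶ Y} : f = f' ↔ ∀ e, Agree f f' e := by
  constructor
  · rintro rfl e
    exact ⟨fun _ => Iff.rfl, fun _ _ _ => rfl⟩
  · intro h
    exact hom_ext (fun e => (h e).1) (fun e => (h e).2)

theorem Agree.refl (f : X ⟶ Y) (e : X.idx) : Agree f f e := eq_iff_agree.1 rfl e

theorem Agree.symm {f f' : X ⟶ Y} {e : X.idx} (h : Agree f f' e) : Agree f' f e :=
  ⟨fun y => (h.1 y).symm, fun y h₁ h₂ => (h.2 y h₂ h₁).symm⟩

theorem Agree.trans {f f' f'' : X ⟶ Y} {e : X.idx} (h : Agree f f' e) (h' : Agree f' f'' e) :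
    Agree f f'' e :=
  ⟨fun y => (h.1 y).trans (h'.1 y),
    fun y h₁ h₂ => (h.2 y h₁ ((h.1 y).1 h₁)).trans (h'.2 y _ h₂)⟩

theorem Agree.comp {f f' : X ⟶ Y} {g g' : Y ⟶ Z} {e : X.idx} (h : Agree f f' e)
    (h' : ∀ y, y ∈ f.base.pfun e → Agree g g' y) : Agree (f ≫ g) (f' ≫ g') e := by
  refine ⟨fun z => ?_, fun z hz hz' => ?_⟩
  · rw [mem_comp_base, mem_comp_base]
    constructor
    · rintro ⟨y, hy, hz⟩
      exact ⟨y, (h.1 y).1 hy, ((h' y hy).1 z).1 hz⟩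
    · rintro ⟨y, hy, hz⟩
      have hy' := (h.1 y).2 hy
      exact ⟨y, hy', ((h' y hy').1 z).2 hz⟩
  · obtain ⟨y, hy, hyz⟩ := (mem_comp_base _ _ _ _).1 hz
    rw [comp_app f g e y z hy hyz,
      comp_app f' g' e y z ((h.1 y).1 hy) (((h' y hy).1 z).1 hyz), h.2 y hy, (h' y hy).2 z hyz]

end Agree

variable [ContainsTheta Λ] {C D : Wreath 𝒞 Λ}

theorem mem_incl {M : Set C.idx} (e : M) (y : C.idx) :
    y ∈ (C.incl M).base.pfun e ↔ y = e.1 := Part.mem_some_iff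

theorem mem_retr {M : Set C.idx} (e : C.idx) (y : M) :
    y ∈ (C.retr M).base.pfun e ↔ y.1 = e := by
  constructor
  · rintro ⟨h, rfl⟩
    rfl
  · rintro rfl
    exact ⟨y.2, rfl⟩

theorem mem_idem {M : Set C.idx} (e y : C.idx) :
    y ∈ (C.idem M).base.pfun e ↔ e ∈ M ∧ y = e := by
  rw [idem, mem_comp_base]
  constructor
  · rintro ⟨z, hz, hy⟩
    obtain rfl := (mem_retr _ _).1 hz
    exact ⟨z.2, (mem_incl _ _).1 hy⟩
  · rintro ⟨h, rfl⟩
    exact ⟨⟨y, h⟩, (mem_retr _ _).2 rfl, (mem_incl _ _).2 rfl⟩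

theorem idem_app {M : Set C.idx} (e : C.idx) (h) : (C.idem M).app e e h = 𝟙 (C.fam e) := by
  have he := ((mem_idem e e).1 h).1
  refine (comp_app (C.retr M) (C.incl M) e ⟨e, he⟩ e ((mem_retr _ _).2 rfl)
    ((mem_incl _ _).2 rfl) h).trans ?_
  exact Category.comp_id _

theorem agree_incl_comp_iff {M : Set C.idx} {f f' : C ⟶ D} (e : M) :
    Agree (C.incl M ≫ f) (C.incl M ≫ f') e ↔ Agree f f' e.1 := by
  have hmem : ∀ (f : C ⟶ D) y, y ∈ (C.incl M ≫ f).base.pfun e ↔ y ∈ f.base.pfun e.1 := by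
    intro f y
    refine (mem_comp_base (C.incl M) f e y).trans ⟨?_, ?_⟩
    · rintro ⟨z, hz, hy⟩
      obtain rfl := (mem_incl _ _).1 hz
      exact hy
    · exact fun h => ⟨e.1, (mem_incl _ _).2 rfl, h⟩
  have happ : ∀ (f : C ⟶ D) y (h : y ∈ f.base.pfun e.1) h',
      (C.incl M ≫ f).app e y h' = f.app e.1 y h := by
    intro f y h h'
    refine (comp_app (C.incl M) f e e.1 y ((mem_incl _ _).2 rfl) h h').trans ?_
    exact Category.id_comp _
  constructor
  · intro h
    exact ⟨fun y => (hmem f y).symm.trans ((h.1 y).trans (hmem f' y)),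
      fun y hy hy' => (happ f y hy ((hmem f _).2 hy)).symm.trans
        ((h.2 y _ _).trans (happ f' y hy' ((hmem f' _).2 hy')))⟩
  · intro h
    exact ⟨fun y => (hmem f y).trans ((h.1 y).trans (hmem f' y).symm),
      fun y hy hy' => (happ f y ((hmem f y).1 hy) hy).trans
        ((h.2 y _ _).trans (happ f' y ((hmem f' y).1 hy') hy').symm)⟩

theorem incl_comp_eq_iff {M : Set C.idx} {f f' : C ⟶ D} :
    C.incl M ≫ f = C.incl M ≫ f' ↔ ∀ e ∈ M, Agree f f' e :=
  eq_iff_agree.trans ⟨fun h e he => (agree_incl_comp_iff ⟨e, he⟩).1 (h ⟨e, he⟩),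
    fun h e => (agree_incl_comp_iff e).2 (h e.1 e.2)⟩

theorem incl_comp_retr (M : Set C.idx) : C.incl M ≫ C.retr M = 𝟙 (C.restrict M) := by
  have hmem : ∀ (e : M) (y : M),
      y ∈ (C.incl M ≫ C.retr M).base.pfun e ↔ y = e := by
    intro e y
    refine (mem_comp_base (C.incl M) (C.retr M) e y).trans ⟨?_, ?_⟩
    · rintro ⟨z, hz, hy⟩
      obtain rfl := (mem_incl _ _).1 hz
      exact Subtype.ext ((mem_retr _ _).1 hy)
    · rintro rfl
      exact ⟨y.1, (mem_incl _ _).2 rfl, (mem_retr _ _).2 rfl⟩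
  refine eq_iff_agree.2 fun e => ⟨fun y => (hmem e y).trans (mem_id_base _ _).symm,
    fun y hy hy' => ?_⟩
  obtain rfl := (hmem e y).1 hy
  refine (comp_app (C.incl M) (C.retr M) y y.1 y ((mem_incl _ _).2 rfl)
    ((mem_retr _ _).2 rfl) hy).trans ?_
  exact Category.comp_id _

theorem incl_comp_idem (M : Set C.idx) : C.incl M ≫ C.idem M = C.incl M := by
  rw [idem, ← Category.assoc, incl_comp_retr, Category.id_comp]

theorem idem_comp_idem (U V : Set C.idx) : C.idem V ≫ C.idem U = C.idem (U ∩ V) := by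
  have hmem : ∀ e y, y ∈ (C.idem V ≫ C.idem U).base.pfun e ↔ y ∈ (C.idem (U ∩ V)).base.pfun e := by
    intro e y
    rw [mem_comp_base, mem_idem]
    constructor
    · rintro ⟨z, hz, hy⟩
      obtain ⟨h, rfl⟩ := (mem_idem _ _).1 hz
      obtain ⟨h', rfl⟩ := (mem_idem _ _).1 hy
      exact ⟨⟨h', h⟩, rfl⟩
    · rintro ⟨⟨h, h'⟩, rfl⟩
      exact ⟨y, (mem_idem _ _).2 ⟨h', rfl⟩, (mem_idem _ _).2 ⟨h, rfl⟩⟩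
  refine eq_iff_agree.2 fun e => ⟨hmem e, fun y hy hy' => ?_⟩
  obtain ⟨⟨h, h'⟩, rfl⟩ := (mem_idem _ _).1 hy'
  rw [comp_app (C.idem V) (C.idem U) y y y ((mem_idem _ _).2 ⟨h', rfl⟩)
    ((mem_idem _ _).2 ⟨h, rfl⟩), idem_app, idem_app, idem_app]
  exact Category.comp_id _

theorem idem_univ : C.idem Set.univ = 𝟙 C := by
  have hmem : ∀ e y, y ∈ (C.idem Set.univ).base.pfun e ↔ y = e := by
    intro e y
    rw [mem_idem]
    simp
  refine eq_iff_agree.2 fun e => ⟨fun y => (hmem e y).trans (mem_id_base _ _).symm,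
    fun y hy hy' => ?_⟩
  obtain rfl := (hmem e y).1 hy
  rw [idem_app]
  rfl

/-- The idempotents of `ρ_V(C)` are compatible with those of `C`. -/
theorem retr_comp_idem (V : Set C.idx) (W : Set V) :
    C.retr V ≫ (C.restrict V).idem W = C.idem (Subtype.val '' W) ≫ C.retr V := by
  have h₁ : ∀ e (y : V), y ∈ (C.retr V ≫ (C.restrict V).idem W).base.pfun e ↔ y ∈ W ∧ y.1 = e := by
    intro e y
    refine (mem_comp_base (C.retr V) ((C.restrict V).idem W) e y).trans ⟨?_, ?_⟩
    · rintro ⟨z, hz, hy⟩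
      obtain rfl := (mem_retr _ _).1 hz
      obtain ⟨h, rfl⟩ := (mem_idem (C := C.restrict V) _ _).1 hy
      exact ⟨h, rfl⟩
    · rintro ⟨h, rfl⟩
      exact ⟨y, (mem_retr _ _).2 rfl, (mem_idem (C := C.restrict V) _ _).2 ⟨h, rfl⟩⟩
  have h₂ : ∀ e (y : V), y ∈ (C.idem (Subtype.val '' W) ≫ C.retr V).base.pfun e ↔
      y ∈ W ∧ y.1 = e := by
    intro e y
    refine (mem_comp_base (C.idem (Subtype.val '' W)) (C.retr V) e y).trans ⟨?_, ?_⟩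
    · rintro ⟨z, hz, hy⟩
      obtain ⟨⟨w, hw, rfl⟩, rfl⟩ := (mem_idem _ _).1 hz
      have := (mem_retr _ _).1 hy
      exact ⟨(Subtype.ext this : y = w) ▸ hw, this⟩
    · rintro ⟨h, rfl⟩
      exact ⟨y.1, (mem_idem _ _).2 ⟨⟨y, h, rfl⟩, rfl⟩, (mem_retr _ _).2 rfl⟩
  refine eq_iff_agree.2 fun e => ⟨fun y => (h₁ e y).trans (h₂ e y).symm, fun y hy hy' => ?_⟩
  obtain ⟨h, rfl⟩ := (h₁ e y).1 hy
  refine (comp_app (C.retr V) ((C.restrict V).idem W) y.1 y y ((mem_retr _ _).2 rfl)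
    ((mem_idem (C := C.restrict V) _ _).2 ⟨h, rfl⟩) hy).trans (Eq.trans ?_
    (comp_app (C.idem (Subtype.val '' W)) (C.retr V) y.1 y.1 y
      ((mem_idem _ _).2 ⟨⟨y, h, rfl⟩, rfl⟩) ((mem_retr _ _).2 rfl) hy').symm)
  exact congrArg₂ (· ≫ ·) rfl (idem_app (C := C.restrict V) y _) |>.trans
    (congrArg₂ (· ≫ ·) (idem_app y.1 _) rfl).symm

/-! ### The action of the automorphisms on the indices -/

theorem exists_mem_base (g : Aut C) (e : C.idx) : ∃ y, y ∈ g.hom.base.pfun e := by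
  obtain ⟨z, hz, _⟩ := (mem_comp_base g.hom g.inv e e).1
    (by rw [g.hom_inv_id]; exact (mem_id_base e e).2 rfl)
  exact ⟨z, hz⟩

/-- The image of an index under an automorphism. -/
noncomputable def actFun (g : Aut C) (e : C.idx) : C.idx := (exists_mem_base g e).choose

theorem mem_aut_iff (g : Aut C) (e y : C.idx) : y ∈ g.hom.base.pfun e ↔ y = actFun g e := by
  have h := (exists_mem_base g e).choose_spec
  constructor
  · exact fun hy => Part.mem_unique hy h
  · rintro rfl
    exact h

theorem actFun_mul (g h : Aut C) (e : C.idx) : actFun (g * h) e = actFun g (actFun h e) := by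
  refine ((mem_aut_iff (g * h) e _).1 ?_).symm
  exact (mem_comp_base h.hom g.hom _ _).2
    ⟨actFun h e, (mem_aut_iff _ _ _).2 rfl, (mem_aut_iff _ _ _).2 rfl⟩

theorem actFun_one (e : C.idx) : actFun (1 : Aut C) e = e :=
  ((mem_aut_iff 1 e e).1 ((mem_id_base e e).2 rfl)).symm

/-- The action of the automorphisms of a family on its index set. -/
noncomputable def act (C : Wreath 𝒞 Λ) : Aut C →* Equiv.Perm C.idx where
  toFun g :=
    { toFun := actFun g
      invFun := actFun g⁻¹
      left_inv := fun e => by rw [← actFun_mul, inv_mul_cancel, actFun_one]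
      right_inv := fun e => by rw [← actFun_mul, mul_inv_cancel, actFun_one] }
  map_one' := Equiv.ext actFun_one
  map_mul' g h := Equiv.ext (actFun_mul g h)

theorem mem_base_iff (g : Aut C) (e y : C.idx) : y ∈ g.hom.base.pfun e ↔ y = act C g e :=
  mem_aut_iff g e y

theorem idem_comp_aut (g : Aut C) (U : Set C.idx) :
    C.idem U ≫ g.hom = g.hom ≫ C.idem (act C g '' U) := by
  have h₁ : ∀ e y, y ∈ (C.idem U ≫ g.hom).base.pfun e ↔ e ∈ U ∧ y = act C g e := by
    intro e y
    rw [mem_comp_base]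
    constructor
    · rintro ⟨z, hz, hy⟩
      obtain ⟨h, rfl⟩ := (mem_idem _ _).1 hz
      exact ⟨h, (mem_base_iff _ _ _).1 hy⟩
    · rintro ⟨h, rfl⟩
      exact ⟨e, (mem_idem _ _).2 ⟨h, rfl⟩, (mem_base_iff _ _ _).2 rfl⟩
  have h₂ : ∀ e y, y ∈ (g.hom ≫ C.idem (act C g '' U)).base.pfun e ↔ e ∈ U ∧ y = act C g e := by
    intro e y
    rw [mem_comp_base]
    constructor
    · rintro ⟨z, hz, hy⟩
      obtain rfl := (mem_base_iff _ _ _).1 hz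
      obtain ⟨h, rfl⟩ := (mem_idem _ _).1 hy
      exact ⟨(act C g).injective.mem_set_image.1 h, rfl⟩
    · rintro ⟨h, rfl⟩
      exact ⟨act C g e, (mem_base_iff _ _ _).2 rfl,
        (mem_idem _ _).2 ⟨Set.mem_image_of_mem _ h, rfl⟩⟩
  refine eq_iff_agree.2 fun e => ⟨fun y => (h₁ e y).trans (h₂ e y).symm, fun y hy hy' => ?_⟩
  obtain ⟨h, rfl⟩ := (h₁ e y).1 hy
  rw [comp_app (C.idem U) g.hom e e _ ((mem_idem _ _).2 ⟨h, rfl⟩) ((mem_base_iff _ _ _).2 rfl),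
    comp_app g.hom (C.idem (act C g '' U)) e (act C g e) _ ((mem_base_iff _ _ _).2 rfl)
      ((mem_idem _ _).2 ⟨Set.mem_image_of_mem _ h, rfl⟩), idem_app, idem_app,
    Category.id_comp, Category.comp_id]

/-! ### Pointwise stabilizers -/

/-- The automorphisms of `C` that are the identity on `ρ_U(C)`. -/
def fixer (U : Set C.idx) : Subgroup (Aut C) where
  carrier := {g | C.incl U ≫ g.hom = C.incl U}
  one_mem' := Category.comp_id _
  mul_mem' {g h} hg hh := by
    change C.incl U ≫ h.hom ≫ g.hom = _
    rw [← Category.assoc, show C.incl U ≫ h.hom = _ from hh, show C.incl U ≫ g.hom = _ from hg]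
  inv_mem' {g} hg := by
    change C.incl U ≫ g.inv = _
    conv_lhs => rw [← show C.incl U ≫ g.hom = _ from hg]
    rw [Category.assoc, g.hom_inv_id, Category.comp_id]

theorem mem_fixer {U : Set C.idx} {g : Aut C} : g ∈ fixer U ↔ C.incl U ≫ g.hom = C.incl U :=
  Iff.rfl

theorem mem_fixer_iff {U : Set C.idx} {g : Aut C} :
    g ∈ fixer U ↔ ∀ e ∈ U, Agree g.hom (𝟙 C) e := by
  rw [mem_fixer, ← incl_comp_eq_iff, Category.comp_id]

theorem act_of_mem_fixer {U : Set C.idx} {g : Aut C} (hg : g ∈ fixer U) {e : C.idx} (he : e ∈ U) :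
    act C g e = e :=
  ((mem_base_iff g e e).1 (((mem_fixer_iff.1 hg e he).1 e).2 ((mem_id_base e e).2 rfl))).symm

theorem image_of_mem_fixer {U : Set C.idx} {g : Aut C} (hg : g ∈ fixer U) : act C g '' U = U := by
  conv_rhs => rw [← Set.image_id U]
  exact Set.image_congr fun e he => act_of_mem_fixer hg he

theorem fixer_anti {U V : Set C.idx} (h : U ⊆ V) : fixer V ≤ fixer U := fun _ hg =>
  mem_fixer_iff.2 fun e he => mem_fixer_iff.1 hg e (h he)

theorem fixer_conj {U : Set C.idx} {g h : Aut C} (hg : g ∈ fixer (act C h '' U)) :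
    h⁻¹ * g * h ∈ fixer U := by
  have key : C.incl U ≫ h.hom =
      C.incl U ≫ h.hom ≫ C.retr (act C h '' U) ≫ C.incl (act C h '' U) := by
    conv_lhs => rw [← incl_comp_idem, Category.assoc, idem_comp_aut]
    rfl
  change C.incl U ≫ h.hom ≫ g.hom ≫ h.inv = C.incl U
  rw [← Category.assoc, key]
  simp only [Category.assoc]
  rw [← Category.assoc (C.incl (act C h '' U)) g.hom h.inv, mem_fixer.1 hg]
  simp only [← Category.assoc] at key ⊢
  rw [← key, Category.assoc, h.hom_inv_id, Category.comp_id]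

/-! ### Extension of automorphisms by the identity -/

theorem extendAut_mem_fixer (M : Set C.idx) (g : Aut (C.restrict M)) :
    extendAut C M g ∈ fixer Mᶜ := by
  refine mem_fixer_iff.2 fun e he => ?_
  have hmem : ∀ y, y ∈ (extendAut C M g).hom.base.pfun e ↔ y = e := fun y =>
    mem_extendPFun_of_notMem he
  refine ⟨fun y => (hmem y).trans (mem_id_base _ _).symm, fun y hy hy' => ?_⟩
  obtain rfl := (hmem y).1 hy
  exact extendHom_app_of_notMem C M g.hom (theta_base _ g) _ _ he rfl hy

theorem extendAut_injective (M : Set C.idx) : Function.Injective (extendAut C M) := by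
  intro g h hgh
  have h1 := incl_extendAut C M g
  rw [hgh, ← incl_extendAut C M h] at h1
  refine Iso.ext ?_
  have := congrArg (· ≫ C.retr M) h1
  simpa only [Category.assoc, incl_comp_retr, Category.comp_id] using this

theorem extendAut_image (M : Set C.idx) (g : Aut (C.restrict M)) :
    act C (extendAut C M g) '' M = M := by
  have h : act C (extendAut C M g) '' Mᶜ = Mᶜ := image_of_mem_fixer (extendAut_mem_fixer M g)
  rw [Set.image_compl_eq (act C (extendAut C M g)).bijective] at h
  exact compl_injective h

/-- An automorphism of `C` that is the identity outside `M` comes from `ρ_M(C)`. -/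
theorem exists_extendAut (M : Set C.idx) {g : Aut C} (hg : g ∈ fixer Mᶜ) :
    ∃ g', extendAut C M g' = g := by
  have key : ∀ g : Aut C, g ∈ fixer Mᶜ → C.incl M ≫ g.hom ≫ C.idem M = C.incl M ≫ g.hom := by
    intro g hg
    have h : act C g '' M = M := by
      have := image_of_mem_fixer hg
      rw [Set.image_compl_eq (act C g).bijective] at this
      exact compl_injective this
    have h' := idem_comp_aut g M
    rw [h] at h'
    rw [← h', ← Category.assoc, incl_comp_idem]
  have key' : ∀ g : Aut C, g ∈ fixer Mᶜ →
      (C.incl M ≫ g.hom ≫ C.retr M) ≫ C.incl M ≫ g.inv ≫ C.retr M = 𝟙 _ := by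
    intro g hg
    have := key g hg
    simp only [idem] at this
    simp only [Category.assoc]
    rw [← Category.assoc (C.retr M), ← Category.assoc g.hom, ← Category.assoc (C.incl M), this,
      Category.assoc, ← Category.assoc g.hom, g.hom_inv_id, Category.id_comp, incl_comp_retr]
  let g' : Aut (C.restrict M) :=
    { hom := C.incl M ≫ g.hom ≫ C.retr M
      inv := C.incl M ≫ g.inv ≫ C.retr M
      hom_inv_id := key' g hg
      inv_hom_id := key' g⁻¹ (inv_mem hg) }
  refine ⟨g', Iso.ext (eq_iff_agree.2 fun e => ?_)⟩
  by_cases he : e ∈ M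
  · refine incl_comp_eq_iff.1 ?_ e he
    rw [← incl_extendAut]
    have := key g hg
    simp only [idem] at this
    change (C.incl M ≫ g.hom ≫ C.retr M) ≫ C.incl M = _
    simp only [Category.assoc]
    exact this
  · exact (mem_fixer_iff.1 (extendAut_mem_fixer M g') e he).trans (mem_fixer_iff.1 hg e he).symm

end Wreath

/-! ### Extension of partial automorphisms -/

namespace Wreath

variable {𝒞 : Type u} [Category.{v} 𝒞] {Λ : MorphismProperty FinPart} [ContainsTheta Λ]
  {C : Wreath 𝒞 Λ}

/-- The automorphism of `C` given by a permutation `σ` of its index set and isomorphisms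
`C_e ≅ C_{σ e}`. -/
noncomputable def permAut (σ : Equiv.Perm C.idx) (γ : ∀ e, C.fam e ≅ C.fam (σ e)) : Aut C where
  hom :=
    { base := ⟨fun e => Part.some (σ e)⟩
      mem := ContainsTheta.theta_le _ fun e e' y h h' =>
        σ.injective ((Part.mem_some_iff.1 h).symm.trans (Part.mem_some_iff.1 h'))
      app := fun e y hy => (γ e).hom ≫ eqToHom (congrArg C.fam (Part.mem_some_iff.1 hy).symm) }
  inv :=
    { base := ⟨fun e => Part.some (σ.symm e)⟩
      mem := ContainsTheta.theta_le _ fun e e' y h h' =>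
        σ.symm.injective ((Part.mem_some_iff.1 h).symm.trans (Part.mem_some_iff.1 h'))
      app := fun e y hy => eqToHom (congrArg C.fam
        ((σ.eq_symm_apply).1 (Part.mem_some_iff.1 hy)).symm) ≫ (γ y).inv }
  hom_inv_id := by
    refine eq_iff_agree.2 fun e => ⟨fun y => ?_, fun y hy hy' => ?_⟩
    · refine ((mem_comp_base _ _ _ _).trans ⟨?_, ?_⟩).trans (mem_id_base _ _).symm
      · rintro ⟨z, hz, hy⟩
        rw [Part.mem_some_iff.1 hy, Part.mem_some_iff.1 hz, σ.symm_apply_apply]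
      · rintro rfl
        exact ⟨σ y, Part.mem_some_iff.2 rfl, Part.mem_some_iff.2 (σ.symm_apply_apply y).symm⟩
    · obtain rfl := (mem_id_base _ _).1 hy'
      refine (comp_app _ _ y (σ y) y (Part.mem_some_iff.2 rfl)
        (Part.mem_some_iff.2 (σ.symm_apply_apply y).symm) hy).trans ?_
      rw [id_app]
      simp
  inv_hom_id := by
    refine eq_iff_agree.2 fun e => ⟨fun y => ?_, fun y hy hy' => ?_⟩
    · refine ((mem_comp_base _ _ _ _).trans ⟨?_, ?_⟩).trans (mem_id_base _ _).symm
      · rintro ⟨z, hz, hy⟩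
        rw [Part.mem_some_iff.1 hy, Part.mem_some_iff.1 hz, σ.apply_symm_apply]
      · rintro rfl
        exact ⟨σ.symm y, Part.mem_some_iff.2 rfl, Part.mem_some_iff.2 (σ.apply_symm_apply y).symm⟩
    · obtain rfl := (mem_id_base _ _).1 hy'
      refine (comp_app _ _ y (σ.symm y) y (Part.mem_some_iff.2 rfl)
        (Part.mem_some_iff.2 (σ.apply_symm_apply y).symm) hy).trans ?_
      rw [id_app]
      simp

theorem mem_inv_base {h : Aut C} {u w : C.idx} (hw : w ∈ h.hom.base.pfun u) :
    u ∈ h.inv.base.pfun w := by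
  obtain rfl := (mem_base_iff h u w).1 hw
  refine (mem_base_iff h⁻¹ _ _).2 ?_
  rw [map_inv]
  exact ((act C h).symm_apply_apply u).symm

/-- The components of an automorphism are isomorphisms. -/
def appIso (h : Aut C) {u w : C.idx} (hw : w ∈ h.hom.base.pfun u) : C.fam u ≅ C.fam w where
  hom := h.hom.app u w hw
  inv := h.inv.app w u (mem_inv_base hw)
  hom_inv_id := by
    have h1 := (mem_comp_base h.hom h.inv u u).2 ⟨w, hw, mem_inv_base hw⟩
    rw [← comp_app h.hom h.inv u w u hw (mem_inv_base hw) h1]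
    exact (eq_iff_agree.1 h.hom_inv_id u).2 u h1 ((mem_id_base _ _).2 rfl)
  inv_hom_id := by
    have h1 := (mem_comp_base h.inv h.hom w w).2 ⟨u, mem_inv_base hw, hw⟩
    rw [← comp_app h.inv h.hom w u w (mem_inv_base hw) hw h1]
    exact (eq_iff_agree.1 h.inv_hom_id w).2 w h1 ((mem_id_base _ _).2 rfl)

/-- For an automorphism `h` of `C`, there is an automorphism that agrees with `h` at the index `u`
and is the identity away from `u` and its image. -/
theorem exists_swap (h : Aut C) (u : C.idx) : ∃ s : Aut C, Agree s.hom h.hom u ∧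
    ∀ e, e ≠ u → e ≠ act C h u → Agree s.hom (𝟙 C) e := by
  classical
  obtain ⟨w, hw⟩ := exists_mem_base h u
  obtain rfl := (mem_base_iff h u w).1 hw
  set w := act C h u with hw_def
  have hγ : ∀ e, ∃ γ : C.fam e ≅ C.fam (Equiv.swap u w e),
      (∀ he : e = u, γ.hom = eqToHom (by rw [he]) ≫ (appIso h hw).hom ≫
        eqToHom (by rw [he, Equiv.swap_apply_left])) ∧
      ∀ (h₁ : e ≠ u) (h₂ : e ≠ w),
        γ.hom = eqToHom (by rw [Equiv.swap_apply_of_ne_of_ne h₁ h₂]) := by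
    intro e
    by_cases he : e = u
    · exact ⟨eqToIso (by rw [he]) ≪≫ appIso h hw ≪≫
        eqToIso (by rw [he, Equiv.swap_apply_left]), fun _ => rfl, fun h => absurd he h⟩
    · by_cases he' : e = w
      · exact ⟨eqToIso (by rw [he']) ≪≫ (appIso h hw).symm ≪≫
          eqToIso (by rw [he', Equiv.swap_apply_right]), fun h => absurd h he,
          fun _ h => absurd he' h⟩
      · exact ⟨eqToIso (by rw [Equiv.swap_apply_of_ne_of_ne he he']), fun h => absurd h he,
          fun _ _ => rfl⟩
  choose γ hγ₁ hγ₂ using hγ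
  refine ⟨permAut (Equiv.swap u w) γ, ⟨fun y => ?_, fun y hy hy' => ?_⟩, fun e he he' =>
    ⟨fun y => ?_, fun y hy hy' => ?_⟩⟩
  · refine Part.mem_some_iff.trans ?_
    rw [Equiv.swap_apply_left, mem_base_iff]
  · obtain rfl : y = w := (mem_base_iff h u y).1 hy'
    change (γ u).hom ≫ eqToHom _ = _
    rw [hγ₁ u rfl]
    simp [appIso]
  · refine Part.mem_some_iff.trans ?_
    rw [Equiv.swap_apply_of_ne_of_ne he he', mem_id_base]
  · obtain rfl := (mem_id_base _ _).1 hy'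
    change (γ y).hom ≫ eqToHom _ = _
    rw [hγ₂ y he he', eqToHom_trans]
    rfl

/-- An automorphism of `C` that maps `U ⊆ M` into `M` agrees on `U` with an automorphism of
`ρ_M(C)`. By induction on `U`: once the automorphism has been corrected so that it is the identity on
all of `U` but one element, the remaining element is moved to its place inside `M` by a
transposition. -/
theorem exists_extendAut_mul_mem_fixer (M U : Set C.idx) (hU : U ⊆ M) (g : Aut C)
    (hg : act C g '' U ⊆ M) : ∃ g', g⁻¹ * extendAut C M g' ∈ fixer U := by
  induction U, U.toFinite using Set.Finite.induction_on with
  | empty => exact ⟨1, mem_fixer_iff.2 fun e he => he.elim⟩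
  | @insert u U hu _ ih =>
    obtain ⟨g₀, hg₀⟩ := ih ((Set.subset_insert u U).trans hU)
      ((Set.image_mono (Set.subset_insert u U)).trans hg)
    set h : Aut C := (extendAut C M g₀)⁻¹ * g with h_def
    have hh : h⁻¹ ∈ fixer U := by rw [h_def, mul_inv_rev, inv_inv]; exact hg₀
    have hh' : h ∈ fixer U := by rw [← inv_inv h]; exact inv_mem hh
    have hw : act C h u ∈ M := by
      have h1 : act C g u ∈ M := hg (Set.mem_image_of_mem _ (Set.mem_insert u U))
      have h2 := (extendAut_image M g₀⁻¹).le (Set.mem_image_of_mem _ h1)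
      rwa [map_inv, ← Equiv.Perm.mul_apply, ← map_mul] at h2
    obtain ⟨s, hs, hs'⟩ := exists_swap h u
    have hsM : s ∈ fixer Mᶜ := mem_fixer_iff.2 fun e he =>
      hs' e (fun h => he (h ▸ hU (Set.mem_insert u U))) fun h => he (h ▸ hw)
    obtain ⟨s', hs''⟩ := exists_extendAut M hsM
    refine ⟨g₀ * s', ?_⟩
    have : g⁻¹ * extendAut C M (g₀ * s') = h⁻¹ * s := by
      rw [map_mul, hs'', h_def]; group
    rw [this]
    refine mem_fixer_iff.2 fun e he => ?_
    rcases Set.mem_insert_iff.1 he with rfl | he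
    · have := hs.comp fun y _ => Agree.refl h.inv y
      rwa [h.hom_inv_id] at this
    · have h1 : Agree s.hom (𝟙 C) e := by
        refine hs' e (fun h => hu (h ▸ he)) fun h3 => hu ?_
        have := act_of_mem_fixer hh' he
        rw [h3] at this
        exact (act C h).injective this ▸ h3 ▸ he
      have h2 := h1.comp (g := h.inv) (g' := 𝟙 C) fun y hy => by
        obtain rfl := (mem_id_base _ _).1 ((h1.1 y).1 hy)
        exact mem_fixer_iff.1 hh y he
      rwa [Category.comp_id] at h2

/-- The pointwise stabilizers of the non-empty subsets of `M` of bounded cardinality. -/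
theorem stabData (M : Set C.idx) (n : ℕ) : StabData (act C) fixer (extendAut C M) M
    {U | U ⊆ M ∧ U.Nonempty ∧ U.ncard ≤ n} where
  image_eq _ _ hg := image_of_mem_fixer hg
  anti _ _ h := fixer_anti h
  conj _ _ _ hg := fixer_conj hg
  map g := extendAut_image M g
  sub _ hU := hU.1
  ext U hU g hg := exists_extendAut_mul_mem_fixer M U hU.1 g hg

end Wreath

/-! ### Polynomial functors and graded representations -/

theorem isIso_homologyMap_iff (n : ℕ) {G H : Type v} [Group G] [Group H] (f : G →* H) :
    IsIso (homologyMap n f) ↔ Function.Bijective ((trivial_equivar (ULift.{v} ℤ) f).H n) :=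
  ConcreteCategory.isIso_iff_bijective (homologyMap n f)

theorem epi_homologyMap_iff (n : ℕ) {G H : Type v} [Group G] [Group H] (f : G →* H) :
    Epi (homologyMap n f) ↔ Function.Surjective ((trivial_equivar (ULift.{v} ℤ) f).H n) :=
  AddCommGrpCat.epi_iff_surjective (homologyMap n f)

namespace Wreath

variable {𝒞 : Type u} [Category.{v} 𝒞] {Λ : MorphismProperty FinPart} [ContainsTheta Λ]
  (κ : Wreath 𝒞 Λ ⥤ GrpCat.{v}) {X Y Z : Wreath 𝒞 Λ}

/-- The map induced on `H_q(κ(-))` by a morphism of `𝒞 ≀ Λ`, as a linear map. -/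
noncomputable def coeffMap (q : ℕ) (f : X ⟶ Y) :
    HG (Representation.trivial (ULift.{v} ℤ) (κ.obj X) (ULift.{v} ℤ)) q →ₗ[ULift.{v} ℤ]
      HG (Representation.trivial (ULift.{v} ℤ) (κ.obj Y) (ULift.{v} ℤ)) q :=
  (trivial_equivar _ (κ.map f).hom).H q

theorem coeffMap_comp (q : ℕ) (f : X ⟶ Y) (g : Y ⟶ Z) (x) :
    coeffMap κ q (f ≫ g) x = coeffMap κ q g (coeffMap κ q f x) :=
  Equivar.H_comp _ _ _ (fun x => congr(($(κ.map_comp f g)).hom x)) (fun _ => rfl) q x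

theorem coeffMap_id (q : ℕ) (x) : coeffMap κ q (𝟙 X) x = x :=
  Equivar.H_id _ (fun x => congr(($(κ.map_id X)).hom x)) (fun _ => rfl) q x

variable {C : Wreath 𝒞 Λ}

theorem kerRep_eq (q : ℕ) (g : Aut C) (x) :
    kerRep (ULift.{v} ℤ) (autAction κ C) q g x = coeffMap κ q g.hom x := rfl

/-- The homology of `κ(C)` in a degree in which it is polynomial is graded by the subsets of the
index set of `C`: a non-zero homogeneous element of degree `V` restricts to a non-zero element of
the cross effect at `ρ_V(C)`. -/
theorem coeff_graded {q n : ℕ} (hpoly : IsPolynomialOfDegreeLE (κ ⋙ intHomology.{v} q) n)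
    {M : Set C.idx} (hV : ∀ U : Set C.idx, U.ncard ≤ n → MemOrbits C M U) :
    Graded (act C) fixer {U | U ⊆ M ∧ U.Nonempty ∧ U.ncard ≤ n}
      (kerRep (ULift.{v} ℤ) (autAction κ C) q) (fun U => coeffMap κ q (C.idem U)) where
  inter U V x := by rw [← coeffMap_comp, idem_comp_idem]
  univ x := by rw [idem_univ, coeffMap_id]
  equivar g U x := by
    rw [kerRep_eq, kerRep_eq, ← coeffMap_comp, ← coeffMap_comp, idem_comp_aut]
  fixed U g hg x := by
    rw [kerRep_eq, ← coeffMap_comp, show C.idem U ≫ g.hom = C.idem U from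
      (Category.assoc _ _ _).trans (congrArg (C.retr U ≫ ·) hg)]
  degree V x hx h0 := by
    set y := coeffMap κ q (C.retr V) x with hy_def
    have hy : y ≠ 0 := fun h => h0
      ((hx.1.symm.trans (coeffMap_comp κ q (C.retr V) (C.incl V) x)).trans
        (by rw [← hy_def, h, map_zero]))
    -- `x` is killed by the `d_{C,W}` with `V ⊄ W`, so `y` is killed by the `d` of proper subsets
    have hcr : y ∈ crossEffect (κ ⋙ intHomology.{v} q) (C.restrict V) := by
      refine ⟨?_, ?_⟩
      · refine (AddSubgroup.mem_iInf).2 fun W => ?_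
        change coeffMap κ q ((C.restrict V).idem W.1) y = 0
        rw [hy_def, ← coeffMap_comp]
        refine (congrArg (fun f => coeffMap κ q f x) (retr_comp_idem V W.1)).trans ?_
        rw [coeffMap_comp, hx.2, map_zero]
        intro h
        refine W.2.2 fun e _ => ?_
        obtain ⟨e', he', h'⟩ := h e.2
        exact (Subtype.ext h' : e' = e) ▸ he'
      · refine ⟨y, ?_⟩
        change coeffMap κ q ((C.restrict V).idem Set.univ) y = y
        rw [idem_univ, coeffMap_id]
    have hcard : V.ncard ≤ n := by
      by_contra h
      have := hpoly.2 (C.restrict V) (not_le.1 h)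
      rw [this] at hcr
      exact hy hcr
    -- the degree is not empty because the functor vanishes on the empty family
    have hne : V.Nonempty := by
      rw [Set.nonempty_iff_ne_empty]
      rintro rfl
      have := hpoly.1
      let a : C.restrict ∅ ⟶ empty 𝒞 Λ :=
        { base := ⟨fun e => e.2.elim⟩
          mem := ContainsTheta.theta_le _ fun e => e.2.elim
          app := fun e => e.2.elim }
      let b : empty 𝒞 Λ ⟶ C.restrict ∅ :=
        { base := ⟨fun e => Empty.elim e⟩
          mem := ContainsTheta.theta_le _ fun e => Empty.elim e
          app := fun e => Empty.elim e }
      have hab : a ≫ b = 𝟙 _ := eq_iff_agree.2 fun e => e.2.elim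
      have h1 : coeffMap κ q a y = 0 :=
        Subsingleton.elim (α := (κ ⋙ intHomology.{v} q).obj (empty 𝒞 Λ)) _ _
      apply hy
      rw [← coeffMap_id κ q y, ← hab, coeffMap_comp, h1, map_zero]
    obtain ⟨g, U, hUM, hgU⟩ := hV V hcard
    have himg : act C g '' U = V := by
      rw [← hgU]
      ext y
      simp only [mem_base_iff, Set.mem_image, Set.mem_ofPred_eq, eq_comm]
    refine ⟨U, ⟨hUM, ?_, ?_⟩, g, himg⟩
    · rw [← himg] at hne
      exact Set.image_nonempty.1 hne
    · rwa [← himg, Set.ncard_image_of_injective _ (act C g).injective] at hcard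

theorem map_incl_autAction (M : Set C.idx) (g : Aut (C.restrict M)) (x : κ.obj (C.restrict M)) :
    (κ.map (C.incl M)).hom (autAction κ (C.restrict M) g x) =
      autAction κ C (extendAut C M g) ((κ.map (C.incl M)).hom x) := by
  have h : κ.map g.hom ≫ κ.map (C.incl M) = κ.map (C.incl M) ≫ κ.map (extendAut C M g).hom := by
    rw [← κ.map_comp, incl_extendAut, κ.map_comp]
  exact congr(($h).hom x)

/-- Comparison of the homology of `G_A` and `G_C` with coefficients in a polynomial homology
functor: the homology of `κ(A)` is the part of the homology of `κ(C)` of degree contained in `A`. -/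
theorem coeff_compare {q n : ℕ} (hpoly : IsPolynomialOfDegreeLE (κ ⋙ intHomology.{v} q) n)
    {M : Set C.idx} (hV : ∀ U : Set C.idx, U.ncard ≤ n → MemOrbits C M U) {a b : ℕ} (hba : b ≤ a)
    (hab : a ≤ b + 1)
    (hs : ∀ U : Set C.idx, U ⊆ M → U.Nonempty → U.ncard ≤ n → ∀ l, l < a → Function.Surjective
      ((trivial_equivar (ULift.{v} ℤ) ((extendAut C M).subgroupComap (fixer U))).H l))
    (hi : ∀ U : Set C.idx, U ⊆ M → U.Nonempty → U.ncard ≤ n → ∀ l, l < b → Function.Injective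
      ((trivial_equivar (ULift.{v} ℤ) ((extendAut C M).subgroupComap (fixer U))).H l))
    (p : ℕ) :
    (p < a → Function.Surjective
      ((kerRep_equivar (ULift.{v} ℤ) (map_incl_autAction κ M) q).H p)) ∧
    (p < b → Function.Injective
      ((kerRep_equivar (ULift.{v} ℤ) (map_incl_autAction κ M) q).H p)) := by
  refine graded_compare_of_range (stabData M n) hba hab
    (fun U hU => hs U hU.1 hU.2.1 hU.2.2) (fun U hU => hi U hU.1 hU.2.1 hU.2.2) p
    (coeff_graded κ hpoly hV) (kerRep_equivar (ULift.{v} ℤ) (map_incl_autAction κ M) q) ?_ ?_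
  · intro x y h
    have h := congrArg (coeffMap κ q (C.retr M)) h
    change coeffMap κ q (C.retr M) (coeffMap κ q (C.incl M) x) =
      coeffMap κ q (C.retr M) (coeffMap κ q (C.incl M) y) at h
    rwa [← coeffMap_comp, ← coeffMap_comp, incl_comp_retr, coeffMap_id, coeffMap_id] at h
  · refine le_antisymm ?_ ?_
    · rintro _ ⟨x, rfl⟩
      refine ⟨coeffMap κ q (C.incl M) x, ?_⟩
      rw [← coeffMap_comp, incl_comp_idem]
      rfl
    · rintro _ ⟨x, rfl⟩
      exact ⟨coeffMap κ q (C.retr M) x, (coeffMap_comp κ q _ _ x).symm⟩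

end Wreath

/-! ### Identification of the stabilizers -/

section Trivial

variable {k : Type u} [CommRing k] {G G' H H' : Type u} [Group G] [Group G'] [Group H] [Group H']

theorem trivial_H_bijective (k : Type u) [CommRing k] {f : G →* H} (hf : Function.Bijective f)
    (n : ℕ) : Function.Bijective ((trivial_equivar k f).H n) :=
  Equivar.H_bijective_of_equiv (MulEquiv.ofBijective f hf) (LinearEquiv.refl k k)
    (trivial_equivar k f) n

theorem trivial_H_surjective_iff {f : G →* H} {f' : G' →* H'} {a : H →* H'} {a' : G →* G'}
    (ha : Function.Bijective a) (ha' : Function.Bijective a') (h : ∀ x, a (f x) = f' (a' x))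
    (n : ℕ) : Function.Surjective ((trivial_equivar k f).H n) ↔
      Function.Surjective ((trivial_equivar k f').H n) :=
  (trivial_equivar k f).H_surjective_iff_of_square (trivial_equivar k f') (trivial_equivar k a)
    (trivial_equivar k a') h (fun _ => rfl) n (trivial_H_bijective k ha n)
    (trivial_H_bijective k ha' n)

theorem trivial_H_injective_iff {f : G →* H} {f' : G' →* H'} {a : H →* H'} {a' : G →* G'}
    (ha : Function.Bijective a) (ha' : Function.Bijective a') (h : ∀ x, a (f x) = f' (a' x))
    (n : ℕ) : Function.Injective ((trivial_equivar k f).H n) ↔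
      Function.Injective ((trivial_equivar k f').H n) :=
  (trivial_equivar k f).H_injective_iff_of_square (trivial_equivar k f') (trivial_equivar k a)
    (trivial_equivar k a') h (fun _ => rfl) n (trivial_H_bijective k ha n)
    (trivial_H_bijective k ha' n)

theorem trivial_H_bijective_iff {f : G →* H} {f' : G' →* H'} {a : H →* H'} {a' : G →* G'}
    (ha : Function.Bijective a) (ha' : Function.Bijective a') (h : ∀ x, a (f x) = f' (a' x))
    (n : ℕ) : Function.Bijective ((trivial_equivar k f).H n) ↔
      Function.Bijective ((trivial_equivar k f').H n) :=
  and_congr (trivial_H_injective_iff ha ha' h n) (trivial_H_surjective_iff ha ha' h n)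

theorem trivial_H_zero_bijective (k : Type u) [CommRing k] (f : G →* H) :
    Function.Bijective ((trivial_equivar k f).H 0) :=
  H_zero_bijective_of_trivial _ Function.bijective_id

theorem exists_mulEquiv_of_map_eq_range {φ : G →* H} {β : G' →* H} {S : Subgroup G}
    (hφ : Function.Injective φ) (hβ : Function.Injective β) (h : S.map φ = β.range) :
    ∃ e : G' ≃* S, ∀ x, φ (e x) = β x := by
  refine ⟨((MonoidHom.ofInjective hβ).trans (MulEquiv.subgroupCongr h.symm)).trans
    (S.equivMapOfInjective φ hφ).symm, fun x => ?_⟩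
  rw [← S.coe_equivMapOfInjective_apply φ hφ]
  simp only [MulEquiv.trans_apply, MulEquiv.apply_symm_apply]
  rfl

theorem bijective_subtype_of_eq_top {S : Subgroup G} (h : S = ⊤) :
    Function.Bijective S.subtype :=
  ⟨S.subtype_injective, fun x => ⟨⟨x, h ▸ Subgroup.mem_top x⟩, rfl⟩⟩

theorem trivial_H_subgroupComap_surjective_iff (f : G →* H) {S : Subgroup H} (h : S = ⊤) (n : ℕ) :
    Function.Surjective ((trivial_equivar k (f.subgroupComap S)).H n) ↔
      Function.Surjective ((trivial_equivar k f).H n) :=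
  trivial_H_surjective_iff (a := S.subtype) (a' := (S.comap f).subtype)
    (bijective_subtype_of_eq_top h)
    (bijective_subtype_of_eq_top (by rw [h, Subgroup.comap_top])) (fun _ => rfl) n

theorem trivial_H_subgroupComap_bijective_iff (f : G →* H) {S : Subgroup H} (h : S = ⊤) (n : ℕ) :
    Function.Bijective ((trivial_equivar k (f.subgroupComap S)).H n) ↔
      Function.Bijective ((trivial_equivar k f).H n) :=
  trivial_H_bijective_iff (a := S.subtype) (a' := (S.comap f).subtype)
    (bijective_subtype_of_eq_top h)
    (bijective_subtype_of_eq_top (by rw [h, Subgroup.comap_top])) (fun _ => rfl) n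

end Trivial

namespace Wreath

variable {𝒞 : Type u} [Category.{v} 𝒞] {Λ : MorphismProperty FinPart} [ContainsTheta Λ]
  {C : Wreath 𝒞 Λ}

theorem extendAut_mem_fixer_image_iff (N : Set C.idx) (W : Set N) (g : Aut (C.restrict N)) :
    extendAut C N g ∈ fixer (Subtype.val '' W) ↔ g ∈ fixer (C := C.restrict N) W := by
  have h1 : extendAut C N g ∈ fixer (Subtype.val '' W) ↔
      (C.restrict N).incl W ≫ C.incl N ≫ (extendAut C N g).hom =
        (C.restrict N).incl W ≫ C.incl N ≫ 𝟙 C := by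
    refine mem_fixer_iff.trans (Iff.trans ?_ (incl_comp_eq_iff (C := C.restrict N)).symm)
    exact ⟨fun h e he => (agree_incl_comp_iff e).2 (h e.1 ⟨e, he, rfl⟩),
      by rintro h _ ⟨e, he, rfl⟩; exact (agree_incl_comp_iff e).1 (h e he)⟩
  refine h1.trans (Iff.trans ?_ (mem_fixer (C := C.restrict N)).symm)
  rw [← incl_extendAut, Category.comp_id]
  constructor
  · intro h
    have := congrArg (· ≫ C.retr N) h
    simpa only [Category.assoc, incl_comp_retr, Category.comp_id] using this
  · intro h
    rw [← Category.assoc, h]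

theorem mem_range_extendAut_iff (N : Set C.idx) (g : Aut C) :
    g ∈ (extendAut C N).range ↔ g ∈ fixer Nᶜ :=
  ⟨by rintro ⟨x, rfl⟩; exact extendAut_mem_fixer N x, fun h => exists_extendAut N h⟩

theorem mem_range_extendAut_comp_iff (N : Set C.idx) (W : Set N) (g : Aut C) :
    g ∈ ((extendAut C N).comp (extendAut (C.restrict N) W)).range ↔
      g ∈ fixer Nᶜ ∧ g ∈ fixer (Subtype.val '' Wᶜ) := by
  constructor
  · rintro ⟨x, rfl⟩
    exact ⟨extendAut_mem_fixer N _, (extendAut_mem_fixer_image_iff N Wᶜ _).2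
      (extendAut_mem_fixer (C := C.restrict N) W x)⟩
  · rintro ⟨h, h'⟩
    obtain ⟨y, rfl⟩ := exists_extendAut N h
    obtain ⟨z, rfl⟩ := exists_extendAut (C := C.restrict N) W
      ((extendAut_mem_fixer_image_iff N Wᶜ y).1 h')
    exact ⟨z, rfl⟩

/-- The automorphisms of `C - ρ_U(C)` are the automorphisms of `C` that fix `ρ_U(C)`, and those of
`A - ρ_U(C)` are the automorphisms of `A` that fix it. -/
theorem exists_stabilizer_equiv (M U : Set C.idx) (hU : U ⊆ M) :
    ∃ (a : Aut (C.restrict Uᶜ) →* fixer U)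
      (a' : Aut ((C.restrict Uᶜ).restrict ((Subtype.val : ↥Uᶜ → C.idx) ⁻¹' M)) →*
        (fixer U).comap (extendAut C M)), Function.Bijective a ∧ Function.Bijective a' ∧
      ∀ x, a (extendAut (C.restrict Uᶜ) ((Subtype.val : ↥Uᶜ → C.idx) ⁻¹' M) x) =
        (extendAut C M).subgroupComap (fixer U) (a' x) := by
  have himg : Subtype.val '' ((Subtype.val : ↥Uᶜ → C.idx) ⁻¹' M)ᶜ = Mᶜ := by
    ext e
    constructor
    · rintro ⟨e, he, rfl⟩
      exact he
    · exact fun he => ⟨⟨e, fun h => he (hU h)⟩, he, rfl⟩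
  have hfix : ∀ g, extendAut C Uᶜ g ∈ fixer U := fun g => by
    have := extendAut_mem_fixer Uᶜ g
    rwa [compl_compl] at this
  obtain ⟨a', ha'⟩ := exists_mulEquiv_of_map_eq_range (S := (fixer U).comap (extendAut C M))
    (β := (extendAut C Uᶜ).comp (extendAut (C.restrict Uᶜ) ((Subtype.val : ↥Uᶜ → C.idx) ⁻¹' M)))
    (extendAut_injective M)
    ((extendAut_injective Uᶜ).comp (extendAut_injective (C := C.restrict Uᶜ) _)) (by
      ext y
      rw [Subgroup.map_comap_eq, Subgroup.mem_inf, mem_range_extendAut_iff]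
      refine Iff.trans ?_ (mem_range_extendAut_comp_iff Uᶜ _ y).symm
      rw [and_comm]
      exact and_congr (by rw [compl_compl]) (Iff.of_eq (congrArg (y ∈ fixer ·) himg.symm)))
  refine ⟨(extendAut C Uᶜ).codRestrict (fixer U) hfix, a', ⟨fun x y hxy => ?_, fun y => ?_⟩,
    a'.bijective, fun x => Subtype.ext (ha' x).symm⟩
  · exact extendAut_injective Uᶜ (congrArg Subtype.val hxy)
  · obtain ⟨x, hx⟩ := exists_extendAut (M := Uᶜ) (g := y.1) (by rw [compl_compl]; exact y.2)
    exact ⟨x, Subtype.ext hx⟩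

theorem sigma_surjective_iff (M U : Set C.idx) (hU : U ⊆ M) (l : ℕ) :
    Epi (sigma C M U l) ↔ Function.Surjective
      ((trivial_equivar (ULift.{v} ℤ) ((extendAut C M).subgroupComap (fixer U))).H l) := by
  obtain ⟨a, a', ha, ha', h⟩ := exists_stabilizer_equiv M U hU
  exact (epi_homologyMap_iff l _).trans (trivial_H_surjective_iff ha ha' h l)

theorem sigma_bijective_iff (M U : Set C.idx) (hU : U ⊆ M) (l : ℕ) :
    IsIso (sigma C M U l) ↔ Function.Bijective
      ((trivial_equivar (ULift.{v} ℤ) ((extendAut C M).subgroupComap (fixer U))).H l) := by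
  obtain ⟨a, a', ha, ha', h⟩ := exists_stabilizer_equiv M U hU
  exact (isIso_homologyMap_iff l _).trans (trivial_H_bijective_iff ha ha' h l)

theorem fixer_empty : fixer (∅ : Set C.idx) = ⊤ :=
  eq_top_iff.2 fun _ _ => mem_fixer_iff.2 fun _ he => he.elim

theorem sigma_empty_surjective_iff (M : Set C.idx) (l : ℕ) : Epi (sigma C M ∅ l) ↔
    Function.Surjective ((trivial_equivar (ULift.{v} ℤ) (extendAut C M)).H l) :=
  (sigma_surjective_iff M ∅ (Set.empty_subset M) l).trans
    (trivial_H_subgroupComap_surjective_iff _ fixer_empty l)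

theorem sigma_empty_bijective_iff (M : Set C.idx) (l : ℕ) : IsIso (sigma C M ∅ l) ↔
    Function.Bijective ((trivial_equivar (ULift.{v} ℤ) (extendAut C M)).H l) :=
  (sigma_bijective_iff M ∅ (Set.empty_subset M) l).trans
    (trivial_H_subgroupComap_bijective_iff _ fixer_empty l)

end Wreath

end WreathStability

open CategoryTheory WreathStability WreathStability.Wreath in
theorem mainTheorem7 {𝒞 : Type u} [Category.{v} 𝒞]
    (Λ : MorphismProperty FinPart) [ContainsTheta Λ]
    (κ : Wreath 𝒞 Λ ⥤ GrpCat.{v}) (d : ℕ → ℕ)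
    (hpoly : ∀ q : ℕ, 1 ≤ q → IsPolynomialOfDegreeLE (κ ⋙ intHomology.{v} q) (d q))
    (C : Wreath 𝒞 Λ) (M : Set C.idx) (i : ℕ)
    -- `V_A / G_A = V_C / G_C` in cardinality at most `d q`
    (hV : ∀ q : ℕ, 1 ≤ q → q ≤ i → ∀ U : Set C.idx, U.ncard ≤ d q → MemOrbits C M U)
    (hσ : ∀ q : ℕ, 1 ≤ q → q + 1 ≤ i →
      ∀ U : Set C.idx, U ⊆ M → U.Nonempty → U.ncard ≤ d q →
        (∀ l : ℕ, l + q ≤ i → IsIso (sigma C M U l)) ∧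
        (∀ l : ℕ, l + q = i + 1 → Epi (sigma C M U l)))
    (hσ₀ : ∀ l : ℕ, l ≤ i → IsIso (sigma C M ∅ l)) :
    (∀ l : ℕ, l ≤ i → IsIso (mu κ C M l)) ∧
    ((∀ U : Set C.idx, U.ncard ≤ d (i + 1) → MemOrbits C M U) →
      Epi (sigma C M ∅ (i + 1)) →
      (1 ≤ i → ∀ U : Set C.idx, U ⊆ M → U.Nonempty → U.ncard ≤ d i → Epi (sigma C M U 1)) →
      Epi (mu κ C M (i + 1))) := by

  -- coefficients in the homology of `κ` in degree `q`, compared in the range given by `a` and `b`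
  have compare : ∀ q : ℕ, 1 ≤ q → (∀ U : Set C.idx, U.ncard ≤ d q → MemOrbits C M U) →
      ∀ a b : ℕ, b ≤ a → a ≤ b + 1 →
      (∀ U : Set C.idx, U ⊆ M → U.Nonempty → U.ncard ≤ d q → ∀ l, 1 ≤ l →
        (l < a → Epi (sigma C M U l)) ∧ (l < b → IsIso (sigma C M U l))) → ∀ p : ℕ,
      (p < a → Function.Surjective
        ((kerRep_equivar (ULift.{v} ℤ) (map_incl_autAction κ M) q).H p)) ∧
      (p < b → Function.Injective
        ((kerRep_equivar (ULift.{v} ℤ) (map_incl_autAction κ M) q).H p)) := by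
    intro q hq hVq a b hba hab h
    refine coeff_compare κ (hpoly q hq) hVq hba hab (fun U hUM hU hUd l hl => ?_)
      (fun U hUM hU hUd l hl => ?_)
    · rcases Nat.eq_zero_or_pos l with rfl | h0
      · exact (trivial_H_zero_bijective _ _).2
      · exact (sigma_surjective_iff M U hUM l).1 ((h U hUM hU hUd l h0).1 hl)
    · rcases Nat.eq_zero_or_pos l with rfl | h0
      · exact (trivial_H_zero_bijective _ _).1
      · exact ((sigma_bijective_iff M U hUM l).1 ((h U hUM hU hUd l h0).2 hl)).1
  -- below degree `i`, the hypotheses on `σ` are used in their full range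
  have low : ∀ q : ℕ, 1 ≤ q → q + 1 ≤ i → ∀ p : ℕ,
      (q + p ≤ i + 1 → Function.Surjective
        ((kerRep_equivar (ULift.{v} ℤ) (map_incl_autAction κ M) q).H p)) ∧
      (q + p ≤ i → Function.Injective
        ((kerRep_equivar (ULift.{v} ℤ) (map_incl_autAction κ M) q).H p)) := by
    intro q hq hqi p
    have := compare q hq (hV q hq (by omega)) (i - q + 2) (i - q + 1) (by omega) (by omega)
      (fun U hUM hU hUd l _ => ⟨fun hl => ?_, fun hl => (hσ q hq hqi U hUM hU hUd).1 l (by omega)⟩) p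
    · exact ⟨fun h => this.1 (by omega), fun h => this.2 (by omega)⟩
    · by_cases hl' : l + q ≤ i
      · have := (hσ q hq hqi U hUM hU hUd).1 l hl'
        infer_instance
      · exact (hσ q hq hqi U hUM hU hUd).2 l (by omega)
  -- in degree `i`, only coinvariants are needed, and `H_0` of a group does not depend on the group
  have top : 1 ≤ i → Function.Bijective
      ((kerRep_equivar (ULift.{v} ℤ) (map_incl_autAction κ M) i).H 0) := fun hi => by
    have := compare i hi (hV i hi le_rfl) 1 1 le_rfl (by omega)
      (fun U hUM hU hUd l hl => ⟨fun h => by omega, fun h => by omega⟩) 0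
    exact ⟨this.2 Nat.one_pos, this.1 Nat.one_pos⟩
  have hinj : ∀ q p : ℕ, 1 ≤ q → q + p ≤ i → Function.Injective
      ((kerRep_equivar (ULift.{v} ℤ) (map_incl_autAction κ M) q).H p) := by
    intro q p hq hqp
    by_cases hqi : q + 1 ≤ i
    · exact (low q hq hqi p).2 hqp
    · obtain rfl : q = i := by omega
      obtain rfl : p = 0 := by omega
      exact (top hq).1
  have hsurj : ∀ q p : ℕ, 1 ≤ q → (q + p ≤ i ∨ (q + p = i + 1 ∧ (2 ≤ p ∨ False))) →
      Function.Surjective ((kerRep_equivar (ULift.{v} ℤ) (map_incl_autAction κ M) q).H p) := by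
    intro q p hq hqp
    rw [or_false] at hqp
    by_cases hqi : q + 1 ≤ i
    · exact (low q hq hqi p).1 (by omega)
    · obtain rfl : q = i := by omega
      obtain rfl : p = 0 := by omega
      exact (top hq).2
  have hl : ∀ x, semidirectMap κ C M (SemidirectProduct.inl x) =
      SemidirectProduct.inl ((κ.map (C.incl M)).hom x) := SemidirectProduct.map_inl _ _ _
  have hr : ∀ g, semidirectMap κ C M (SemidirectProduct.inr g) =
      SemidirectProduct.inr (extendAut C M g) := SemidirectProduct.map_inr _ _ _
  refine ⟨fun l hl' => (isIso_homologyMap_iff l _).2 ?_, fun hV' hσ₀' hσ₁ =>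
    (epi_homologyMap_iff _ _).2 ?_⟩
  · rcases l with _ | l
    · exact trivial_H_zero_bijective _ _
    · have h0 := (sigma_empty_bijective_iff M (l + 1)).1 (hσ₀ (l + 1) hl')
      exact ⟨semidirect_injective (map_incl_autAction κ M) _ hl hr hinj hsurj l hl' h0.1,
        semidirect_surjective (map_incl_autAction κ M) _ hl hr hinj hsurj l (Or.inl hl') h0.2⟩
  · have hsurj' : ∀ q p : ℕ, 1 ≤ q → (q + p ≤ i ∨ (q + p = i + 1 ∧ (2 ≤ p ∨ True))) →
        Function.Surjective ((kerRep_equivar (ULift.{v} ℤ) (map_incl_autAction κ M) q).H p) := by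
      intro q p hq hqp
      by_cases hqi : q + 1 ≤ i
      · exact (low q hq hqi p).1 (by omega)
      · by_cases hq' : q = i
        · subst hq'
          have := compare q hq (hV q hq le_rfl) 2 1 (by omega) (by omega)
            (fun U hUM hU hUd l hl => ⟨fun h => ?_, fun h => by omega⟩) p
          · exact this.1 (by omega)
          · obtain rfl : l = 1 := by omega
            exact hσ₁ hq U hUM hU hUd
        · obtain rfl : q = i + 1 := by omega
          -- `H_0` with coefficients in `H_{i+1}`
          have := compare (i + 1) hq hV' 1 0 (by omega) (by omega)
            (fun U hUM hU hUd l hl => ⟨fun h => by omega, fun h => by omega⟩) p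
          exact this.1 (by omega)
    exact semidirect_surjective (map_incl_autAction κ M) _ hl hr hinj hsurj' i
      (Or.inr ⟨rfl, trivial⟩)
      ((sigma_empty_surjective_iff M (i + 1)).1 hσ₀')
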